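/- **Lemma.** Weighted Subset Feedback Vertex Set is polynomial-time solvable for $(3P_1+P_2)$-free graphs. Here all graphs are finite, undirected and simple. For a graph $G=(V,E)$ and $T\subseteq V$, a *$T$-cycle* is a cycle of $G$ that contains a vertex of $T$, and a set $S_T\subseteq V$ is a *$T$-feedback vertex set* of $G$ if it contains at least one vertex of every $T$-cycle. *Weighted Subset Feedback Vertex Set* is the following decision problem: given a graph $G$, a subset $T\subseteq V(G)$, a weighting $w$ that assigns to every vertex a non-negative real number, and an integer $k\ge 1$, decide whether $G$ has a $T$-feedback vertex set $S_T$ with $w(S_T)=\sum_{v\in S_T}w(v)\le k$. The graph $3P_1+P_2$ is the disjoint union of three isolated vertices and one edge, and $G$ is *$(3P_1+P_2)$-free* if no induced subgraph of $G$ is isomorphic to $3P_1+P_2$. Precisely: there are one program for a random access machine and one polynomial $p$ such that for every instance $(G,T,w,k)$ in which $G$ is $(3P_1+P_2)$-free with $n$ vertices, the program, started with $n$, the adjacency matrix of $G$, the characteristic vector of $T$, the weights and $k$ in its memory, halts after at most $p(n)$ time units with the correct answer. The machine stores integers and real numbers in arrays; reading or writing a cell, adding, subtracting and comparing two integers or two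 real numbers take one time unit each, the only real constant is $0$, and there is no multiplication, division or rounding. -/

import Mathlib

/-! ## While-programs on a random access machine with additive real arithmetic -/

namespace RAM

/-- Memory: two-dimensional arrays of natural numbers and two-dimensional arrays of real numbers,
named by `a = 0, 1, 2, …`.  Names are not computed, so a program uses only finitely many arrays. -/
structure State where
  nat : ℕ → ℕ → ℕ → ℕ
  real : ℕ → ℕ → ℕ → ℝ

/-- Integer expressions: constants, the cell `(i, j)` of array `a`, sum, truncated difference.
There is no multiplication: operations have unit cost, and with sums and differences only, the bit
length of a number grows by at most a constant in each step of a given program. -/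
inductive NatExpr where
  | const (c : ℕ)
  | cell (a : ℕ) (i j : NatExpr)
  | add (x y : NatExpr)
  | sub (x y : NatExpr)

/-- Real expressions: zero, the cell `(i, j)` of array `a`, sum, difference. -/
inductive RealExpr where
  | zero
  | cell (a : ℕ) (i j : NatExpr)
  | add (x y : RealExpr)
  | sub (x y : RealExpr)

/-- Tests: comparisons of integers and of reals, and Boolean combinations. -/
inductive Test where
  | natLE (x y : NatExpr)
  | natEq (x y : NatExpr)
  | realLE (x y : RealExpr)
  | not (b : Test)
  | and (b c : Test)
  | or (b c : Test)

/-- Programs.  `setNat a i j x` stores `x` in the cell `(i, j)` of the integer array `a`,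
and `setReal` does the same for real arrays. -/
inductive Program where
  | skip
  | setNat (a : ℕ) (i j x : NatExpr)
  | setReal (a : ℕ) (i j : NatExpr) (x : RealExpr)
  | seq (P Q : Program)
  | ite (b : Test) (P Q : Program)
  | while (b : Test) (P : Program)

def NatExpr.eval (s : State) : NatExpr → ℕ
  | const c => c
  | cell a i j => s.nat a (i.eval s) (j.eval s)
  | add x y => x.eval s + y.eval s
  | sub x y => x.eval s - y.eval s

noncomputable def RealExpr.eval (s : State) : RealExpr → ℝ
  | zero => 0
  | cell a i j => s.real a (i.eval s) (j.eval s)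
  | add x y => x.eval s + y.eval s
  | sub x y => x.eval s - y.eval s

def Test.Holds (s : State) : Test → Prop
  | natLE x y => x.eval s ≤ y.eval s
  | natEq x y => x.eval s = y.eval s
  | realLE x y => x.eval s ≤ y.eval s
  | not b => ¬ b.Holds s
  | and b c => b.Holds s ∧ c.Holds s
  | or b c => b.Holds s ∨ c.Holds s

/-- The cost of evaluating an expression: one unit for every operation and every memory access. -/
def NatExpr.cost : NatExpr → ℕ
  | const _ => 1
  | cell _ i j => i.cost + j.cost + 1
  | add x y => x.cost + y.cost + 1
  | sub x y => x.cost + y.cost + 1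

def RealExpr.cost : RealExpr → ℕ
  | zero => 1
  | cell _ i j => i.cost + j.cost + 1
  | add x y => x.cost + y.cost + 1
  | sub x y => x.cost + y.cost + 1

def Test.cost : Test → ℕ
  | natLE x y => x.cost + y.cost + 1
  | natEq x y => x.cost + y.cost + 1
  | realLE x y => x.cost + y.cost + 1
  | not b => b.cost + 1
  | and b c => b.cost + c.cost + 1
  | or b c => b.cost + c.cost + 1

def State.setNat (s : State) (a i j v : ℕ) : State where
  nat a' i' j' := if a' = a ∧ i' = i ∧ j' = j then v else s.nat a' i' j'
  real := s.real

noncomputable def State.setReal (s : State) (a i j : ℕ) (v : ℝ) : State where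
  nat := s.nat
  real a' i' j' := if a' = a ∧ i' = i ∧ j' = j then v else s.real a' i' j'

/-- `Exec P s t s'`: started in memory `s`, the program `P` halts after exactly `t` time units
with memory `s'`. -/
inductive Exec : Program → State → ℕ → State → Prop where
  | skip (s : State) : Exec .skip s 1 s
  | setNat (s : State) (a : ℕ) (i j x : NatExpr) :
      Exec (.setNat a i j x) s (i.cost + j.cost + x.cost + 1)
        (s.setNat a (i.eval s) (j.eval s) (x.eval s))
  | setReal (s : State) (a : ℕ) (i j : NatExpr) (x : RealExpr) :
      Exec (.setReal a i j x) s (i.cost + j.cost + x.cost + 1)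
        (s.setReal a (i.eval s) (j.eval s) (x.eval s))
  | seq {P Q : Program} {s s' s'' : State} {t u : ℕ} :
      Exec P s t s' → Exec Q s' u s'' → Exec (.seq P Q) s (t + u + 1) s''
  | iteTrue {b : Test} {P Q : Program} {s s' : State} {t : ℕ} :
      b.Holds s → Exec P s t s' → Exec (.ite b P Q) s (b.cost + t + 1) s'
  | iteFalse {b : Test} {P Q : Program} {s s' : State} {t : ℕ} :
      ¬ b.Holds s → Exec Q s t s' → Exec (.ite b P Q) s (b.cost + t + 1) s'
  | whileTrue {b : Test} {P : Program} {s s' s'' : State} {t u : ℕ} :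
      b.Holds s → Exec P s t s' → Exec (.while b P) s' u s'' →
        Exec (.while b P) s (b.cost + t + u + 1) s''
  | whileFalse {b : Test} {P : Program} {s : State} :
      ¬ b.Holds s → Exec (.while b P) s (b.cost + 1) s

end RAM

/-! ## Weighted Subset Feedback Vertex Set -/

/-- `S` is a `T`-feedback vertex set of `G`: it meets every cycle of `G` that meets `T`. -/
def SimpleGraph.IsSubsetFeedbackVertexSet {V : Type*} (G : SimpleGraph V) (T S : Finset V) : Prop :=
  ∀ (v : V) (c : G.Walk v v), c.IsCycle → (∃ x ∈ c.support, x ∈ T) → ∃ x ∈ c.support, x ∈ S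

/-- An instance of Weighted Subset Feedback Vertex Set (with vertices numbered `0, …, n - 1`). -/
structure WSFVS where
  n : ℕ
  G : SimpleGraph (Fin n)
  T : Finset (Fin n)
  w : Fin n → ℝ
  w_nonneg : ∀ v, 0 ≤ w v
  k : ℕ
  one_le_k : 1 ≤ k

namespace WSFVS

/-- The answer to the instance is "yes". -/
def IsYes (I : WSFVS) : Prop :=
  ∃ S : Finset (Fin I.n), I.G.IsSubsetFeedbackVertexSet I.T S ∧ ∑ v ∈ S, I.w v ≤ (I.k : ℝ)

open Classical in
/-- The initial memory for an instance.  Integer array `0` holds `n` in cell `(0, 0)`, integer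
array `1` the adjacency matrix of `G`, column `0` of integer array `2` the characteristic vector of
`T`, column `0` of real array `0` the weights, and cell `(0, 0)` of real array `1` the bound `k`.
All other cells are zero. -/
noncomputable def input (I : WSFVS) : RAM.State where
  nat a i j :=
    if a = 0 ∧ i = 0 ∧ j = 0 then I.n
    else if a = 1 ∧ (∃ (hi : i < I.n) (hj : j < I.n), I.G.Adj ⟨i, hi⟩ ⟨j, hj⟩) then 1
    else if a = 2 ∧ j = 0 ∧ (∃ hi : i < I.n, ⟨i, hi⟩ ∈ I.T) then 1
    else 0
  real a i j :=
    if h : a = 0 ∧ j = 0 ∧ i < I.n then I.w ⟨i, h.2.2⟩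
    else if a = 1 ∧ i = 0 ∧ j = 0 then (I.k : ℝ)
    else 0

/-- The program `P` answers the instance `I` within `t` time units: it halts by then, with
`1` (if the answer is yes) or `0` (if it is no) in cell `(0, 0)` of integer array `3`. -/
def DecidedWithin (I : WSFVS) (P : RAM.Program) (t : ℕ) : Prop :=
  ∃ (t' : ℕ) (s : RAM.State), RAM.Exec P I.input t' s ∧ t' ≤ t ∧
    (I.IsYes → s.nat 3 0 0 = 1) ∧ (¬ I.IsYes → s.nat 3 0 0 = 0)

/-- Weighted Subset Feedback Vertex Set is polynomial-time solvable on `H`-free graphs: one program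
answers every instance whose graph has no induced subgraph isomorphic to `H`, in time polynomial in
the number of vertices. -/
def PolyTimeSolvableOnFree {U : Type*} (H : SimpleGraph U) : Prop :=
  ∃ (P : RAM.Program) (p : Polynomial ℕ), ∀ I : WSFVS,
    ¬ H.IsIndContained I.G → I.DecidedWithin P (p.eval I.n)

end WSFVS

/-- The graph `3P₁ + P₂`. -/
def threeP1AddP2 : SimpleGraph (((Fin 1 ⊕ Fin 1) ⊕ Fin 1) ⊕ Fin 2) :=
  ((SimpleGraph.pathGraph 1 ⊕g SimpleGraph.pathGraph 1) ⊕g SimpleGraph.pathGraph 1) ⊕g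
    SimpleGraph.pathGraph 2

/-! ## For-programs: while-programs all of whose loops run a counter up to a fixed bound -/

namespace RAM

/-! A set is a `T`-feedback vertex set exactly when its complement `F` is a subset forest: no cycle
inside `F` meets `T` (`isSubsetFeedbackVertexSet_iff`). The task is therefore to find a heaviest
subset forest.

Structure (`IsSubsetForest.exists_isGuess`). Consider the components of `F \ T`. If each has a
vertex meeting all its edges, then `F` has neither triangles nor four-cycles, and freeness leaves
two cases: `F` has at most 17 vertices, or one vertex `c` meets all edges of `F`. In the latter case
fix three vertices of `F` other than `c`; two adjacent vertices anticomplete to them would complete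
an induced `3P₁ + P₂`, so all vertices without neighbours among the three may be added freely.
Otherwise some component is wide: every vertex misses one of its edges. A vertex of `F ∩ T` has at
most one neighbour in each component, and edges of the wide component away from such neighbours
bound `F ∩ T` by 14; if `F ∩ T` is nonempty, they also leave, apart from the wide component and at
most one isolated vertex, at most one further component. It then suffices to know `A`, consisting of
`F ∩ T` and the isolated vertex, and the vertices `X`, `Y` at which the two components are attached
to `F ∩ T`. The rest of the components may be replaced by any sets `P`, `Q` with no vertex in common
and no edge between them, avoiding `T`, `A`, `X`, `Y`, the neighbours of `A`, and those of `Y` and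
`X` respectively: detours through them enter and leave at vertices that are joined anyway
(`IsSubsetForest.union_region`).

Optimisation. For given `A`, `X`, `Y`, a heaviest pair `P`, `Q` is a heaviest independent set of a
bipartite graph, hence a minimum cut (`max_independent_of_min_cut`). Augmenting along shortest paths
with distance labels needs only sums, differences and comparisons of reals, and a potential bounds
the number of steps in terms of the number of nodes alone.

Machine. Nested loops try all tuples of 51 slots and a flag. Each candidate is weighed and checked
to be a subset forest before "yes" is recorded, so wrong guesses do no harm, and the guess belonging
to an optimal `F` succeeds. All loops share the bound `N = 2n + 2`, the number of nodes of the
network, so the running time is polynomial by the form of the program (`exec_toProgram`). -/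

@[simp] theorem State.setNat_nat (s : State) (a i j v a' i' j' : ℕ) :
    (s.setNat a i j v).nat a' i' j' = if a' = a ∧ i' = i ∧ j' = j then v else s.nat a' i' j' := rfl

@[simp] theorem State.setNat_real (s : State) (a i j v : ℕ) :
    (s.setNat a i j v).real = s.real := rfl

@[simp] theorem State.setReal_nat (s : State) (a i j : ℕ) (v : ℝ) :
    (s.setReal a i j v).nat = s.nat := rfl

@[simp] theorem State.setReal_real (s : State) (a i j : ℕ) (v : ℝ) (a' i' j' : ℕ) :
    (s.setReal a i j v).real a' i' j' =
      if a' = a ∧ i' = i ∧ j' = j then v else s.real a' i' j' := rfl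

theorem State.setNat_nat_of_ne (s : State) {a i j v a' : ℕ} (h : a' ≠ a) :
    (s.setNat a i j v).nat a' = s.nat a' := by
  funext i' j'; simp [h]

theorem State.setReal_real_of_ne (s : State) {a i j : ℕ} {v : ℝ} {a' : ℕ} (h : a' ≠ a) :
    (s.setReal a i j v).real a' = s.real a' := by
  funext i' j'; simp [h]

attribute [simp] NatExpr.eval RealExpr.eval Test.Holds

/-- Programs with bounded loops only: `loop a P` runs the cell `(0, 0)` of the integer array `a`
through `0, …, N - 1`, where `N` is the content of the cell `(0, 0)` of the integer array `4`. -/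
inductive Cmd where
  | skip
  | setNat (a : ℕ) (i j x : NatExpr)
  | setReal (a : ℕ) (i j : NatExpr) (x : RealExpr)
  | seq (P Q : Cmd)
  | ite (b : Test) (P Q : Cmd)
  | loop (a : ℕ) (P : Cmd)

namespace Cmd

/-- Iteration of a step that depends on the number of the round. -/
def iter (f : ℕ → State → State) : ℕ → State → State
  | 0, s => s
  | k + 1, s => f k (iter f k s)

/-- The memory after running a for-program whose loop bound is `N`. -/
noncomputable def sem (N : ℕ) : Cmd → State → State
  | skip, s => s
  | setNat a i j x, s => s.setNat a (i.eval s) (j.eval s) (x.eval s)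
  | setReal a i j x, s => s.setReal a (i.eval s) (j.eval s) (x.eval s)
  | seq P Q, s => Q.sem N (P.sem N s)
  | ite b P Q, s => by classical exact if b.Holds s then P.sem N s else Q.sem N s
  | loop a P, s => (iter (fun k s => P.sem N (s.setNat a 0 0 k)) N s).setNat a 0 0 N

/-- The integer arrays that a for-program may change. -/
def natWrites : Cmd → List ℕ
  | skip => []
  | setNat a _ _ _ => [a]
  | setReal _ _ _ _ => []
  | seq P Q => P.natWrites ++ Q.natWrites
  | ite _ P Q => P.natWrites ++ Q.natWrites
  | loop a P => a :: P.natWrites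

/-- The real arrays that a for-program may change. -/
def realWrites : Cmd → List ℕ
  | skip => []
  | setNat _ _ _ _ => []
  | setReal a _ _ _ => [a]
  | seq P Q => P.realWrites ++ Q.realWrites
  | ite _ P Q => P.realWrites ++ Q.realWrites
  | loop _ P => P.realWrites

/-- No loop body changes the counter of the loop, and the loop bound is never changed. -/
def WF : Cmd → Prop
  | skip => True
  | setNat a _ _ _ => a ≠ 4
  | setReal _ _ _ _ => True
  | seq P Q => P.WF ∧ Q.WF
  | ite _ P Q => P.WF ∧ Q.WF
  | loop a P => P.WF ∧ a ≠ 4 ∧ a ∉ P.natWrites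

/-- The underlying while-program. -/
def toProgram : Cmd → Program
  | skip => .skip
  | setNat a i j x => .setNat a i j x
  | setReal a i j x => .setReal a i j x
  | seq P Q => .seq P.toProgram Q.toProgram
  | ite b P Q => .ite b P.toProgram Q.toProgram
  | loop a P => .seq (.setNat a (.const 0) (.const 0) (.const 0))
      (.while (.not (.natLE (.cell 4 (.const 0) (.const 0)) (.cell a (.const 0) (.const 0))))
        (.seq P.toProgram (.setNat a (.const 0) (.const 0)
          (.add (.cell a (.const 0) (.const 0)) (.const 1)))))

/-- A bound for the running time as a polynomial in the loop bound. -/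
noncomputable def time : Cmd → Polynomial ℕ
  | skip => 1
  | setNat _ i j x => Polynomial.C (i.cost + j.cost + x.cost + 1)
  | setReal _ i j x => Polynomial.C (i.cost + j.cost + x.cost + 1)
  | seq P Q => P.time + Q.time + 1
  | ite b P Q => Polynomial.C b.cost + P.time + Q.time + 1
  | loop _ P => Polynomial.X * (P.time + 18) + 14

variable {N : ℕ}

theorem sem_ite_pos {b : Test} {P Q : Cmd} {s : State} (h : b.Holds s) :
    (ite b P Q).sem N s = P.sem N s := by simp [sem, h]

theorem sem_ite_neg {b : Test} {P Q : Cmd} {s : State} (h : ¬ b.Holds s) :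
    (ite b P Q).sem N s = Q.sem N s := by simp [sem, h]

theorem iter_ind {f : ℕ → State → State} (I : ℕ → State → Prop) {s : State} (h0 : I 0 s)
    (K : ℕ) (hs : ∀ k < K, ∀ s, I k s → I (k + 1) (f k s)) : I K (iter f K s) := by
  induction K with
  | zero => exact h0
  | succ K ih => exact hs K (Nat.lt_succ_self K) _ (ih fun k hk => hs k (hk.trans (Nat.lt_succ_self K)))

/-- Since `natWrites` is a computed list, such frame conditions reduce to `decide` for concrete
programs. -/
theorem sem_nat (c : Cmd) (s : State) {a : ℕ} (ha : a ∉ c.natWrites) :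
    (c.sem N s).nat a = s.nat a := by
  induction c generalizing s with
  | skip => rfl
  | setNat b i j x =>
    simp only [natWrites, List.mem_singleton] at ha
    exact State.setNat_nat_of_ne _ ha
  | setReal b i j x => rfl
  | seq P Q hP hQ =>
    simp only [natWrites, List.mem_append, not_or] at ha
    simp only [sem]
    rw [hQ _ ha.2, hP _ ha.1]
  | ite b P Q hP hQ =>
    simp only [natWrites, List.mem_append, not_or] at ha
    by_cases h : b.Holds s
    · rw [sem_ite_pos h, hP _ ha.1]
    · rw [sem_ite_neg h, hQ _ ha.2]
  | loop b P hP =>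
    simp only [natWrites, List.mem_cons, not_or] at ha
    simp only [sem]
    rw [State.setNat_nat_of_ne _ ha.1]
    refine iter_ind (fun _ s' => s'.nat a = s.nat a) rfl N fun k _ s' hs' => ?_
    rw [hP _ ha.2, State.setNat_nat_of_ne _ ha.1, hs']

theorem sem_real (c : Cmd) (s : State) {a : ℕ} (ha : a ∉ c.realWrites) :
    (c.sem N s).real a = s.real a := by
  induction c generalizing s with
  | skip => rfl
  | setNat b i j x => rfl
  | setReal b i j x =>
    simp only [realWrites, List.mem_singleton] at ha
    exact State.setReal_real_of_ne _ ha
  | seq P Q hP hQ =>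
    simp only [realWrites, List.mem_append, not_or] at ha
    simp only [sem]
    rw [hQ _ ha.2, hP _ ha.1]
  | ite b P Q hP hQ =>
    simp only [realWrites, List.mem_append, not_or] at ha
    by_cases h : b.Holds s
    · rw [sem_ite_pos h, hP _ ha.1]
    · rw [sem_ite_neg h, hQ _ ha.2]
  | loop b P hP =>
    simp only [realWrites] at ha
    simp only [sem, State.setNat_real]
    refine iter_ind (fun _ s' => s'.real a = s.real a) rfl N fun k _ s' hs' => ?_
    rw [hP _ ha, State.setNat_real, hs']

/-- `s` agrees with `s₀` on all arrays that `c` does not change. -/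
def Frame (c : Cmd) (s₀ s : State) : Prop :=
  (∀ a ∉ c.natWrites, s.nat a = s₀.nat a) ∧ ∀ a ∉ c.realWrites, s.real a = s₀.real a

/-- Loop invariants; the invariant need not mention arrays that the loop does not change. -/
theorem sem_loop_ind {a : ℕ} {c : Cmd} {s₀ : State} (I : ℕ → State → Prop) {Q : State → Prop}
    (h0 : I 0 s₀)
    (hs : ∀ k < N, ∀ s, (loop a c).Frame s₀ s → I k s → I (k + 1) (c.sem N (s.setNat a 0 0 k)))
    (hQ : ∀ s, (loop a c).Frame s₀ s → I N s → Q (s.setNat a 0 0 N)) :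
    Q ((loop a c).sem N s₀) := by
  have key := iter_ind (f := fun k s => c.sem N (s.setNat a 0 0 k))
    (fun k s => (loop a c).Frame s₀ s ∧ I k s) (s := s₀)
    ⟨⟨fun _ _ => rfl, fun _ _ => rfl⟩, h0⟩ N ?_
  · exact hQ _ key.1 key.2
  · rintro k hk s ⟨hf, hI⟩
    refine ⟨⟨fun b hb => ?_, fun b hb => ?_⟩, hs k hk s hf hI⟩
    · rw [← hf.1 b hb]
      simp only [natWrites, List.mem_cons, not_or] at hb
      rw [sem_nat _ _ hb.2, State.setNat_nat_of_ne _ hb.1]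
    · rw [← hf.2 b hb, sem_real c _ hb, State.setNat_real]

theorem four_notMem_natWrites {c : Cmd} (hc : c.WF) : 4 ∉ c.natWrites := by
  induction c with
  | skip => simp [natWrites]
  | setNat a i j x => simpa [natWrites, WF, eq_comm] using hc
  | setReal a i j x => simp [natWrites]
  | seq P Q hP hQ => simp [natWrites, hP hc.1, hQ hc.2]
  | ite b P Q hP hQ => simp [natWrites, hP hc.1, hQ hc.2]
  | loop a P hP => simp [natWrites, hP hc.1, hc.2.1.symm]

/-- The meaning `sem` resets the counter before every round, whereas the while-program increments
it. The two agree because a well-formed body touches neither the counter nor the cell with the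
bound. -/
theorem exec_toProgram {c : Cmd} (hc : c.WF) {s : State} (hN : s.nat 4 0 0 = N) :
    ∃ t ≤ c.time.eval N, Exec c.toProgram s t (c.sem N s) := by
  induction c generalizing s with
  | skip => exact ⟨1, by simp [time], .skip s⟩
  | setNat a i j x => exact ⟨_, by simp [time], .setNat s a i j x⟩
  | setReal a i j x => exact ⟨_, by simp [time], .setReal s a i j x⟩
  | seq P Q hP hQ =>
    obtain ⟨t, ht, h⟩ := hP hc.1 hN
    obtain ⟨u, hu, h'⟩ := hQ hc.2 (s := P.sem N s)
      (by rw [sem_nat _ _ (four_notMem_natWrites hc.1), hN])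
    exact ⟨_, by simp only [time, Polynomial.eval_add, Polynomial.eval_one]; omega, h.seq h'⟩
  | ite b P Q hP hQ =>
    obtain ⟨t, ht, h⟩ := hP hc.1 hN
    obtain ⟨u, hu, h'⟩ := hQ hc.2 hN
    by_cases hb : b.Holds s
    · rw [sem_ite_pos hb]
      refine ⟨_, ?_, .iteTrue hb h⟩
      simp only [time, Polynomial.eval_add, Polynomial.eval_one, Polynomial.eval_C]; omega
    · rw [sem_ite_neg hb]
      refine ⟨_, ?_, .iteFalse hb h'⟩
      simp only [time, Polynomial.eval_add, Polynomial.eval_one, Polynomial.eval_C]; omega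
  | loop a P hP =>
    obtain ⟨hc1, hc2, hc3⟩ := hc
    set f : ℕ → State → State := fun k s => P.sem N (s.setNat a 0 0 k) with hf
    have h4 : ∀ k, (iter f k s).nat 4 0 0 = N := by
      intro k
      induction k with
      | zero => exact hN
      | succ k ih =>
        simp only [iter, hf]
        rw [sem_nat _ _ (four_notMem_natWrites hc1), State.setNat_nat_of_ne _ hc2.symm]
        exact ih
    -- Here `m` rounds are still to come. Test, increment and sequencing cost 18 per round besides
    -- the body, and the last, failing test costs 9.
    have key : ∀ m k, k + m = N → ∃ t ≤ m * (P.time.eval N + 18) + 9,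
        Exec (.while (.not (.natLE (.cell 4 (.const 0) (.const 0)) (.cell a (.const 0) (.const 0))))
          (.seq P.toProgram (.setNat a (.const 0) (.const 0)
          (.add (.cell a (.const 0) (.const 0)) (.const 1)))))
          ((iter f k s).setNat a 0 0 k) t ((iter f N s).setNat a 0 0 N) := by
      intro m
      induction m with
      | zero =>
        rintro k rfl
        refine ⟨_, ?_, .whileFalse ?_⟩
        · simp [Test.cost, NatExpr.cost]
        · simp [hc2.symm, h4]
      | succ m ih =>
        intro k hk
        obtain ⟨t, ht, h⟩ := ih (k + 1) (by omega)
        obtain ⟨u, hu, h'⟩ := hP hc1 (s := (iter f k s).setNat a 0 0 k)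
          (by rw [State.setNat_nat_of_ne _ hc2.symm, h4])
        have e : (P.sem N ((iter f k s).setNat a 0 0 k)).nat a 0 0 = k := by
          rw [sem_nat _ _ hc3]; simp
        have h'' := h'.seq (Exec.setNat _ a (.const 0) (.const 0)
          (.add (.cell a (.const 0) (.const 0)) (.const 1)))
        simp only [NatExpr.eval, e] at h''
        refine ⟨_, ?_, Exec.whileTrue ?_ h'' h⟩
        · simp only [Test.cost, NatExpr.cost]
          rw [Nat.succ_mul]
          omega
        · simp only [Test.Holds, NatExpr.eval]
          rw [State.setNat_nat_of_ne _ hc2.symm, h4]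
          simp; omega
    obtain ⟨t, ht, h⟩ := key N 0 (by omega)
    refine ⟨_, ?_, Exec.seq (Exec.setNat s a (.const 0) (.const 0) (.const 0)) h⟩
    simp only [time, NatExpr.cost, Polynomial.eval_add, Polynomial.eval_mul, Polynomial.eval_X,
      Polynomial.eval_ofNat]
    omega

end Cmd

/-- The disjunction of the tests `f 0, …, f (k - 1)`. -/
def Test.any (f : ℕ → Test) : ℕ → Test
  | 0 => .not (.natEq (.const 0) (.const 0))
  | k + 1 => .or (Test.any f k) (f k)

@[simp] theorem Test.holds_any {f : ℕ → Test} {k : ℕ} {s : State} :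
    (Test.any f k).Holds s ↔ ∃ i < k, (f i).Holds s := by
  induction k with
  | zero => simp [Test.any]
  | succ k ih => simp only [Test.any, Test.Holds, ih, Order.lt_add_one_iff, Nat.le_iff_lt_or_eq,
      or_and_right, exists_or, exists_eq_left]

end RAM

/-! ## Subset forests -/

namespace SimpleGraph

variable {V : Type*} (G : SimpleGraph V)

/-- `x` and `y` are joined by a walk of `G` inside `S` (or equal). -/
def ReachIn (S : Set V) : V → V → Prop :=
  Relation.ReflTransGen fun x y => G.Adj x y ∧ x ∈ S ∧ y ∈ S

/-- The subgraph induced by `F` has no cycle that meets `T`. -/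
def IsSubsetForest (T F : Set V) : Prop :=
  ∀ t ∈ T, t ∈ F → ∀ u ∈ F, ∀ v ∈ F, G.Adj t u → G.Adj t v → G.ReachIn (F \ {t}) u v → u = v

/-- No induced subgraph consists of three isolated vertices and an edge. -/
def AvoidsThreeP1AddP2 : Prop :=
  ∀ a b c u v, G.Adj u v → a ≠ b → a ≠ c → b ≠ c → ¬ G.Adj a b → ¬ G.Adj a c → ¬ G.Adj b c →
    (∀ z, z = a ∨ z = b ∨ z = c → z ≠ u ∧ z ≠ v ∧ ¬ G.Adj z u ∧ ¬ G.Adj z v) → False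

/-- No two vertices of `P` and `Q` are equal or adjacent. -/
def Separated (P Q : Set V) : Prop := ∀ p ∈ P, ∀ q ∈ Q, p ≠ q ∧ ¬ G.Adj p q

/-- The vertices outside `A ∪ X ∪ Y` without neighbours in `A ∪ Z`; those in `T` are admitted only
if `m` holds. -/
def region (T : Set V) (m : Prop) (A X Y Z : Set V) : Set V :=
  {v | (m ∨ v ∉ T) ∧ v ∉ A ∧ v ∉ X ∧ v ∉ Y ∧ (∀ a ∈ A, ¬ G.Adj v a) ∧ ∀ z ∈ Z, ¬ G.Adj v z}

variable {G} {T F S : Set V}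

theorem ReachIn.symm {x y : V} (h : G.ReachIn S x y) : G.ReachIn S y x := by
  induction h with
  | refl => exact .refl
  | tail _ h ih => exact .head ⟨h.1.symm, h.2.2, h.2.1⟩ ih

theorem ReachIn.trans {x y z : V} (h : G.ReachIn S x y) (h' : G.ReachIn S y z) :
    G.ReachIn S x z :=
  Relation.ReflTransGen.trans h h'

theorem ReachIn.mono {S' : Set V} (hS : S ⊆ S') {x y : V} (h : G.ReachIn S x y) :
    G.ReachIn S' x y :=
  Relation.ReflTransGen.mono (fun _ _ h => ⟨h.1, hS h.2.1, hS h.2.2⟩) _ _ h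

theorem Adj.reachIn {x y : V} (h : G.Adj x y) (hx : x ∈ S) (hy : y ∈ S) : G.ReachIn S x y :=
  .single ⟨h, hx, hy⟩

theorem ReachIn.mem {x y : V} (h : G.ReachIn S x y) (hx : x ∈ S) : y ∈ S := by
  induction h with
  | refl => exact hx
  | tail _ h _ => exact h.2.2

theorem ReachIn.eq_or_adj {x y : V} (h : G.ReachIn S x y) :
    y = x ∨ ∃ z ∈ S, G.Adj x z ∧ x ∈ S := by
  induction h using Relation.ReflTransGen.head_induction_on with
  | refl => exact .inl rfl
  | head h _ _ => exact .inr ⟨_, h.2.2, h.1, h.2.1⟩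

/-- Vertices of a subset forest may be joined by further walks through sets `P` and `Q`, as long as
the vertices at which `P` (and likewise `Q`) is attached are joined anyhow. -/
theorem IsSubsetForest.union_region (hF : G.IsSubsetForest T F) {A X Y P Q : Set V}
    (hA : A ⊆ F) (hX : X ⊆ F \ T) (hY : Y ⊆ F \ T)
    (hXX : ∀ x ∈ X, ∀ x' ∈ X, G.ReachIn (F \ T) x x')
    (hYY : ∀ y ∈ Y, ∀ y' ∈ Y, G.ReachIn (F \ T) y y')
    (hP : P ⊆ G.region T False A X Y Y) (hQ : Q ⊆ G.region T False A X Y X)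
    (hPQ : G.Separated P Q) :
    G.IsSubsetForest T (A ∪ X ∪ Y ∪ P ∪ Q) := by
  intro t htT ht u hu v hv htu htv huv
  have hK : A ∪ X ∪ Y ⊆ F := by
    rintro z ((hz | hz) | hz)
    exacts [hA hz, (hX hz).1, (hY hz).1]
  -- With the flag `False` the regions avoid `T`, as do `X` and `Y`, so vertices of `T` can only
  -- come from `A`.
  have htA : t ∈ A := by
    rcases ht with (((h | h) | h) | h) | h
    · exact h
    · exact absurd htT (hX h).2
    · exact absurd htT (hY h).2
    · exact absurd htT ((hP h).1.resolve_left id)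
    · exact absurd htT ((hQ h).1.resolve_left id)
  have hFt : F \ T ⊆ F \ {t} := fun z hz => ⟨hz.1, fun h => hz.2 (by rw [h]; exact htT)⟩
  have hin : ∀ z, z ∈ A ∪ X ∪ Y ∪ P ∪ Q → G.Adj t z → z ∈ A ∪ X ∪ Y := by
    rintro z ((hz | hz) | hz) h
    · exact hz
    · exact absurd h.symm ((hP hz).2.2.2.2.1 t htA)
    · exact absurd h.symm ((hQ hz).2.2.2.2.1 t htA)
  have huK := hin u hu htu
  have hvK := hin v hv htv
  refine hF t htT (hA htA) u (hK huK) v (hK hvK) htu htv ?_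
  -- The statement is strengthened for induction along the walk: while the walk is inside `P`, all
  -- of `X` is already joined to `u` without `t`, so that leaving `P` through `X` gains nothing;
  -- likewise for `Q` and `Y`.
  suffices H : (v ∈ A ∪ X ∪ Y → G.ReachIn (F \ {t}) u v) ∧
      (v ∈ P → ∀ x ∈ X, G.ReachIn (F \ {t}) u x) ∧
      (v ∈ Q → ∀ y ∈ Y, G.ReachIn (F \ {t}) u y) from H.1 hvK
  clear htv hvK hv
  have dP : ∀ z ∈ P, z ∉ A ∪ X ∪ Y := fun z hz h => by
    obtain ⟨-, h1, h2, h3, -⟩ := hP hz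
    rcases h with (h | h) | h <;> contradiction
  have dQ : ∀ z ∈ Q, z ∉ A ∪ X ∪ Y := fun z hz h => by
    obtain ⟨-, h1, h2, h3, -⟩ := hQ hz
    rcases h with (h | h) | h <;> contradiction
  have key : ∀ p ∈ P, ∀ z ∈ A ∪ X ∪ Y, G.Adj p z → z ∈ X := by
    rintro p hp z ((hz | hz) | hz) h
    · exact absurd h ((hP hp).2.2.2.2.1 z hz)
    · exact hz
    · exact absurd h ((hP hp).2.2.2.2.2 z hz)
  have key' : ∀ q ∈ Q, ∀ z ∈ A ∪ X ∪ Y, G.Adj q z → z ∈ Y := by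
    rintro q hq z ((hz | hz) | hz) h
    · exact absurd h ((hQ hq).2.2.2.2.1 z hz)
    · exact absurd h ((hQ hq).2.2.2.2.2 z hz)
    · exact hz
  induction huv with
  | refl => exact ⟨fun _ => .refl, fun h => absurd huK (dP _ h), fun h => absurd huK (dQ _ h)⟩
  | @tail b c _ hbc ih =>
    obtain ⟨hadj, ⟨hb, hbt⟩, hc, hct⟩ := hbc
    refine ⟨fun hcK => ?_, fun hcP => ?_, fun hcQ => ?_⟩
    · rcases hb with (hb | hb) | hb
      · exact (ih.1 hb).trans (hadj.reachIn ⟨hK hb, hbt⟩ ⟨hK hcK, hct⟩)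
      · exact ih.2.1 hb c (key b hb c hcK hadj)
      · exact ih.2.2 hb c (key' b hb c hcK hadj)
    · intro x hx
      rcases hb with (hb | hb) | hb
      · exact (ih.1 hb).trans ((hXX b (key c hcP b hb hadj.symm) x hx).mono hFt)
      · exact ih.2.1 hb x hx
      · exact absurd hadj.symm (hPQ c hcP b hb).2
    · intro y hy
      rcases hb with (hb | hb) | hb
      · exact (ih.1 hb).trans ((hYY b (key' c hcQ b hb hadj.symm) y hy).mono hFt)
      · exact absurd hadj (hPQ b hb c hcQ).2
      · exact ih.2.2 hb y hy

/-- A set that is independent up to one vertex is a subset forest. -/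
theorem isSubsetForest_of_indep {c : V} (h : ∀ x ∈ F, ∀ y ∈ F, x ≠ c → y ≠ c → ¬ G.Adj x y) :
    G.IsSubsetForest T F := by
  intro t _ ht u hu v hv htu htv huv
  -- A walk avoiding `c` uses no edge, hence is constant; and a vertex other than `c` has no
  -- neighbour but `c`.
  by_cases htc : t = c
  · rcases huv.eq_or_adj with h' | ⟨z, hz, h', -⟩
    · exact h'.symm
    · exact absurd h' (h u hu z hz.1 (htc ▸ htu.ne') (htc ▸ hz.2))
  · have h1 : u = c := by_contra fun h' => h t ht u hu htc h' htu
    have h2 : v = c := by_contra fun h' => h t ht v hv htc h' htv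
    rw [h1, h2]

/-- The form in which the forest condition enters the structural arguments: a walk outside `T`
avoids `t`, so `t` has at most one neighbour in each component of `F \ T`. -/
theorem IsSubsetForest.eq_of_reachIn (hF : G.IsSubsetForest T F) {t u v : V} (htT : t ∈ T)
    (htF : t ∈ F) (hu : u ∈ F) (htu : G.Adj t u) (hv : v ∈ F) (htv : G.Adj t v)
    (h : G.ReachIn (F \ T) u v) : u = v :=
  hF t htT htF u hu v hv htu htv
    (h.mono (S' := F \ {t}) fun z hz => ⟨hz.1, fun h' => hz.2 (by rw [h']; exact htT)⟩)

/-! ### Bounds for triangle-free sets -/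

/-- The maximal number of vertices that `card_le_of_triangleFree` allows. -/
def triangleFreeBound : ℕ → ℕ
  | 0 => 0
  | k + 1 => triangleFreeBound k + (k + 2)

open Classical in
-- Ramsey recursion: the neighbours of a vertex `z` are independent, so at most `k + 1`; independent
-- sets of non-neighbours can be extended by `z`, so the bound for `k` applies to these; and `z`
-- itself counts one.
theorem card_le_of_triangleFree (k : ℕ) (Z : Finset V)
    (htri : ∀ x ∈ Z, ∀ y ∈ Z, ∀ z ∈ Z, G.Adj x y → G.Adj x z → ¬ G.Adj y z)
    (hind : ∀ I ⊆ Z, (∀ x ∈ I, ∀ y ∈ I, ¬ G.Adj x y) → I.card ≤ k) :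
    Z.card ≤ triangleFreeBound k := by
  induction k generalizing Z with
  | zero =>
    rcases Z.eq_empty_or_nonempty with rfl | ⟨z, hz⟩
    · simp [triangleFreeBound]
    · have := hind {z} (by simpa using hz) (by simp)
      simp at this
  | succ k ih =>
    rcases Z.eq_empty_or_nonempty with rfl | ⟨z, hz⟩
    · simp
    have h1 : (Z.filter (G.Adj z)).card ≤ k + 1 :=
      hind _ (Finset.filter_subset _ _) fun x hx y hy => by
        rw [Finset.mem_filter] at hx hy
        exact htri z hz x hx.1 y hy.1 hx.2 hy.2
    have h2 : ((Z.erase z).filter fun x => ¬ G.Adj z x).card ≤ triangleFreeBound k := by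
      have hsub : ((Z.erase z).filter fun x => ¬ G.Adj z x) ⊆ Z :=
        (Finset.filter_subset _ _).trans (Finset.erase_subset _ _)
      refine ih _ (fun x hx y hy w hw => htri x (hsub hx) y (hsub hy) w (hsub hw)) ?_
      intro I hI hII
      have hzI : z ∉ I := fun h => by simpa using hI h
      have := hind (insert z I) (Finset.insert_subset hz (hI.trans hsub)) ?_
      · rw [Finset.card_insert_of_notMem hzI] at this; omega
      · intro x hx y hy
        have h' : ∀ x ∈ I, ¬ G.Adj z x := fun x hx => (Finset.mem_filter.1 (hI hx)).2
        rcases Finset.mem_insert.1 hx with rfl | hx' <;> rcases Finset.mem_insert.1 hy with rfl | hy'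
        · exact G.loopless.irrefl _
        · exact h' y hy'
        · exact fun h => h' x hx' h.symm
        · exact hII x hx' y hy'
    have h3 : Z ⊆ insert z (Z.filter (G.Adj z) ∪ (Z.erase z).filter fun x => ¬ G.Adj z x) := by
      intro x hx
      by_cases h : x = z <;> by_cases h' : G.Adj z x <;> simp [*]
    have h4 := Finset.card_le_card h3
    have h5 := Finset.card_insert_le z (Z.filter (G.Adj z) ∪ (Z.erase z).filter fun x => ¬ G.Adj z x)
    have h6 := Finset.card_union_le (Z.filter (G.Adj z)) ((Z.erase z).filter fun x => ¬ G.Adj z x)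
    simp only [triangleFreeBound]
    omega

theorem exists_three {I : Finset V} (h : 3 ≤ I.card) :
    ∃ a ∈ I, ∃ b ∈ I, ∃ c ∈ I, a ≠ b ∧ a ≠ c ∧ b ≠ c := by
  obtain ⟨a, ha, b, hb, c, hc, h⟩ := Finset.two_lt_card.1 h
  exact ⟨a, ha, b, hb, c, hc, h⟩

/-- An independent set without neighbours on an edge has at most two vertices. -/
theorem AvoidsThreeP1AddP2.card_le_two (hG : G.AvoidsThreeP1AddP2) {u v : V} (huv : G.Adj u v)
    {I : Finset V} (hI : ∀ x ∈ I, ∀ y ∈ I, ¬ G.Adj x y)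
    (h : ∀ x ∈ I, x ≠ u ∧ x ≠ v ∧ ¬ G.Adj x u ∧ ¬ G.Adj x v) : I.card ≤ 2 := by
  by_contra! h3
  obtain ⟨a, ha, b, hb, c, hc, hab, hac, hbc⟩ := exists_three h3
  refine hG a b c u v huv hab hac hbc (hI a ha b hb) (hI a ha c hc) (hI b hb c hc) ?_
  rintro z (rfl | rfl | rfl)
  exacts [h _ ha, h _ hb, h _ hc]

open Classical in
-- A neighbour of `u` is `x` or `y`, or a common neighbour of `u` with `x` or with `y` (at most one
-- each, for want of four-cycles), or belongs to the set `J`, which is independent and anticomplete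
-- to the edge `xy`, hence of size at most 2. The total is 2 + 1 + 1 + 2.
theorem card_le_six (hG : G.AvoidsThreeP1AddP2) {F : Finset V}
    (h3 : ∀ x ∈ F, ∀ y ∈ F, ∀ z ∈ F, G.Adj x y → G.Adj x z → ¬ G.Adj y z)
    (h4 : ∀ u ∈ F, ∀ x ∈ F, ∀ p ∈ F, ∀ q ∈ F, u ≠ x → G.Adj u p → G.Adj u q → G.Adj x p →
      G.Adj x q → p = q)
    {u : V} (hu : u ∈ F)
    (hc : ∃ x ∈ F, ∃ y ∈ F, x ≠ u ∧ y ≠ u ∧ G.Adj x y) :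
    (F.filter (G.Adj u)).card ≤ 6 := by
  obtain ⟨x, hx, y, hy, hxu, hyu, hxy⟩ := hc
  have h1 : ∀ x ∈ F, x ≠ u → (F.filter fun z => G.Adj u z ∧ G.Adj x z).card ≤ 1 := by
    intro x hx hxu
    refine Finset.card_le_one.2 fun p hp q hq => ?_
    simp only [Finset.mem_filter] at hp hq
    exact h4 u hu x hx p hp.1 q hq.1 hxu.symm hp.2.1 hq.2.1 hp.2.2 hq.2.2
  set J := F.filter fun z => G.Adj u z ∧ z ≠ x ∧ z ≠ y ∧ ¬ G.Adj z x ∧ ¬ G.Adj z y with hJ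
  have hJ2 : J.card ≤ 2 := by
    refine hG.card_le_two hxy (fun p hp q hq => ?_) fun p hp => ?_
    · simp only [hJ, Finset.mem_filter] at hp hq
      exact h3 u hu p hp.1 q hq.1 hp.2.1 hq.2.1
    · simp only [hJ, Finset.mem_filter] at hp
      exact hp.2.2
  have hsub : F.filter (G.Adj u) ⊆ ({x, y} : Finset V) ∪ (J ∪
      ((F.filter fun z => G.Adj u z ∧ G.Adj x z) ∪ (F.filter fun z => G.Adj u z ∧ G.Adj y z))) := by
    intro z hz
    simp only [Finset.mem_filter, Finset.mem_union, Finset.mem_insert, Finset.mem_singleton, hJ] at hz ⊢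
    rw [G.adj_comm z x, G.adj_comm z y]
    tauto
  have := Finset.card_le_card hsub
  have c1 := h1 x hx hxu
  have c2 := h1 y hy hyu
  have c3 : ({x, y} : Finset V).card ≤ 2 := Finset.card_le_two
  have c4 := Finset.card_union_le ({x, y} : Finset V) (J ∪
      ((F.filter fun z => G.Adj u z ∧ G.Adj x z) ∪ (F.filter fun z => G.Adj u z ∧ G.Adj y z)))
  have c5 := Finset.card_union_le J
      ((F.filter fun z => G.Adj u z ∧ G.Adj x z) ∪ (F.filter fun z => G.Adj u z ∧ G.Adj y z))
  have c6 := Finset.card_union_le (F.filter fun z => G.Adj u z ∧ G.Adj x z)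
    (F.filter fun z => G.Adj u z ∧ G.Adj y z)
  omega

open Classical in
/-- A set without triangles and four-cycles has bounded size, unless one vertex meets all its
edges. -/
theorem card_le_of_no_short_cycle (hG : G.AvoidsThreeP1AddP2) {F : Finset V}
    (h3 : ∀ x ∈ F, ∀ y ∈ F, ∀ z ∈ F, G.Adj x y → G.Adj x z → ¬ G.Adj y z)
    (h4 : ∀ u ∈ F, ∀ x ∈ F, ∀ p ∈ F, ∀ q ∈ F, u ≠ x → G.Adj u p → G.Adj u q → G.Adj x p →
      G.Adj x q → p = q)
    (hc : ∀ c ∈ F, ∃ x ∈ F, ∃ y ∈ F, x ≠ c ∧ y ≠ c ∧ G.Adj x y) : F.card ≤ 17 := by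
  rcases F.eq_empty_or_nonempty with rfl | ⟨w, hw⟩
  · simp
  obtain ⟨u, hu, v, hv, -, -, huv⟩ := hc w hw
  -- The set `Z` is anticomplete to the edge `uv`, so its independent sets have at most two vertices
  -- and it has at most 5. As `u` and `v` are neighbours of each other, the total is 6 + 6 + 5 = 17.
  set Z := F.filter fun z => z ≠ u ∧ z ≠ v ∧ ¬ G.Adj z u ∧ ¬ G.Adj z v with hZ
  have hZF : Z ⊆ F := Finset.filter_subset _ _
  have c1 : Z.card ≤ triangleFreeBound 2 := by
    refine card_le_of_triangleFree 2 Z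
      (fun x hx y hy z hz => h3 x (hZF hx) y (hZF hy) z (hZF hz)) fun I hI hII => ?_
    exact hG.card_le_two huv hII fun x hx => (Finset.mem_filter.1 (hI hx)).2
  have c2 := card_le_six hG h3 h4 hu (hc u hu)
  have c3 := card_le_six hG h3 h4 hv (hc v hv)
  have hsub : F ⊆ F.filter (G.Adj u) ∪ (F.filter (G.Adj v) ∪ Z) := by
    intro z hz
    simp only [Finset.mem_filter, Finset.mem_union, hZ]
    by_cases h : z = u
    · exact .inr (.inl ⟨hz, h ▸ huv.symm⟩)
    by_cases h' : z = v
    · exact .inl ⟨hz, h' ▸ huv⟩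
    rw [G.adj_comm z u, G.adj_comm z v]
    tauto
  have := Finset.card_le_card hsub
  have c4 := Finset.card_union_le (F.filter (G.Adj u)) (F.filter (G.Adj v) ∪ Z)
  have c5 := Finset.card_union_le (F.filter (G.Adj v)) Z
  simp only [triangleFreeBound] at c1
  omega

end SimpleGraph

/-! ### Bounded descriptions of subset forests -/

namespace SimpleGraph

variable {V : Type*} {G : SimpleGraph V} {T : Set V}

/-- The vertices of a set that are joined inside a subset forest and adjacent to one of the vertices
of `A ⊆ T` are at most as many as the vertices of `A`. -/
theorem IsSubsetForest.exists_attachment {F : Finset V} (hF : G.IsSubsetForest T F) {A : Finset V}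
    (hAF : A ⊆ F) (hAT : ∀ a ∈ A, a ∈ T) (C : Set V) (hC : C ⊆ ↑F \ T)
    (hCC : ∀ x ∈ C, ∀ y ∈ C, G.ReachIn (↑F \ T) x y) :
    ∃ X : Finset V, X.card ≤ A.card ∧ ∀ x, x ∈ X ↔ x ∈ C ∧ ∃ a ∈ A, G.Adj a x := by
  classical
  refine ⟨A.biUnion fun a => F.filter fun x => x ∈ C ∧ G.Adj a x, ?_, fun x => ?_⟩
  · refine (Finset.card_biUnion_le_card_mul _ _ 1 fun a ha => ?_).trans (by simp)
    refine Finset.card_le_one.2 fun x hx y hy => ?_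
    rw [Finset.mem_filter] at hx hy
    exact hF.eq_of_reachIn (hAT a ha) (hAF ha) hx.1 hx.2.2 hy.1 hy.2.2 (hCC x hx.2.1 y hy.2.1)
  · simp only [Finset.mem_biUnion, Finset.mem_filter]
    constructor
    · rintro ⟨a, ha, -, h1, h2⟩; exact ⟨h1, a, ha, h2⟩
    · rintro ⟨h1, a, ha, h2⟩; exact ⟨a, ha, (hC h1).1, h1, h2⟩

/-- A bounded description of a subset forest: the vertices of `A`, `X` and `Y`, to which any two
separated subsets of the corresponding regions may be added, and some do at least as well as `F`. -/
def IsGuess (G : SimpleGraph V) (T : Set V) (F : Finset V) (m : Prop) (A X Y : Finset V) : Prop :=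
  (∃ P Q : Set V, P ⊆ G.region T m A X Y Y ∧ Q ⊆ G.region T m A X Y X ∧ G.Separated P Q ∧
    (F : Set V) ⊆ ↑A ∪ ↑X ∪ ↑Y ∪ P ∪ Q) ∧
  ∀ P Q : Set V, P ⊆ G.region T m A X Y Y → Q ⊆ G.region T m A X Y X → G.Separated P Q →
    G.IsSubsetForest T (↑A ∪ ↑X ∪ ↑Y ∪ P ∪ Q)

/-- The description used when `F` is small: vertices outside `T` with no neighbour in `F` cannot
close a cycle through `T`. -/
theorem IsSubsetForest.isGuess_self {F : Finset V} (hF : G.IsSubsetForest T F) :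
    G.IsGuess T F False F ∅ ∅ := by
  refine ⟨⟨∅, ∅, by simp, by simp, by simp [Separated], by simp⟩, fun P Q hP hQ hPQ => ?_⟩
  exact hF.union_region subset_rfl (by simp) (by simp) (by simp) (by simp) hP hQ hPQ

theorem isGuess_of_indep [Fintype V] (hG : G.AvoidsThreeP1AddP2) {F : Finset V} {c : V}
    (hcF : ∀ x ∈ F, ∀ y ∈ F, x ≠ c → y ≠ c → ¬ G.Adj x y) {x y z : V} (hx : x ∈ F) (hy : y ∈ F)
    (hz : z ∈ F) (hxc : x ≠ c) (hyc : y ≠ c) (hzc : z ≠ c) (hxy : x ≠ y) (hxz : x ≠ z)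
    (hyz : y ≠ z) [DecidableEq V] : G.IsGuess T F True {x, y, z} {c} ∅ := by
  set A : Finset V := {x, y, z} with hA
  have hAF : ∀ a ∈ A, a ∈ F ∧ a ≠ c := by
    intro a ha
    simp only [hA, Finset.mem_insert, Finset.mem_singleton] at ha
    rcases ha with rfl | rfl | rfl <;> simp [*]
  have hAA : ∀ a ∈ A, ∀ b ∈ A, ¬ G.Adj a b := fun a ha b hb =>
    hcF a (hAF a ha).1 b (hAF b hb).1 (hAF a ha).2 (hAF b hb).2
  refine ⟨⟨↑F \ (↑A ∪ {c}), ∅, ?_, by simp, by simp [Separated], ?_⟩, fun P Q hP hQ _ => ?_⟩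
  · rintro v ⟨hv, hv'⟩
    simp only [Set.mem_union, Finset.mem_coe, Set.mem_singleton_iff, not_or] at hv'
    refine ⟨.inl trivial, hv'.1, by simpa using hv'.2, by simp, fun a ha => ?_, by simp⟩
    exact hcF v hv a (hAF a ha).1 hv'.2 (hAF a ha).2
  · intro v hv
    by_cases h : v ∈ A <;> by_cases h' : v = c <;> simp_all
  · have hI : ∀ Z : Set V, ∀ v ∈ G.region T True A ({c} : Finset V) (∅ : Finset V) Z,
        v ∉ A ∧ ∀ a ∈ A, ¬ G.Adj v a := fun Z v hv => ⟨hv.2.1, hv.2.2.2.2.1⟩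
    refine isSubsetForest_of_indep (c := c) ?_
    have key : ∀ v ∈ (↑A ∪ ↑({c} : Finset V) ∪ ↑(∅ : Finset V) ∪ P ∪ Q : Set V), v ≠ c →
        v ∈ A ∨ v ∉ A ∧ ∀ a ∈ A, ¬ G.Adj v a := by
      rintro v ((((hv | hv) | hv) | hv) | hv) hvc
      · exact .inl hv
      · exact absurd (by simpa using hv) hvc
      · simp at hv
      · exact .inr (hI _ v (hP hv))
      · exact .inr (hI _ v (hQ hv))
    intro u hu v hv huc hvc huv
    rcases key u hu huc with hu | ⟨huA, hu⟩ <;> rcases key v hv hvc with hv | ⟨hvA, hv⟩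
    · exact hAA u hu v hv huv
    · exact hv u hu huv.symm
    · exact hu v hv huv
    · have hxA : x ∈ A := by simp [hA]
      have hyA : y ∈ A := by simp [hA]
      have hzA : z ∈ A := by simp [hA]
      have := hG.card_le_two huv (I := A) hAA fun a ha =>
        ⟨fun h => huA (h ▸ ha), fun h => hvA (h ▸ ha), fun h => hu a ha h.symm,
          fun h => hv a ha h.symm⟩
      rw [hA, Finset.card_eq_three.2 ⟨x, y, z, hxy, hxz, hyz, rfl⟩] at this
      omega

variable {F : Finset V}

theorem IsSubsetForest.triangle_mem (hF : G.IsSubsetForest T F) {x y z : V} (hx : x ∈ F)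
    (hy : y ∈ F) (hz : z ∈ F) (hxy : G.Adj x y) (hxz : G.Adj x z) (hyz : G.Adj y z) : x ∉ T :=
  fun h => hyz.ne (hF x h hx y hy z hz hxy hxz
    (hyz.reachIn (S := (F : Set V) \ {x}) ⟨hy, hxy.ne'⟩ ⟨hz, hxz.ne'⟩))

theorem IsSubsetForest.square_mem (hF : G.IsSubsetForest T F) {u x p q : V} (hu : u ∈ F)
    (hx : x ∈ F) (hp : p ∈ F) (hq : q ∈ F) (hux : u ≠ x) (hpq : p ≠ q) (hup : G.Adj u p)
    (huq : G.Adj u q) (hxp : G.Adj x p) (hxq : G.Adj x q) : u ∉ T :=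
  fun h => hpq (hF u h hu p hp q hq hup huq
    ((hxp.symm.reachIn (S := (F : Set V) \ {u}) ⟨hp, hup.ne'⟩ ⟨hx, hux.symm⟩).trans
      (hxq.reachIn ⟨hx, hux.symm⟩ ⟨hq, huq.ne'⟩)))

/-- If one vertex meets all edges of each component outside `T`, there is a bounded description. -/
theorem IsSubsetForest.exists_isGuess_of_stars [Fintype V] (hG : G.AvoidsThreeP1AddP2)
    (hF : G.IsSubsetForest T F)
    (hstar : ∀ b ∈ ↑F \ T, ∃ c, ∀ x ∈ ↑F \ T, ∀ y ∈ ↑F \ T, G.ReachIn (↑F \ T) b x → G.Adj x y →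
      x = c ∨ y = c) :
    ∃ (m : Prop) (A X Y : Finset V), A.card ≤ 17 ∧ X.card ≤ 17 ∧ Y.card ≤ 17 ∧
      (m → Nonempty V) ∧ G.IsGuess T F m A X Y := by
  classical
  by_cases hsmall : F.card ≤ 17
  · exact ⟨False, F, ∅, ∅, hsmall, by simp, by simp, False.elim, hF.isGuess_self⟩
  -- The vertices of a triangle lie outside `T` and in one component, but no single vertex meets all
  -- three edges. Four-cycles are excluded below in the same way.
  have h3 : ∀ x ∈ F, ∀ y ∈ F, ∀ z ∈ F, G.Adj x y → G.Adj x z → ¬ G.Adj y z := by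
    intro x hx y hy z hz hxy hxz hyz
    have hxT := hF.triangle_mem hx hy hz hxy hxz hyz
    have hyT := hF.triangle_mem hy hx hz hxy.symm hyz hxz
    have hzT := hF.triangle_mem hz hx hy hxz.symm hyz.symm hxy
    obtain ⟨c, hc⟩ := hstar x ⟨hx, hxT⟩
    have r := hxy.reachIn (S := ↑F \ T) ⟨hx, hxT⟩ ⟨hy, hyT⟩
    have e1 := hc x ⟨hx, hxT⟩ y ⟨hy, hyT⟩ .refl hxy
    have e2 := hc x ⟨hx, hxT⟩ z ⟨hz, hzT⟩ .refl hxz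
    have e3 := hc y ⟨hy, hyT⟩ z ⟨hz, hzT⟩ r hyz
    have := hxy.ne; have := hxz.ne; have := hyz.ne
    grind
  have h4 : ∀ u ∈ F, ∀ x ∈ F, ∀ p ∈ F, ∀ q ∈ F, u ≠ x → G.Adj u p → G.Adj u q → G.Adj x p →
      G.Adj x q → p = q := by
    intro u hu x hx p hp q hq hux hup huq hxp hxq
    by_contra hpq
    have huT := hF.square_mem hu hx hp hq hux hpq hup huq hxp hxq
    have hxT := hF.square_mem hx hu hp hq hux.symm hpq hxp hxq hup huq
    have hpT := hF.square_mem hp hq hu hx hpq hux hup.symm hxp.symm huq.symm hxq.symm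
    have hqT := hF.square_mem hq hp hu hx (Ne.symm hpq) hux huq.symm hxq.symm hup.symm hxp.symm
    obtain ⟨c, hc⟩ := hstar u ⟨hu, huT⟩
    have r1 := hup.reachIn (S := ↑F \ T) ⟨hu, huT⟩ ⟨hp, hpT⟩
    have r2 := r1.trans (hxp.symm.reachIn ⟨hp, hpT⟩ ⟨hx, hxT⟩)
    have e1 := hc u ⟨hu, huT⟩ p ⟨hp, hpT⟩ .refl hup
    have e2 := hc u ⟨hu, huT⟩ q ⟨hq, hqT⟩ .refl huq
    have e3 := hc x ⟨hx, hxT⟩ p ⟨hp, hpT⟩ r2 hxp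
    have e4 := hc x ⟨hx, hxT⟩ q ⟨hq, hqT⟩ r2 hxq
    have := hup.ne; have := huq.ne; have := hxp.ne; have := hxq.ne
    grind
  by_cases hc : ∀ c ∈ F, ∃ x ∈ F, ∃ y ∈ F, x ≠ c ∧ y ≠ c ∧ G.Adj x y
  · exact absurd (card_le_of_no_short_cycle hG h3 h4 hc) hsmall
  push Not at hc
  obtain ⟨c, hcF, hc⟩ := hc
  obtain ⟨x, hx, y, hy, z, hz, hxy, hxz, hyz⟩ := exists_three (I := F.erase c)
    (by rw [Finset.card_erase_of_mem hcF]; omega)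
  rw [Finset.mem_erase] at hx hy hz
  -- Nonemptiness matters later, when the flag is encoded by a number below the number of vertices.
  exact ⟨True, {x, y, z}, {c}, ∅, Finset.card_le_three.trans (by norm_num), by simp, by simp,
    fun _ => ⟨x⟩, isGuess_of_indep hG hc hx.2 hy.2 hz.2 hx.1 hy.1 hz.1 hxy hxz hyz⟩

/-- If no vertex meets all edges of some component outside `T`, independent sets in `T` are small. -/
theorem card_indep_le_four (hG : G.AvoidsThreeP1AddP2) (hF : G.IsSubsetForest T F) {b₀ : V}
    (hwide : ∀ c, ∃ x ∈ ↑F \ T, ∃ y ∈ ↑F \ T,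
      G.ReachIn (↑F \ T) b₀ x ∧ G.Adj x y ∧ x ≠ c ∧ y ≠ c)
    {I : Finset V} (hIF : I ⊆ F) (hIT : ∀ a ∈ I, a ∈ T)
    (hI : ∀ x ∈ I, ∀ y ∈ I, ¬ G.Adj x y) : I.card ≤ 4 := by
  classical
  by_contra! h5
  have hadj : ∃ a₁ ∈ I, ∃ c₁ ∈ ↑F \ T, G.ReachIn (↑F \ T) b₀ c₁ ∧ G.Adj a₁ c₁ ∧
      ∃ a₂ ∈ I, ∃ c₂ ∈ ↑F \ T, G.ReachIn (↑F \ T) b₀ c₂ ∧ G.Adj a₂ c₂ ∧ c₁ ≠ c₂ := by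
    -- Otherwise `c` is the only possible neighbour of `I` in the component, and an edge of the
    -- component avoiding `c` is anticomplete to `I`.
    have one : ∀ c, ∃ a ∈ I, ∃ c' ∈ ↑F \ T, G.ReachIn (↑F \ T) b₀ c' ∧ G.Adj a c' ∧ c' ≠ c := by
      intro c
      by_contra! hno
      obtain ⟨x, hx, y, hy, hbx, hxy, hxc, hyc⟩ := hwide c
      have := hG.card_le_two hxy hI fun a ha =>
        ⟨fun h => hx.2 (h ▸ hIT a ha), fun h => hy.2 (h ▸ hIT a ha),
          fun h => hxc (hno a ha x hx hbx h),
          fun h => hyc (hno a ha y hy (hbx.trans (hxy.reachIn hx hy)) h)⟩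
      omega
    obtain ⟨a₁, ha₁, c₁, hc₁, hb₁, h₁, -⟩ := one b₀
    obtain ⟨a₂, ha₂, c₂, hc₂, hb₂, h₂, hne⟩ := one c₁
    exact ⟨a₁, ha₁, c₁, hc₁, hb₁, h₁, a₂, ha₂, c₂, hc₂, hb₂, h₂, hne.symm⟩
  obtain ⟨a₁, ha₁, c₁, hc₁, hb₁, h₁, a₂, ha₂, c₂, hc₂, hb₂, h₂, hne⟩ := hadj
  -- Now `ac` serves as the edge: the vertices of `I` not adjacent to `c` are anticomplete to it.
  have small : ∀ a ∈ I, ∀ c ∈ ↑F \ T, G.Adj a c → (I.filter fun x => ¬ G.Adj x c).card ≤ 2 := by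
    intro a ha c hc hac
    refine hG.card_le_two hac (fun x hx y hy => hI x (Finset.mem_filter.1 hx).1 y
      (Finset.mem_filter.1 hy).1) fun x hx => ?_
    rw [Finset.mem_filter] at hx
    exact ⟨fun h => hx.2 (h ▸ hac), fun h => hc.2 (h ▸ hIT x hx.1), hI x hx.1 a ha, hx.2⟩
  -- No vertex of `I` is adjacent to both `c₁` and `c₂`, as these are joined outside `T`. Hence the
  -- bound 2 + 2.
  have hsub : I ⊆ (I.filter fun x => ¬ G.Adj x c₁) ∪ I.filter fun x => ¬ G.Adj x c₂ := by
    intro x hx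
    simp only [Finset.mem_union, Finset.mem_filter, hx, true_and]
    by_contra! h
    exact hne (hF.eq_of_reachIn (hIT x hx) (hIF hx) hc₁.1 h.1 hc₂.1 h.2 (hb₁.symm.trans hb₂))
  have := Finset.card_le_card hsub
  have e1 := small a₁ ha₁ c₁ hc₁ h₁
  have e2 := small a₂ ha₂ c₂ hc₂ h₂
  have e3 := Finset.card_union_le (I.filter fun x => ¬ G.Adj x c₁) (I.filter fun x => ¬ G.Adj x c₂)
  omega

/-- Outside the component of `b₀`, at most one vertex has to be removed to leave at most one
component; moreover that vertex is isolated outside `T`. -/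
theorem exists_isolated (hG : G.AvoidsThreeP1AddP2) (hF : G.IsSubsetForest T F) {b₀ : V}
    (hwide : ∀ c, ∃ x ∈ ↑F \ T, ∃ y ∈ ↑F \ T,
      G.ReachIn (↑F \ T) b₀ x ∧ G.Adj x y ∧ x ≠ c ∧ y ≠ c)
    {a : V} (ha : a ∈ F) (haT : a ∈ T) :
    ∃ D : Finset V, D.card ≤ 1 ∧ (∀ d ∈ D, d ∈ F ∧ d ∉ T ∧ ¬ G.ReachIn (↑F \ T) b₀ d ∧
        ∀ x ∈ ↑F \ T, ¬ G.Adj d x) ∧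
      ∀ x ∈ ↑F \ T, ∀ y ∈ ↑F \ T, x ∉ D → y ∉ D → ¬ G.ReachIn (↑F \ T) b₀ x →
        ¬ G.ReachIn (↑F \ T) b₀ y → G.ReachIn (↑F \ T) x y := by
  -- A vertex of `T` has at most one neighbour in the component of `b₀`, and the other vertices
  -- considered have none. An edge of the component avoiding that neighbour completes `p`, `q`, `r`
  -- to an induced `3P₁ + P₂`.
  have three : ∀ p q r, p ∈ F → p ≠ q → p ≠ r → q ≠ r → ¬ G.Adj p q → ¬ G.Adj p r → ¬ G.Adj q r →
      (p ∈ T ∨ ¬ G.ReachIn (↑F \ T) b₀ p) → q ∈ ↑F \ T → r ∈ ↑F \ T →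
      ¬ G.ReachIn (↑F \ T) b₀ q → ¬ G.ReachIn (↑F \ T) b₀ r → False := by
    intro p q r hpF hpq hpr hqr hpq' hpr' hqr' hp hq hr hbq hbr
    have hout : ∀ z ∈ ↑F \ T, ¬ G.ReachIn (↑F \ T) b₀ z → ∀ x ∈ ↑F \ T,
        G.ReachIn (↑F \ T) b₀ x → z ≠ x ∧ ¬ G.Adj z x := fun z hz hbz x hx hbx =>
      ⟨fun h => hbz (h ▸ hbx), fun h => hbz (hbx.trans (h.symm.reachIn hx hz))⟩
    obtain ⟨c, hc⟩ : ∃ c, ∀ x ∈ ↑F \ T, G.ReachIn (↑F \ T) b₀ x → x ≠ c → p ≠ x ∧ ¬ G.Adj p x := by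
      by_cases hpT : p ∈ T
      · by_cases hex : ∃ c ∈ ↑F \ T, G.ReachIn (↑F \ T) b₀ c ∧ G.Adj p c
        · obtain ⟨c, hc, hbc, hpc⟩ := hex
          refine ⟨c, fun x hx hbx hxc => ⟨fun h => hx.2 (h ▸ hpT), fun h => hxc ?_⟩⟩
          exact hF.eq_of_reachIn hpT hpF hx.1 h hc.1 hpc (hbx.symm.trans hbc)
        · push Not at hex
          exact ⟨p, fun x hx hbx _ => ⟨fun h => hx.2 (h ▸ hpT), hex x hx hbx⟩⟩
      · exact ⟨p, fun x hx hbx _ => hout p ⟨hpF, hpT⟩ (hp.resolve_left hpT) x hx hbx⟩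
    obtain ⟨x, hx, y, hy, hbx, hxy, hxc, hyc⟩ := hwide c
    have hby := hbx.trans (hxy.reachIn hx hy)
    refine hG p q r x y hxy hpq hpr hqr hpq' hpr' hqr' ?_
    rintro z (rfl | rfl | rfl)
    · exact ⟨(hc x hx hbx hxc).1, (hc y hy hby hyc).1, (hc x hx hbx hxc).2, (hc y hy hby hyc).2⟩
    · exact ⟨(hout z hq hbq x hx hbx).1, (hout z hq hbq y hy hby).1,
        (hout z hq hbq x hx hbx).2, (hout z hq hbq y hy hby).2⟩
    · exact ⟨(hout z hr hbr x hx hbx).1, (hout z hr hbr y hy hby).1,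
        (hout z hr hbr x hx hbx).2, (hout z hr hbr y hy hby).2⟩
  have nadj : ∀ x ∈ ↑F \ T, ∀ y ∈ ↑F \ T, ¬ G.ReachIn (↑F \ T) x y → x ≠ y ∧ ¬ G.Adj x y :=
    fun x hx y hy h => ⟨fun e => h (e ▸ .refl), fun e => h (e.reachIn hx hy)⟩
  by_cases hconn : ∀ x ∈ ↑F \ T, ∀ y ∈ ↑F \ T, ¬ G.ReachIn (↑F \ T) b₀ x →
        ¬ G.ReachIn (↑F \ T) b₀ y → G.ReachIn (↑F \ T) x y
  · exact ⟨∅, by simp, by simp, fun x hx y hy _ _ => hconn x hx y hy⟩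
  push Not at hconn
  obtain ⟨y, hy, z, hz, hby, hbz, hyz⟩ := hconn
  -- If `a` missed a vertex in the component of `y` and one in that of `z`, these two vertices and
  -- `a` would contradict `three`. A component consisting of neighbours of `a` is a single vertex.
  have iso : ∃ d ∈ ↑F \ T, ¬ G.ReachIn (↑F \ T) b₀ d ∧
      ∀ x ∈ ↑F \ T, G.ReachIn (↑F \ T) d x → G.Adj a x := by
    by_contra! hno
    obtain ⟨y', hy', hyy', hay'⟩ := hno y hy hby
    obtain ⟨z', hz', hzz', haz'⟩ := hno z hz hbz
    have hyz' := nadj y' hy' z' hz' fun h => hyz (hyy'.trans (h.trans hzz'.symm))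
    exact three a y' z' ha (fun h => hy'.2 (h ▸ haT)) (fun h => hz'.2 (h ▸ haT)) hyz'.1
      hay' haz' hyz'.2 (.inl haT) hy' hz' (fun h => hby (h.trans hyy'.symm))
      fun h => hbz (h.trans hzz'.symm)
  obtain ⟨d, hd, hbd, had⟩ := iso
  have hdiso : ∀ x ∈ ↑F \ T, ¬ G.Adj d x := fun x hx h =>
    h.ne (hF.eq_of_reachIn haT ha hd.1 (had d hd .refl) hx.1 (had x hx (h.reachIn hd hx))
      (h.reachIn hd hx))
  refine ⟨{d}, by simp, by simpa using ⟨hd.1, hd.2, hbd, fun x hx hxT => hdiso x ⟨hx, hxT⟩⟩, ?_⟩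
  intro x hx y hy hxd hyd hbx hby
  by_contra hxy
  rw [Finset.mem_singleton] at hxd hyd
  have h' := nadj x hx y hy hxy
  exact three d x y hd.1 (Ne.symm hxd) (Ne.symm hyd) h'.1 (hdiso x hx) (hdiso y hy) h'.2
    (.inr hbd) hx hy hbx hby

/-- The set `A` collects `F ∩ T` and the isolated vertex; `X` and `Y` are the attachments to `F ∩ T`
of the wide component `C` and of the remaining part `C'`, bounded by `exists_attachment`. The rest
of `C` and of `C'` are the separated sets. -/
theorem exists_isGuess_of_wide (hG : G.AvoidsThreeP1AddP2) (hF : G.IsSubsetForest T F) {b₀ : V}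
    (hwide : ∀ c, ∃ x ∈ ↑F \ T, ∃ y ∈ ↑F \ T,
      G.ReachIn (↑F \ T) b₀ x ∧ G.Adj x y ∧ x ≠ c ∧ y ≠ c) :
    ∃ (A X Y : Finset V), A.card ≤ 17 ∧ X.card ≤ 17 ∧ Y.card ≤ 17 ∧
      G.IsGuess T F False A X Y := by
  classical
  set A₀ := F.filter (· ∈ T) with hA₀
  have hA₀F : A₀ ⊆ F := Finset.filter_subset _ _
  have hA₀T : ∀ a ∈ A₀, a ∈ T := fun a ha => (Finset.mem_filter.1 ha).2
  -- The bound is 14; with the isolated vertex, `A` has at most 15 vertices.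
  have hcard : A₀.card ≤ triangleFreeBound 4 := by
    refine card_le_of_triangleFree 4 A₀ (fun x hx y hy z hz hxy hxz hyz =>
      hF.triangle_mem (hA₀F hx) (hA₀F hy) (hA₀F hz) hxy hxz hyz (hA₀T x hx)) fun I hI hII => ?_
    exact card_indep_le_four hG hF hwide (hI.trans hA₀F) (fun a ha => hA₀T a (hI ha)) hII
  simp only [triangleFreeBound] at hcard
  rcases A₀.eq_empty_or_nonempty with hemp | ⟨a, ha⟩
  -- If `F` avoids `T`, the empty description with flag `False` admits every set outside `T`, and
  -- such sets are trivially subset forests.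
  · have hnT : ∀ x ∈ F, x ∉ T := fun x hx h => by
      have : x ∈ A₀ := Finset.mem_filter.2 ⟨hx, h⟩
      simp [hemp] at this
    refine ⟨∅, ∅, ∅, by simp, by simp, by simp, ⟨F, ∅, ?_, by simp, by simp [Separated], by simp⟩, ?_⟩
    · intro x hx
      simpa [region] using hnT x hx
    · intro P Q hP hQ _ t ht ht'
      rcases ht' with ((((h | h) | h) | h) | h)
      · simp at h
      · simp at h
      · simp at h
      · exact absurd ht ((hP h).1.resolve_left id)
      · exact absurd ht ((hQ h).1.resolve_left id)
  obtain ⟨D, hD1, hD, hconn⟩ := exists_isolated hG hF hwide (hA₀F ha) (hA₀T a ha)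
  set C : Set V := {x | x ∈ ↑F \ T ∧ G.ReachIn (↑F \ T) b₀ x} with hC
  set C' : Set V := {x | x ∈ ↑F \ T ∧ ¬ G.ReachIn (↑F \ T) b₀ x ∧ x ∉ D} with hC'
  have hCC : ∀ x ∈ C, ∀ y ∈ C, G.ReachIn (↑F \ T) x y := fun x hx y hy => hx.2.symm.trans hy.2
  have hCC' : ∀ x ∈ C', ∀ y ∈ C', G.ReachIn (↑F \ T) x y := fun x hx y hy =>
    hconn x hx.1 y hy.1 hx.2.2 hy.2.2 hx.2.1 hy.2.1
  have hsep : ∀ x ∈ C, ∀ y ∈ C', ¬ G.Adj x y := fun x hx y hy h =>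
    hy.2.1 (hx.2.trans (h.reachIn hx.1 hy.1))
  obtain ⟨X, hX1, hX⟩ := hF.exists_attachment hA₀F hA₀T C (fun x hx => hx.1) hCC
  obtain ⟨Y, hY1, hY⟩ := hF.exists_attachment hA₀F hA₀T C' (fun x hx => hx.1) hCC'
  have hA : ∀ x ∈ A₀ ∪ D, x ∈ F := fun x hx =>
    (Finset.mem_union.1 hx).elim (fun h => hA₀F h) fun h => (hD x h).1
  refine ⟨A₀ ∪ D, X, Y, (Finset.card_union_le _ _).trans (by omega), by omega, by omega,
    ⟨C \ X, C' \ Y, ?_, ?_, ?_, ?_⟩, fun P Q hP hQ hPQ => ?_⟩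
  · rintro v ⟨hv, hvX⟩
    refine ⟨.inr hv.1.2, ?_, hvX, fun h => ((hY v).1 h).1.2.1 hv.2, ?_, fun y hy => ?_⟩
    · simp only [Finset.coe_union, Set.mem_union, Finset.mem_coe, not_or]
      exact ⟨fun h => hv.1.2 (hA₀T v h), fun h => (hD v h).2.2.1 hv.2⟩
    · intro d hd h
      rcases Finset.mem_union.1 hd with hd | hd
      · exact hvX ((hX v).2 ⟨hv, d, hd, h.symm⟩)
      · exact (hD d hd).2.2.2 v hv.1 h.symm
    · exact hsep v hv y ((hY y).1 hy).1
  · rintro v ⟨hv, hvY⟩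
    refine ⟨.inr hv.1.2, ?_, fun h => hv.2.1 ((hX v).1 h).1.2, hvY, ?_, fun y hy h => ?_⟩
    · simp only [Finset.coe_union, Set.mem_union, Finset.mem_coe, not_or]
      exact ⟨fun h => hv.1.2 (hA₀T v h), hv.2.2⟩
    · intro d hd h
      rcases Finset.mem_union.1 hd with hd | hd
      · exact hvY ((hY v).2 ⟨hv, d, hd, h.symm⟩)
      · exact (hD d hd).2.2.2 v hv.1 h.symm
    · exact hsep y ((hX y).1 hy).1 v hv h.symm
  · exact fun p hp q hq => ⟨fun h => hq.1.2.1 (h ▸ hp.1.2), hsep p hp.1 q hq.1⟩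
  · intro v hv
    simp only [Finset.coe_union, Set.mem_union, Finset.mem_coe, Set.mem_sdiff, hC, hC',
      Set.mem_ofPred_eq, hA₀, Finset.mem_filter]
    have hvF : v ∈ F := hv
    tauto
  · refine hF.union_region (fun x hx => hA x hx) (fun x hx => ((hX x).1 hx).1.1)
      (fun x hx => ((hY x).1 hx).1.1) (fun x hx y hy => hCC x ((hX x).1 hx).1 y ((hX y).1 hy).1)
      (fun x hx y hy => hCC' x ((hY x).1 hx).1 y ((hY y).1 hy).1) hP hQ hPQ

/-- Every subset forest of a `(3P₁ + P₂)`-free graph has a bounded description. -/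
theorem IsSubsetForest.exists_isGuess [Fintype V] (hG : G.AvoidsThreeP1AddP2)
    (hF : G.IsSubsetForest T F) :
    ∃ (m : Prop) (A X Y : Finset V), A.card ≤ 17 ∧ X.card ≤ 17 ∧ Y.card ≤ 17 ∧
      (m → Nonempty V) ∧ G.IsGuess T F m A X Y := by
  by_cases h : ∀ b ∈ ↑F \ T, ∃ c, ∀ x ∈ ↑F \ T, ∀ y ∈ ↑F \ T, G.ReachIn (↑F \ T) b x → G.Adj x y →
      x = c ∨ y = c
  · exact hF.exists_isGuess_of_stars hG h
  · push Not at h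
    obtain ⟨b, -, h⟩ := h
    obtain ⟨A, X, Y, hA, hX, hY, h⟩ := exists_isGuess_of_wide hG hF h
    exact ⟨False, A, X, Y, hA, hX, hY, False.elim, h⟩

end SimpleGraph

/-! ### Cycles, walks and induced subgraphs in terms of the notions above -/

namespace SimpleGraph

variable {V : Type*} {G : SimpleGraph V}

theorem Walk.reachIn {S : Set V} {u v : V} (p : G.Walk u v) (h : ∀ x ∈ p.support, x ∈ S) :
    G.ReachIn S u v := by
  induction p with
  | nil => exact .refl
  | cons hadj p ih =>
    have h' : ∀ x ∈ p.support, x ∈ S := fun x hx => h x (by simp [hx])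
    exact .head ⟨hadj, h _ (by simp), h' _ (by simp)⟩ (ih h')

theorem ReachIn.exists_isPath {S : Set V} {u v : V} (h : G.ReachIn S u v) (hu : u ∈ S) :
    ∃ p : G.Walk u v, p.IsPath ∧ ∀ x ∈ p.support, x ∈ S := by
  classical
  suffices H : ∃ p : G.Walk u v, ∀ x ∈ p.support, x ∈ S by
    obtain ⟨p, hp⟩ := H
    exact ⟨p.bypass, p.bypass_isPath, fun x hx => hp x (p.support_bypass_subset_support hx)⟩
  induction h with
  | refl => exact ⟨.nil, by simpa using hu⟩
  | tail _ h ih =>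
    obtain ⟨p, hp⟩ := ih
    refine ⟨p.concat h.1, fun x hx => ?_⟩
    rw [Walk.support_concat, List.mem_append, List.mem_singleton] at hx
    rcases hx with hx | rfl
    exacts [hp x hx, h.2.2]

/-- Subset feedback vertex sets are the complements of subset forests. -/
theorem isSubsetFeedbackVertexSet_iff [Fintype V] [DecidableEq V] {T S : Finset V} :
    G.IsSubsetFeedbackVertexSet T S ↔ G.IsSubsetForest (T : Set V) (↑(Sᶜ) : Set V) := by
  constructor
  · intro h t htT ht u hu v hv htu htv huv
    by_contra hne
    obtain ⟨p, hp, hpS⟩ := huv.exists_isPath ⟨hu, htu.ne'⟩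
    have htp : t ∉ p.support := fun h => (hpS t h).2 rfl
    have hc : (Walk.cons htu (p.concat htv.symm)).IsCycle := by
      rw [Walk.cons_isCycle_iff]
      refine ⟨hp.concat htp htv.symm, ?_⟩
      rw [Walk.edges_concat, List.concat_eq_append, List.mem_append, List.mem_singleton]
      rintro (h' | h')
      · exact htp (p.fst_mem_support_of_mem_edges h')
      · rw [Sym2.eq_iff] at h'
        rcases h' with ⟨h', -⟩ | ⟨-, h'⟩
        · exact htv.ne h'
        · exact hne h'
    obtain ⟨x, hx, hxS⟩ := h t _ hc ⟨t, by simp, htT⟩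
    have hxS' : x ∉ Sᶜ := by simpa using hxS
    rw [Walk.support_cons, List.mem_cons, Walk.support_concat, List.mem_append,
      List.mem_singleton] at hx
    rcases hx with rfl | hx | rfl
    · exact hxS' ht
    · exact hxS' (hpS x hx).1
    · exact hxS' ht
  · rintro h v c hc ⟨t, htc, htT⟩
    by_contra! hS
    -- The rotated cycle starts with an edge `tu`, and reversing the rest exposes its last edge
    -- `tv`. The forest condition gives `u = v`, so the cycle would use one edge twice.
    have hc' := hc.rotate htc
    have hS' : ∀ x ∈ (c.rotate t htc).support, x ∈ (↑(Sᶜ) : Set V) := by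
      intro x hx
      have : x ∈ c.support := (c.mem_support_rotate_iff _ htc).1 hx
      simpa using hS x this
    clear hS
    generalize c.rotate t htc = d at hc' hS'
    cases d with
    | nil => exact hc'.ne_nil rfl
    | @cons _ u _ htu p =>
      rw [Walk.cons_isCycle_iff] at hc'
      obtain ⟨hp, hpe⟩ := hc'
      have hpr := hp.reverse
      have hpe' : s(t, u) ∉ p.reverse.edges := by rwa [Walk.edges_reverse, List.mem_reverse]
      have hpS : ∀ x ∈ p.reverse.support, x ∈ (↑(Sᶜ) : Set V) := fun x hx => hS' x <| by
        rw [Walk.support_reverse, List.mem_reverse] at hx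
        simp [hx]
      generalize p.reverse = q at hpr hpe' hpS
      cases q with
      | nil => exact htu.ne rfl
      | @cons _ v _ htv q =>
        rw [Walk.cons_isPath_iff] at hpr
        have hqS : ∀ x ∈ q.support, x ∈ (↑(Sᶜ) : Set V) \ {t} := fun x hx =>
          ⟨hpS x (by simp [hx]), fun h' => hpr.2 (by rwa [← h'])⟩
        have huv := h t htT (hpS t (by simp)) v (hqS v (by simp)).1 u (hqS u (by simp)).1 htv htu
          (q.reachIn hqS)
        subst huv
        exact hpe' (by simp)

/-- Graphs without induced `3P₁ + P₂`, spelled out. -/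
theorem avoidsThreeP1AddP2_of_not_isIndContained (h : ¬ threeP1AddP2.IsIndContained G) :
    G.AvoidsThreeP1AddP2 := by
  intro a b c u v huv hab hac hbc hab' hac' hbc' hz
  obtain ⟨ha₁, ha₂, ha₃, ha₄⟩ := hz a (by simp)
  obtain ⟨hb₁, hb₂, hb₃, hb₄⟩ := hz b (by simp)
  obtain ⟨hc₁, hc₂, hc₃, hc₄⟩ := hz c (by simp)
  clear hz
  have hinj : Function.Injective
      (Sum.elim (Sum.elim (Sum.elim (fun _ : Fin 1 => a) fun _ : Fin 1 => b) fun _ : Fin 1 => c)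
        ![u, v]) := by
    have hne := huv.ne
    rintro (((x | x) | x) | x) (((y | y) | y) | y) <;> fin_cases x <;> fin_cases y <;>
      simp [hab, hac, hbc, ha₁, ha₂, hb₁, hb₂, hc₁, hc₂, hab.symm, hac.symm, hbc.symm, ha₁.symm,
        ha₂.symm, hb₁.symm, hb₂.symm, hc₁.symm, hc₂.symm, hne, hne.symm]
  refine h ⟨⟨⟨_, hinj⟩, fun {x y} => ?_⟩⟩
  simp only [Function.Embedding.coeFn_mk]
  have neg_symm : ∀ {p q : V}, ¬ G.Adj p q → ¬ G.Adj q p := fun h h' => h h'.symm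
  have e1 := neg_symm hab'
  have e2 := neg_symm hac'
  have e3 := neg_symm hbc'
  have e4 := neg_symm ha₃
  have e5 := neg_symm ha₄
  have e6 := neg_symm hb₃
  have e7 := neg_symm hb₄
  have e8 := neg_symm hc₃
  have e10 := huv.symm
  have e9 := neg_symm hc₄
  rcases x with (((x | x) | x) | x) <;> rcases y with (((y | y) | y) | y) <;> fin_cases x <;> fin_cases y <;>
    simp [threeP1AddP2, SimpleGraph.pathGraph_adj, *]

end SimpleGraph

/-! ## Minimum cuts by shortest augmenting paths -/

namespace MinCut

open Classical in
/-- The capacity of the cut `(S, Sᶜ)` of the network with nodes `0, …, N - 1`. -/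
noncomputable def cut (N : ℕ) (c : ℕ → ℕ → ℝ) (S : Set ℕ) : ℝ :=
  ∑ u ∈ Finset.range N, ∑ v ∈ Finset.range N, if u ∈ S ∧ v ∉ S then c u v else 0

/-- Residual capacities after sending `δ` units along the edge `(u, v)`. -/
noncomputable def push (c : ℕ → ℕ → ℝ) (u v : ℕ) (δ : ℝ) : ℕ → ℕ → ℝ := fun x y =>
  if x = v ∧ y = u then c x y + δ else if x = u ∧ y = v then c x y - δ else c x y

open Classical in
-- Only the pairs `(u, v)` and `(v, u)` change. Summed along a path from `s` to `t`, all cuts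
-- separating `s` from `t` change by the same amount; `Inv.cut_eq` can thus describe a flow by its
-- effect on cuts, without a flow function.
theorem cut_push {N u v : ℕ} (c : ℕ → ℕ → ℝ) (δ : ℝ) (hu : u < N) (hv : v < N) (huv : u ≠ v)
    (S : Set ℕ) : cut N (push c u v δ) S =
      cut N c S + (if v ∈ S ∧ u ∉ S then δ else 0) - if u ∈ S ∧ v ∉ S then δ else 0 := by
  have single : ∀ a b : ℕ, a < N → b < N → ∀ r : ℝ, (∑ x ∈ Finset.range N, ∑ y ∈ Finset.range N,
      if x = a then (if y = b then r else 0) else 0) = r := by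
    intro a b ha hb r
    rw [Finset.sum_eq_single_of_mem a (by simpa using ha) (fun x _ hx => by simp [hx]),
      Finset.sum_eq_single_of_mem b (by simpa using hb) (fun x _ hx => by simp [hx])]
    simp
  rw [← single v u hv hu (if v ∈ S ∧ u ∉ S then δ else 0),
    ← single u v hu hv (if u ∈ S ∧ v ∉ S then δ else 0)]
  simp only [cut, ← Finset.sum_add_distrib, ← Finset.sum_sub_distrib]
  refine Finset.sum_congr rfl fun x _ => Finset.sum_congr rfl fun y _ => ?_
  simp only [push]
  by_cases h1 : x = v <;> by_cases h2 : y = u <;> by_cases h3 : x = u <;> by_cases h4 : y = v <;>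
    simp_all <;> split_ifs <;> simp_all

/-- `c` are residual capacities of a flow from `s` to `t` in the network with capacities `cap`, and
`L` are lower bounds of the residual distances from `s`, cut off at `N + 1`. -/
structure Inv (N s t : ℕ) (cap c : ℕ → ℕ → ℝ) (L : ℕ → ℕ) : Prop where
  nonneg : ∀ u < N, ∀ v < N, 0 ≤ c u v
  cut_eq : ∃ val, ∀ S : Set ℕ, s ∈ S → t ∉ S → cut N c S = cut N cap S - val
  label_s : L s = 0
  label_le : ∀ v < N, L v ≤ N + 1
  label_edge : ∀ u < N, ∀ v < N, 0 < c u v → L v ≤ L u + 1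

/-- Every finite label is witnessed by a predecessor. -/
def Exact (N s : ℕ) (c : ℕ → ℕ → ℝ) (L : ℕ → ℕ) : Prop :=
  ∀ v < N, v ≠ s → L v ≤ N → ∃ u < N, 0 < c u v ∧ L v = L u + 1

open Classical in
/-- The residual edges between consecutive labels. -/
noncomputable def levelEdges (N : ℕ) (c : ℕ → ℕ → ℝ) (L : ℕ → ℕ) : Finset (ℕ × ℕ) :=
  (Finset.range N ×ˢ Finset.range N).filter fun p => 0 < c p.1 p.2 ∧ L p.2 = L p.1 + 1

/-- The quantity that decreases in each step of the algorithm. -/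
noncomputable def potential (N : ℕ) (c : ℕ → ℕ → ℝ) (L : ℕ → ℕ) : ℕ :=
  (∑ v ∈ Finset.range N, (N + 1 - L v)) * (N * N + 1) + (levelEdges N c L).card

theorem card_levelEdges_le (N : ℕ) (c : ℕ → ℕ → ℝ) (L : ℕ → ℕ) :
    (levelEdges N c L).card ≤ N * N :=
  (Finset.card_filter_le _ _).trans (by simp)

theorem potential_le (N : ℕ) (c : ℕ → ℕ → ℝ) (L : ℕ → ℕ) :
    potential N c L ≤ N * (N + 1) * (N * N + 1) + N * N := by
  refine Nat.add_le_add (Nat.mul_le_mul_right _ ?_) (card_levelEdges_le N c L)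
  exact (Finset.sum_le_card_nsmul _ _ (N + 1) fun v _ => Nat.sub_le _ _).trans (by simp)

variable {N s t : ℕ} {cap c : ℕ → ℕ → ℝ} {L : ℕ → ℕ}

/-- Each residual edge into `v` satisfies `label_edge` with strict inequality, so the label may rise
by one. The sum in the potential drops by at least one and is weighted by `N * N + 1`, which
outweighs any change among the at most `N * N` level edges. -/
theorem Inv.relabel (h : Inv N s t cap c L) {v : ℕ} (hv : v < N) (hvs : v ≠ s) (hLv : L v ≤ N)
    (hno : ∀ u < N, 0 < c u v → L v ≠ L u + 1) :
    Inv N s t cap c (Function.update L v (L v + 1)) ∧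
      potential N c (Function.update L v (L v + 1)) < potential N c L := by
  refine ⟨⟨h.nonneg, h.cut_eq, ?_, ?_, ?_⟩, ?_⟩
  · rw [Function.update_of_ne hvs.symm, h.label_s]
  · intro x hx
    by_cases hxv : x = v
    · subst hxv; simpa using hLv
    · rw [Function.update_of_ne hxv]; exact h.label_le x hx
  · intro x hx y hy hxy
    have h1 := h.label_edge x hx y hy hxy
    by_cases hyv : y = v
    · subst hyv
      have h2 := hno x hx hxy
      by_cases hxv : x = y
      · subst hxv; simp
      · rw [Function.update_self, Function.update_of_ne hxv]; omega
    · rw [Function.update_of_ne hyv]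
      by_cases hxv : x = v
      · subst hxv; rw [Function.update_self]; omega
      · rwa [Function.update_of_ne hxv]
  · have h1 := card_levelEdges_le N c (Function.update L v (L v + 1))
    have h2 : (∑ x ∈ Finset.range N, (N + 1 - Function.update L v (L v + 1) x)) + 1 ≤
        ∑ x ∈ Finset.range N, (N + 1 - L x) := by
      refine Nat.succ_le_of_lt (Finset.sum_lt_sum (fun x _ => ?_) ⟨v, by simpa using hv, ?_⟩)
      · by_cases hxv : x = v
        · subst hxv; rw [Function.update_self]; omega
        · rw [Function.update_of_ne hxv]
      · rw [Function.update_self]; omega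
    simp only [potential]
    have h3 := Nat.mul_le_mul_right (N * N + 1) h2
    rw [Nat.add_mul, one_mul] at h3
    omega

/-- Following predecessors lowers the label by one at a time, so all of `0, …, L v` occur among the
labels of `N` vertices. That the label `N` is never taken is what closes the cut in `Inv.min_cut`.
-/
theorem Exact.label_lt (hE : Exact N s c L) (hs : L s = 0) {v : ℕ} (hv : v < N) (hLv : L v ≤ N) :
    L v < N := by
  have key : ∀ j ≤ L v, ∃ x < N, L x + j = L v := by
    intro j
    induction j with
    | zero => exact fun _ => ⟨v, hv, rfl⟩
    | succ j ih =>
      intro hj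
      obtain ⟨x, hx, hxj⟩ := ih (by omega)
      have hxs : x ≠ s := by rintro rfl; omega
      obtain ⟨u, hu, -, hu'⟩ := hE x hx hxs (by omega)
      exact ⟨u, hu, by omega⟩
  have hsub : Finset.range (L v + 1) ⊆ (Finset.range N).image L := by
    intro i hi
    rw [Finset.mem_range] at hi
    obtain ⟨x, hx, hxi⟩ := key (L v - i) (by omega)
    exact Finset.mem_image.2 ⟨x, by simpa using hx, by omega⟩
  have := (Finset.card_le_card hsub).trans Finset.card_image_le
  simp at this
  omega

/-- When the labels are exact and `t` has not been reached, the labelled vertices form a minimum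
cut. -/
theorem Inv.min_cut (h : Inv N s t cap c L) (hE : Exact N s c L) (ht : L t = N + 1) (S : Set ℕ)
    (hsS : s ∈ S) (htS : t ∉ S) : cut N cap {v | L v ≤ N} ≤ cut N cap S := by
  obtain ⟨val, hval⟩ := h.cut_eq
  have h1 := hval {v | L v ≤ N} (by simp [h.label_s]) (by simp [ht])
  have h2 := hval S hsS htS
  -- A residual edge leaving this set would start at a label below `N` and hence end at a label at
  -- most `N`.
  have h3 : cut N c {v | L v ≤ N} = 0 := by
    refine Finset.sum_eq_zero fun u hu => Finset.sum_eq_zero fun v hv => ?_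
    rw [Finset.mem_range] at hu hv
    split_ifs with hc
    · obtain ⟨h4, h5⟩ := hc
      simp only [Set.mem_ofPred_eq, not_le] at h4 h5
      refine le_antisymm (not_lt.1 fun hpos => ?_) (h.nonneg u hu v hv)
      have := h.label_edge u hu v hv hpos
      have := hE.label_lt h.label_s hu h4
      omega
    · rfl
  have h4 : 0 ≤ cut N c S := by
    refine Finset.sum_nonneg fun u hu => Finset.sum_nonneg fun v hv => ?_
    rw [Finset.mem_range] at hu hv
    split_ifs
    · exact h.nonneg u hu v hv
    · exact le_rfl
  linarith

/-- The vertices on the path from `s` to `t` given by predecessors, starting from `t`. -/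
def back (s t : ℕ) (par : ℕ → ℕ) : ℕ → ℕ
  | 0 => t
  | r + 1 => if back s t par r = s then s else par (back s t par r)

/-- Residual capacities after sending `δ` units along the last `r` edges of that path. -/
noncomputable def augment (s t : ℕ) (par : ℕ → ℕ) (c : ℕ → ℕ → ℝ) (δ : ℝ) : ℕ → ℕ → ℕ → ℝ
  | 0 => c
  | r + 1 => if back s t par r = s then augment s t par c δ r
      else push (augment s t par c δ r) (par (back s t par r)) (back s t par r) δ

/-- `par` chooses a predecessor for every vertex with a finite label. -/
def IsPar (N s : ℕ) (c : ℕ → ℕ → ℝ) (L par : ℕ → ℕ) : Prop :=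
  ∀ v < N, v ≠ s → L v ≤ N → par v < N ∧ 0 < c (par v) v ∧ L v = L (par v) + 1

theorem IsPar.exact {par : ℕ → ℕ} (hp : IsPar N s c L par) : Exact N s c L :=
  fun v hv hvs hL => ⟨par v, hp v hv hvs hL⟩

section

variable {par : ℕ → ℕ} (hp : IsPar N s c L par) (ht : t < N) (hLt : L t ≤ N)
include hp ht hLt

/-- The label determines the position on the path, so no vertex other than `s` is repeated. -/
theorem back_spec (r : ℕ) (hr : back s t par r ≠ s) :
    back s t par r < N ∧ L (back s t par r) + r = L t := by
  induction r with
  | zero => exact ⟨ht, rfl⟩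
  | succ r ih =>
    simp only [back] at hr ⊢
    by_cases h : back s t par r = s
    · simp [h] at hr
    · obtain ⟨h1, h2⟩ := ih h
      obtain ⟨h3, -, h4⟩ := hp _ h1 h (by omega)
      simp only [h, if_false]
      exact ⟨h3, by omega⟩

theorem back_self (hs : L s = 0) : back s t par N = s := by
  by_contra h
  have h1 := (back_spec hp ht hLt N h).2
  have h2 := hp.exact.label_lt hs ht hLt
  omega

/-- Labels fall strictly along the path, so a level edge is used at most once and its reverse never:
`δ` is subtracted once or not at all, and never added. -/
theorem augment_level (δ : ℝ) (r u v : ℕ) (huv : L v = L u + 1) :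
    ((∃ j < r, back s t par j ≠ s ∧ v = back s t par j ∧ u = par (back s t par j)) →
      augment s t par c δ r u v = c u v - δ) ∧
    ((¬ ∃ j < r, back s t par j ≠ s ∧ v = back s t par j ∧ u = par (back s t par j)) →
      augment s t par c δ r u v = c u v) := by
  induction r with
  | zero => simp [augment]
  | succ r ih =>
    simp only [augment]
    by_cases h : back s t par r = s
    · have e : (∃ j < r + 1, back s t par j ≠ s ∧ v = back s t par j ∧ u = par (back s t par j)) ↔
          ∃ j < r, back s t par j ≠ s ∧ v = back s t par j ∧ u = par (back s t par j) := by
        constructor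
        · rintro ⟨j, hj, hj'⟩
          refine ⟨j, lt_of_le_of_ne (by omega) ?_, hj'⟩
          rintro rfl; exact hj'.1 h
        · rintro ⟨j, hj, hj'⟩; exact ⟨j, by omega, hj'⟩
      rw [e, if_pos h]; exact ih
    · rw [if_neg h]
      obtain ⟨h1, h2⟩ := back_spec hp ht hLt r h
      obtain ⟨-, -, h4⟩ := hp _ h1 h (by omega)
      by_cases huv' : v = back s t par r ∧ u = par (back s t par r)
      · have hno : ¬ ∃ j < r, back s t par j ≠ s ∧ v = back s t par j ∧
            u = par (back s t par j) := by
          rintro ⟨j, hj, hjs, hj', -⟩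
          have := (back_spec hp ht hLt j hjs).2
          rw [← hj', huv'.1] at this
          omega
        refine ⟨fun _ => ?_, fun hno' => absurd ⟨r, by omega, h, huv'⟩ hno'⟩
        rw [push, if_neg, if_pos ⟨huv'.2, huv'.1⟩, ih.2 hno]
        rintro ⟨e1, e2⟩
        rw [e1, e2] at huv; omega
      · have e : (∃ j < r + 1, back s t par j ≠ s ∧ v = back s t par j ∧
            u = par (back s t par j)) ↔
            ∃ j < r, back s t par j ≠ s ∧ v = back s t par j ∧ u = par (back s t par j) := by
          constructor
          · rintro ⟨j, hj, hj'⟩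
            refine ⟨j, lt_of_le_of_ne (by omega) ?_, hj'⟩
            rintro rfl; exact huv' hj'.2
          · rintro ⟨j, hj, hj'⟩; exact ⟨j, by omega, hj'⟩
        have e' : push (augment s t par c δ r) (par (back s t par r)) (back s t par r) δ u v =
            augment s t par c δ r u v := by
          rw [push, if_neg, if_neg]
          · exact fun h' => huv' h'.symm
          · rintro ⟨e1, e2⟩
            rw [e1, e2] at huv; omega
        rw [e, e']; exact ih

/-- Capacity is subtracted only from level edges and added only to their reverses, which lead one
level down. New residual edges therefore respect `label_edge` and are not level edges. -/
theorem augment_nonlevel {δ : ℝ} (hδ : 0 ≤ δ) (r u v : ℕ) (huv : L v ≠ L u + 1) :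
    c u v ≤ augment s t par c δ r u v ∧
      (augment s t par c δ r u v = c u v ∨ L u = L v + 1) := by
  induction r with
  | zero => simp [augment]
  | succ r ih =>
    simp only [augment]
    by_cases h : back s t par r = s
    · rwa [if_pos h]
    · rw [if_neg h]
      obtain ⟨h1, h2⟩ := back_spec hp ht hLt r h
      obtain ⟨-, -, h4⟩ := hp _ h1 h (by omega)
      rw [push]
      by_cases h5 : u = back s t par r ∧ v = par (back s t par r)
      · rw [if_pos h5, h5.1, h5.2]
        exact ⟨by have := ih.1; rw [h5.1, h5.2] at this; linarith, .inr h4⟩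
      · rw [if_neg h5, if_neg]
        · exact ih
        · rintro ⟨rfl, rfl⟩; exact huv h4

open Classical in
-- The pushes telescope: the last `r` edges carry `δ` units from `back s t par r` to `t`, so all
-- that counts is whether this first vertex lies in `S`.
theorem cut_augment (δ : ℝ) (S : Set ℕ) (htS : t ∉ S) (r : ℕ) :
    cut N (augment s t par c δ r) S = cut N c S - if back s t par r ∈ S then δ else 0 := by
  induction r with
  | zero => simp [augment, back, htS]
  | succ r ih =>
    by_cases h : back s t par r = s
    · have e : back s t par (r + 1) = s := if_pos h
      rw [e, augment, if_pos h, ih, h]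
    · have e : back s t par (r + 1) = par (back s t par r) := if_neg h
      obtain ⟨h1, h2⟩ := back_spec hp ht hLt r h
      obtain ⟨h3, -, h4⟩ := hp _ h1 h (by omega)
      rw [e, augment, if_neg h, cut_push _ _ h3 h1, ih]
      · split_ifs <;> simp_all
      · intro e; rw [e] at h4; omega

/-- The bottleneck edge drops to residual capacity zero and leaves the level edges, while no edge
joins them. This makes the number of steps independent of the real capacities. -/
theorem Inv.augment (h : Inv N s t cap c L) {δ : ℝ}
    (hδ : ∀ r < N, back s t par r ≠ s → δ ≤ c (par (back s t par r)) (back s t par r))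
    (hδ' : ∃ r < N, back s t par r ≠ s ∧ δ = c (par (back s t par r)) (back s t par r)) :
    Inv N s t cap (augment s t par c δ N) L ∧
      potential N (MinCut.augment s t par c δ N) L < potential N c L := by
  obtain ⟨r, hr, hrs, hδr⟩ := hδ'
  obtain ⟨h1, h2⟩ := back_spec hp ht hLt r hrs
  obtain ⟨h3, h4, h5⟩ := hp _ h1 hrs (by omega)
  have hpos : 0 < δ := hδr ▸ h4
  have hle : ∀ u v, L v = L u + 1 → MinCut.augment s t par c δ N u v ≤ c u v := by
    intro u v huv
    have := augment_level hp ht hLt δ N u v huv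
    by_cases hex : ∃ j < N, back s t par j ≠ s ∧ v = back s t par j ∧ u = par (back s t par j)
    · rw [this.1 hex]; linarith
    · rw [this.2 hex]
  refine ⟨⟨?_, ?_, h.label_s, h.label_le, ?_⟩, ?_⟩
  · intro u hu v hv
    by_cases huv : L v = L u + 1
    · have := augment_level hp ht hLt δ N u v huv
      by_cases hex : ∃ j < N, back s t par j ≠ s ∧ v = back s t par j ∧ u = par (back s t par j)
      · rw [this.1 hex]
        obtain ⟨j, hj, hjs, rfl, rfl⟩ := hex
        linarith [hδ j hj hjs]
      · rw [this.2 hex]; exact h.nonneg u hu v hv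
    · exact (h.nonneg u hu v hv).trans (augment_nonlevel hp ht hLt hpos.le N u v huv).1
  · obtain ⟨val, hval⟩ := h.cut_eq
    refine ⟨val + δ, fun S hsS htS => ?_⟩
    rw [cut_augment hp ht hLt δ S htS N, back_self hp ht hLt h.label_s, if_pos hsS,
      hval S hsS htS]
    ring
  · intro u hu v hv huv
    by_cases hlev : L v = L u + 1
    · exact hlev.le
    · rcases (augment_nonlevel hp ht hLt hpos.le N u v hlev).2 with e | e
      · rw [e] at huv; exact h.label_edge u hu v hv huv
      · omega
  · refine Nat.add_lt_add_left (Finset.card_lt_card ?_) _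
    refine (Finset.ssubset_iff_of_subset ?_).2 ⟨(par (back s t par r), back s t par r), ?_, ?_⟩
    · intro p hp'
      simp only [levelEdges, Finset.mem_filter] at hp' ⊢
      exact ⟨hp'.1, hp'.2.1.trans_le (hle _ _ hp'.2.2), hp'.2.2⟩
    · simp only [levelEdges, Finset.mem_filter, Finset.mem_product, Finset.mem_range]
      exact ⟨⟨h3, h1⟩, h4, h5⟩
    · simp only [levelEdges, Finset.mem_filter, not_and]
      intro _ hpos'
      rw [(augment_level hp ht hLt δ N _ _ h5).1 ⟨r, hr, hrs, rfl, rfl⟩] at hpos'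
      linarith

end

end MinCut

/-! ### Independent sets of bipartite graphs as minimum cuts -/

namespace MinCut

open Classical in
/-- The network for a heaviest independent set in the bipartite graph with edges `E` between the
left nodes `0, …, n - 1` and the right nodes `n, …, 2n - 1`. -/
noncomputable def bipCap (n : ℕ) (E : ℕ → ℕ → Prop) (wL wR : ℕ → ℝ) (big : ℝ) (x y : ℕ) : ℝ :=
  if x < n ∧ n ≤ y ∧ y < n + n ∧ E x (y - n) then big
  else if x = n + n ∧ y < n then wL y
  else if n ≤ x ∧ x < n + n ∧ y = n + n + 1 then wR (x - n)
  else 0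

variable {n : ℕ} {E : ℕ → ℕ → Prop} {wL wR : ℕ → ℝ} {big : ℝ}

open Classical in
-- The source is `n + n` and the sink `n + n + 1`. A left node is chosen if it lies in `S`, a right
-- node if it does not; the cut pays `big` for each conflict between chosen nodes and the weight of
-- every node not chosen.
theorem cut_bipCap (S : Set ℕ) (hs : n + n ∈ S) (ht : n + n + 1 ∉ S) :
    cut (n + n + 2) (bipCap n E wL wR big) S =
      (∑ v ∈ Finset.range n, ∑ u ∈ Finset.range n,
        if v ∈ S ∧ n + u ∉ S ∧ E v u then big else 0) +
      (∑ u ∈ Finset.range n, if n + u ∈ S then wR u else 0) +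
      ∑ v ∈ Finset.range n, if v ∈ S then 0 else wL v := by
  have h1 : ∀ v ∈ Finset.range n, (∑ y ∈ Finset.range (n + n + 2),
      if v ∈ S ∧ y ∉ S then bipCap n E wL wR big v y else 0) =
      ∑ u ∈ Finset.range n, if v ∈ S ∧ n + u ∉ S ∧ E v u then big else 0 := by
    intro v hv
    rw [Finset.mem_range] at hv
    rw [Finset.sum_range_succ, Finset.sum_range_succ, Finset.sum_range_add,
      Finset.sum_eq_zero (s := Finset.range n), zero_add]
    · have e1 : bipCap n E wL wR big v (n + n) = 0 := by
        simp only [bipCap]; rw [if_neg (by omega), if_neg (by omega), if_neg (by omega)]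
      have e2 : bipCap n E wL wR big v (n + n + 1) = 0 := by
        simp only [bipCap]; rw [if_neg (by omega), if_neg (by omega), if_neg (by omega)]
      rw [e1, e2, ite_self, ite_self, add_zero, add_zero]
      refine Finset.sum_congr rfl fun u hu => ?_
      rw [Finset.mem_range] at hu
      have e3 : bipCap n E wL wR big v (n + u) = if E v u then big else 0 := by
        simp only [bipCap, Nat.add_sub_cancel_left]
        split_ifs <;> first | rfl | omega | (exfalso; simp_all)
      rw [e3]
      split_ifs <;> simp_all
    · intro y hy
      rw [Finset.mem_range] at hy
      have e1 : bipCap n E wL wR big v y = 0 := by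
        simp only [bipCap]; rw [if_neg (by omega), if_neg (by omega), if_neg (by omega)]
      rw [e1, ite_self]
  have h2 : ∀ u ∈ Finset.range n, (∑ y ∈ Finset.range (n + n + 2),
      if n + u ∈ S ∧ y ∉ S then bipCap n E wL wR big (n + u) y else 0) =
      if n + u ∈ S then wR u else 0 := by
    intro u hu
    rw [Finset.mem_range] at hu
    rw [Finset.sum_range_succ, Finset.sum_eq_zero, zero_add]
    · have e1 : bipCap n E wL wR big (n + u) (n + n + 1) = wR u := by
        simp only [bipCap]
        rw [if_neg (by omega), if_neg (by omega), if_pos ⟨by omega, by omega, trivial⟩,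
          Nat.add_sub_cancel_left]
      rw [e1]; simp [ht]
    · intro y hy
      rw [Finset.mem_range] at hy
      have e1 : bipCap n E wL wR big (n + u) y = 0 := by
        simp only [bipCap]; rw [if_neg (by omega), if_neg (by omega), if_neg (by omega)]
      rw [e1, ite_self]
  have h3 : (∑ y ∈ Finset.range (n + n + 2),
      if n + n ∈ S ∧ y ∉ S then bipCap n E wL wR big (n + n) y else 0) =
      ∑ v ∈ Finset.range n, if v ∈ S then 0 else wL v := by
    rw [Finset.sum_range_succ, Finset.sum_range_succ, Finset.sum_range_add,
      Finset.sum_eq_zero (s := Finset.range n) (f := fun x => if n + n ∈ S ∧ n + x ∉ S then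
        bipCap n E wL wR big (n + n) (n + x) else 0)]
    · have e1 : bipCap n E wL wR big (n + n) (n + n + 1) = 0 := by
        simp only [bipCap]; rw [if_neg (by omega), if_neg (by omega), if_neg (by omega)]
      rw [e1, ite_self, if_neg (fun h => h.2 hs), add_zero, add_zero, add_zero]
      refine Finset.sum_congr rfl fun y hy => ?_
      rw [Finset.mem_range] at hy
      have e2 : bipCap n E wL wR big (n + n) y = wL y := by
        simp only [bipCap]; rw [if_neg (by omega), if_pos ⟨trivial, hy⟩]
      rw [e2]
      split_ifs <;> simp_all
    · intro y hy
      rw [Finset.mem_range] at hy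
      have e1 : bipCap n E wL wR big (n + n) (n + y) = 0 := by
        simp only [bipCap]; rw [if_neg (by omega), if_neg (by omega), if_neg (by omega)]
      rw [e1, ite_self]
  rw [cut, Finset.sum_range_succ, Finset.sum_range_succ, Finset.sum_range_add,
    Finset.sum_congr rfl h1, Finset.sum_congr rfl h2, h3]
  simp [ht]

theorem bipCap_nonneg (hL : ∀ v, 0 ≤ wL v) (hR : ∀ u, 0 ≤ wR u) (hbig : 0 ≤ big) (x y : ℕ) :
    0 ≤ bipCap n E wL wR big x y := by
  simp only [bipCap]
  split_ifs
  exacts [hbig, hL _, hR _, le_rfl]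

open Classical in
/-- A minimum cut of the network yields a heaviest independent set of the bipartite graph. -/
theorem max_independent_of_min_cut (hL : ∀ v, 0 ≤ wL v) (hR : ∀ u, 0 ≤ wR u)
    (hbig : ∑ v ∈ Finset.range n, wL v < big) (S : Set ℕ) (hs : n + n ∈ S) (ht : n + n + 1 ∉ S)
    (hmin : ∀ S' : Set ℕ, n + n ∈ S' → n + n + 1 ∉ S' →
      cut (n + n + 2) (bipCap n E wL wR big) S ≤ cut (n + n + 2) (bipCap n E wL wR big) S') :
    (∀ v < n, ∀ u < n, v ∈ S → n + u ∉ S → ¬ E v u) ∧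
    ∀ P Q : Set ℕ, (∀ v < n, ∀ u < n, v ∈ P → u ∈ Q → ¬ E v u) →
      (∑ v ∈ Finset.range n, if v ∈ P then wL v else 0) +
        (∑ u ∈ Finset.range n, if u ∈ Q then wR u else 0) ≤
      (∑ v ∈ Finset.range n, if v ∈ S then wL v else 0) +
        ∑ u ∈ Finset.range n, if n + u ∈ S then 0 else wR u := by
  have hbig0 : 0 < big := (Finset.sum_nonneg fun v _ => hL v).trans_lt hbig
  have hfree : ∀ v < n, ∀ u < n, v ∈ S → n + u ∉ S → ¬ E v u := by
    intro v hv u hu hvS huS hE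
    -- The cut around the source alone costs the total left weight, less than `big`, so a minimum
    -- cut cannot afford a conflict.
    obtain ⟨S₀, hS₀⟩ : ∃ S₀ : Set ℕ, ∀ x, x ∈ S₀ ↔ x = n + n := ⟨{n + n}, fun _ => Iff.rfl⟩
    have hs₀ : n + n ∈ S₀ := (hS₀ _).2 rfl
    have ht₀ : n + n + 1 ∉ S₀ := fun h => by have := (hS₀ _).1 h; omega
    have h1 := hmin S₀ hs₀ ht₀
    rw [cut_bipCap S hs ht, cut_bipCap S₀ hs₀ ht₀] at h1
    have h2 : big ≤ ∑ v ∈ Finset.range n, ∑ u ∈ Finset.range n,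
        if v ∈ S ∧ n + u ∉ S ∧ E v u then big else 0 := by
      have h3 : ∀ v u : ℕ, 0 ≤ if v ∈ S ∧ n + u ∉ S ∧ E v u then big else 0 := fun v u => by
        split_ifs <;> [exact hbig0.le; exact le_rfl]
      refine le_trans ?_ (Finset.single_le_sum (fun x _ => Finset.sum_nonneg fun y _ => h3 x y)
        (Finset.mem_range.2 hv))
      refine le_trans ?_ (Finset.single_le_sum (fun y _ => h3 v y) (Finset.mem_range.2 hu))
      rw [if_pos ⟨hvS, huS, hE⟩]
    have h4 : 0 ≤ ∑ u ∈ Finset.range n, if n + u ∈ S then wR u else 0 :=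
      Finset.sum_nonneg fun u _ => by split_ifs <;> [exact hR u; exact le_rfl]
    have h5 : 0 ≤ ∑ v ∈ Finset.range n, if v ∈ S then 0 else wL v :=
      Finset.sum_nonneg fun u _ => by split_ifs <;> [exact le_rfl; exact hL u]
    have h6 : (∑ v ∈ Finset.range n, ∑ u ∈ Finset.range n,
        if v ∈ S₀ ∧ n + u ∉ S₀ ∧ E v u then big else 0) = 0 := by
      refine Finset.sum_eq_zero fun v hv => Finset.sum_eq_zero fun u _ => if_neg ?_
      rw [Finset.mem_range] at hv
      simp only [hS₀]; omega
    have h7 : (∑ u ∈ Finset.range n, if n + u ∈ S₀ then wR u else 0) = 0 := by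
      refine Finset.sum_eq_zero fun u hu => if_neg ?_
      rw [Finset.mem_range] at hu
      simp only [hS₀]; omega
    have h8 : (∑ v ∈ Finset.range n, if v ∈ S₀ then 0 else wL v) =
        ∑ v ∈ Finset.range n, wL v := by
      refine Finset.sum_congr rfl fun u hu => if_neg ?_
      rw [Finset.mem_range] at hu
      simp only [hS₀]; omega
    rw [h6, h7, h8] at h1
    linarith
  refine ⟨hfree, fun P Q hPQ => ?_⟩
  -- This cut encodes the choice of `P` and `Q`.
  obtain ⟨S', hS'⟩ : ∃ S' : Set ℕ, ∀ x, x ∈ S' ↔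
      x = n + n ∨ (x < n ∧ x ∈ P) ∨ (n ≤ x ∧ x < n + n ∧ x - n ∉ Q) := ⟨{x | _}, fun _ => Iff.rfl⟩
  have hs' : n + n ∈ S' := (hS' _).2 (.inl rfl)
  have ht' : n + n + 1 ∉ S' := by rw [hS']; omega
  have hl : ∀ v < n, (v ∈ S' ↔ v ∈ P) := fun v hv => by
    simp only [hS']
    constructor
    · rintro (h | h | h)
      · omega
      · exact h.2
      · omega
    · exact fun h => .inr (.inl ⟨hv, h⟩)
  have hr : ∀ u < n, (n + u ∈ S' ↔ u ∉ Q) := fun u hu => by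
    simp only [hS', Nat.add_sub_cancel_left]
    constructor
    · rintro (h | h | h)
      · omega
      · omega
      · exact h.2.2
    · exact fun h => .inr (.inr ⟨by omega, by omega, h⟩)
  have h1 := hmin S' hs' ht'
  rw [cut_bipCap S hs ht, cut_bipCap S' hs' ht'] at h1
  have zero : ∀ S : Set ℕ, (∀ v < n, ∀ u < n, v ∈ S → n + u ∉ S → ¬ E v u) →
      (∑ v ∈ Finset.range n, ∑ u ∈ Finset.range n,
        if v ∈ S ∧ n + u ∉ S ∧ E v u then big else 0) = 0 := fun S h =>
    Finset.sum_eq_zero fun v hv => Finset.sum_eq_zero fun u hu => if_neg fun h' =>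
      h v (Finset.mem_range.1 hv) u (Finset.mem_range.1 hu) h'.1 h'.2.1 h'.2.2
  rw [zero S hfree, zero S' fun v hv u hu hvS huS =>
    hPQ v hv u hu ((hl v hv).1 hvS) (by_contra fun h => huS ((hr u hu).2 h))] at h1
  have eL : ∀ S : Set ℕ, (∑ v ∈ Finset.range n, if v ∈ S then 0 else wL v) =
      (∑ v ∈ Finset.range n, wL v) - ∑ v ∈ Finset.range n, if v ∈ S then wL v else 0 := by
    intro S
    rw [← Finset.sum_sub_distrib]
    exact Finset.sum_congr rfl fun v _ => by split_ifs <;> simp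
  have eR : ∀ S : Set ℕ, (∑ u ∈ Finset.range n, if n + u ∈ S then wR u else 0) =
      (∑ u ∈ Finset.range n, wR u) - ∑ u ∈ Finset.range n, if n + u ∈ S then 0 else wR u := by
    intro S
    rw [← Finset.sum_sub_distrib]
    exact Finset.sum_congr rfl fun v _ => by split_ifs <;> simp
  rw [eL, eL, eR, eR] at h1
  have e1 : (∑ v ∈ Finset.range n, if v ∈ S' then wL v else 0) =
      ∑ v ∈ Finset.range n, if v ∈ P then wL v else 0 :=
    Finset.sum_congr rfl fun v hv => by simp only [hl v (Finset.mem_range.1 hv)]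
  have e2 : (∑ u ∈ Finset.range n, if n + u ∈ S' then 0 else wR u) =
      ∑ u ∈ Finset.range n, if u ∈ Q then wR u else 0 :=
    Finset.sum_congr rfl fun u hu => by
      simp only [hr u (Finset.mem_range.1 hu), ite_not]
  rw [e1, e2] at h1
  linarith

end MinCut

/-! ## The minimum cut program -/

namespace RAM

/-- The scalar variable stored in the cell `(0, 0)` of an integer array. -/
def nv (a : ℕ) : NatExpr := .cell a (.const 0) (.const 0)

/-- The entry `i` of the integer list stored in column `0` of an array. -/
def na (a : ℕ) (i : NatExpr) : NatExpr := .cell a i (.const 0)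

/-- The scalar variable stored in the cell `(0, 0)` of a real array. -/
def rv (a : ℕ) : RealExpr := .cell a (.const 0) (.const 0)

@[simp] theorem eval_nv (a : ℕ) (s : State) : (nv a).eval s = s.nat a 0 0 := rfl
@[simp] theorem eval_na (a : ℕ) (i : NatExpr) (s : State) :
    (na a i).eval s = s.nat a (i.eval s) 0 := rfl
@[simp] theorem eval_rv (a : ℕ) (s : State) : (rv a).eval s = s.real a 0 0 := rfl

namespace Cmd

/-- Assignment to a scalar integer variable. -/
def asg (a : ℕ) (x : NatExpr) : Cmd := .setNat a (.const 0) (.const 0) x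

/-- Assignment to an entry of an integer list. -/
def asgAt (a : ℕ) (i x : NatExpr) : Cmd := .setNat a i (.const 0) x

/-- Assignment to a scalar real variable. -/
def asgR (a : ℕ) (x : RealExpr) : Cmd := .setReal a (.const 0) (.const 0) x

/-- Conditional execution. -/
def whenever (b : Test) (c : Cmd) : Cmd := .ite b c .skip

variable {N : ℕ}

@[simp] theorem sem_skip (s : State) : skip.sem N s = s := rfl
@[simp] theorem sem_seq (c d : Cmd) (s : State) : (seq c d).sem N s = d.sem N (c.sem N s) := rfl
@[simp] theorem sem_asg (a : ℕ) (x : NatExpr) (s : State) :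
    (asg a x).sem N s = s.setNat a 0 0 (x.eval s) := rfl
@[simp] theorem sem_asgAt (a : ℕ) (i x : NatExpr) (s : State) :
    (asgAt a i x).sem N s = s.setNat a (i.eval s) 0 (x.eval s) := rfl
@[simp] theorem sem_asgR (a : ℕ) (x : RealExpr) (s : State) :
    (asgR a x).sem N s = s.setReal a 0 0 (x.eval s) := rfl
@[simp] theorem sem_setReal (a : ℕ) (i j : NatExpr) (x : RealExpr) (s : State) :
    (setReal a i j x).sem N s = s.setReal a (i.eval s) (j.eval s) (x.eval s) := rfl
theorem sem_whenever_pos {b : Test} {c : Cmd} {s : State} (h : b.Holds s) :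
    (whenever b c).sem N s = c.sem N s := sem_ite_pos h
theorem sem_whenever_neg {b : Test} {c : Cmd} {s : State} (h : ¬ b.Holds s) :
    (whenever b c).sem N s = s := sem_ite_neg h

end Cmd

open Cmd MinCut

/-- Look for a predecessor of the vertex in variable `5`; the result goes to array `9` and the
success to variable `10`. -/
def findPar : Cmd :=
  seq (asg 10 (.const 0)) (loop 6 (whenever
    (.and (.not (.realLE (.cell 2 (nv 6) (nv 5)) .zero))
      (.natEq (na 8 (nv 5)) (.add (na 8 (nv 6)) (.const 1))))
    (seq (asg 10 (.const 1)) (asgAt 9 (nv 5) (nv 6)))))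

/-- Raise the labels of vertices without predecessors; variable `11` tells if there were any. -/
def sweep : Cmd :=
  seq (asg 11 (.const 0)) (loop 5 (seq findPar (whenever
    (.and (.natEq (nv 10) (.const 0)) (.and (.not (.natEq (nv 5) (.add (nv 0) (nv 0))))
      (.natLE (na 8 (nv 5)) (nv 4))))
    (seq (asgAt 8 (nv 5) (.add (na 8 (nv 5)) (.const 1))) (asg 11 (.const 1))))))

/-- The last node of the network. -/
def sinkE : NatExpr := .add (.add (nv 0) (nv 0)) (.const 1)

/-- Store the bottleneck of the augmenting path in the real variable `4`. -/
def bottleneck : Cmd :=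
  seq (asg 12 sinkE) (seq (asgR 4 (.cell 2 (na 9 (nv 12)) (nv 12)))
    (loop 7 (whenever (.not (.natEq (nv 12) (.add (nv 0) (nv 0))))
      (seq (whenever (.not (.realLE (rv 4) (.cell 2 (na 9 (nv 12)) (nv 12))))
          (asgR 4 (.cell 2 (na 9 (nv 12)) (nv 12))))
        (asg 12 (na 9 (nv 12)))))))

/-- Send the bottleneck along the augmenting path. -/
def pushPath : Cmd :=
  seq (asg 12 sinkE) (loop 7 (whenever (.not (.natEq (nv 12) (.add (nv 0) (nv 0))))
    (seq (setReal 2 (na 9 (nv 12)) (nv 12) (.sub (.cell 2 (na 9 (nv 12)) (nv 12)) (rv 4)))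
      (seq (setReal 2 (nv 12) (na 9 (nv 12)) (.add (.cell 2 (nv 12) (na 9 (nv 12))) (rv 4)))
        (asg 12 (na 9 (nv 12)))))))

/-- One step of the minimum cut algorithm. -/
def flowStep : Cmd :=
  seq sweep (whenever (.and (.natEq (nv 11) (.const 0)) (.natLE (na 8 sinkE) (nv 4)))
    (seq bottleneck pushPath))

/-- `loops a k c` runs `c` in `k` nested loops with the counters `a, …, a + k - 1`. -/
def loops (a : ℕ) : ℕ → Cmd → Cmd
  | 0, c => c
  | k + 1, c => loop (a + k) (loops a k c)

/-- The minimum cut algorithm. -/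
def flow : Cmd := loops 20 7 flowStep

/-- The labels of the vertices. -/
def State.labels (s : State) : ℕ → ℕ := fun v => s.nat 8 v 0

/-- The predecessors of the vertices. -/
def State.pars (s : State) : ℕ → ℕ := fun v => s.nat 9 v 0

variable {N : ℕ}

/-- The last clause preserves the predecessors found for other vertices, which the sweep collects.
-/
theorem findPar_spec (s : State) (v : ℕ) (hv : s.nat 5 0 0 = v) :
    (((findPar.sem N s).nat 10 0 0 = 1 ∧ (findPar.sem N s).pars v < N ∧
        0 < s.real 2 ((findPar.sem N s).pars v) v ∧
        s.labels v = s.labels ((findPar.sem N s).pars v) + 1) ∨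
      ((findPar.sem N s).nat 10 0 0 = 0 ∧ ∀ u < N, 0 < s.real 2 u v → s.labels v ≠ s.labels u + 1)) ∧
    ∀ x, x ≠ v → (findPar.sem N s).pars x = s.pars x := by
  simp only [findPar, sem_seq, sem_asg]
  refine sem_loop_ind (fun k st =>
    ((st.nat 10 0 0 = 1 ∧ st.pars v < N ∧ 0 < s.real 2 (st.pars v) v ∧
        s.labels v = s.labels (st.pars v) + 1) ∨
      (st.nat 10 0 0 = 0 ∧ ∀ u < k, 0 < s.real 2 u v → s.labels v ≠ s.labels u + 1)) ∧
    ∀ x, x ≠ v → st.pars x = s.pars x) (Q := fun st =>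
    ((st.nat 10 0 0 = 1 ∧ st.pars v < N ∧ 0 < s.real 2 (st.pars v) v ∧
        s.labels v = s.labels (st.pars v) + 1) ∨
      (st.nat 10 0 0 = 0 ∧ ∀ u < N, 0 < s.real 2 u v → s.labels v ≠ s.labels u + 1)) ∧
    ∀ x, x ≠ v → st.pars x = s.pars x) ?_ ?_ ?_
  · simp [State.pars]
  · rintro k hk st ⟨hf, hr⟩ hI
    have h5 : st.nat 5 = s.nat 5 := (hf 5 (by decide)).trans (by funext; simp)
    have h8 : st.nat 8 = s.nat 8 := (hf 8 (by decide)).trans (by funext; simp)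
    have h2 : st.real 2 = s.real 2 := (hr 2 (by decide)).trans (by simp)
    have hc : (Test.and (.not (.realLE (.cell 2 (nv 6) (nv 5)) .zero))
      (.natEq (na 8 (nv 5)) (.add (na 8 (nv 6)) (.const 1)))).Holds (st.setNat 6 0 0 k) ↔
        0 < s.real 2 k v ∧ s.labels v = s.labels k + 1 := by
      simp [h5, h8, h2, hv, State.labels]
    by_cases h : 0 < s.real 2 k v ∧ s.labels v = s.labels k + 1
    · rw [sem_whenever_pos (hc.2 h)]
      refine ⟨.inl ?_, ?_⟩
      · simpa [State.pars, h5, hv, hk] using h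
      · intro x hx
        have := hI.2 x hx
        simpa [State.pars, h5, hv, hx] using this
    · rw [sem_whenever_neg (hc.not.2 h)]
      simp only [State.pars, State.setNat_nat] at hI ⊢
      simp only [Nat.reduceEqDiff, false_and, if_false]
      refine ⟨hI.1.imp id fun h' => ⟨h'.1, fun u hu hpos hl => ?_⟩, hI.2⟩
      rcases Nat.lt_succ_iff_lt_or_eq.1 hu with hu | rfl
      · exact h'.2 u hu hpos hl
      · exact h ⟨hpos, hl⟩
  · intro st _ hI
    simpa [State.pars] using hI

theorem labels_setNat (s : State) (v x : ℕ) :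
    (s.setNat 8 v 0 x).labels = Function.update s.labels v x := by
  funext y
  by_cases h : y = v <;> simp [State.labels, h]

/-- While no label has been raised, all predecessors refer to the same labels, so an idle sweep
yields a complete choice of predecessors. After a raise they may be stale, but then they are not
used. The first raise shows that the initial labels were not exact; hence exact labels are never
altered. -/
theorem sweep_spec {n : ℕ} {cap : ℕ → ℕ → ℝ} (s : State) (hn : s.nat 0 0 0 = n)
    (hN : s.nat 4 0 0 = N) {t : ℕ} (h : MinCut.Inv N (n + n) t cap (s.real 2) s.labels) :
    ((sweep.sem N s).nat 11 0 0 = 0 ∧ (sweep.sem N s).labels = s.labels ∧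
      IsPar N (n + n) (s.real 2) s.labels (sweep.sem N s).pars) ∨
    ((sweep.sem N s).nat 11 0 0 = 1 ∧
      MinCut.Inv N (n + n) t cap (s.real 2) (sweep.sem N s).labels ∧
      potential N (s.real 2) (sweep.sem N s).labels < potential N (s.real 2) s.labels ∧
      ¬ Exact N (n + n) (s.real 2) s.labels) := by
  simp only [sweep, sem_seq, sem_asg]
  refine sem_loop_ind (fun k st =>
    (st.nat 11 0 0 = 0 ∧ st.labels = s.labels ∧ ∀ v < k, v < N → v ≠ n + n → s.labels v ≤ N →
      st.pars v < N ∧ 0 < s.real 2 (st.pars v) v ∧ s.labels v = s.labels (st.pars v) + 1) ∨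
    (st.nat 11 0 0 = 1 ∧ MinCut.Inv N (n + n) t cap (s.real 2) st.labels ∧
      potential N (s.real 2) st.labels < potential N (s.real 2) s.labels ∧
      ¬ Exact N (n + n) (s.real 2) s.labels)) (Q := fun st =>
    (st.nat 11 0 0 = 0 ∧ st.labels = s.labels ∧ IsPar N (n + n) (s.real 2) s.labels st.pars) ∨
    (st.nat 11 0 0 = 1 ∧ MinCut.Inv N (n + n) t cap (s.real 2) st.labels ∧
      potential N (s.real 2) st.labels < potential N (s.real 2) s.labels ∧
      ¬ Exact N (n + n) (s.real 2) s.labels)) ?_ ?_ ?_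
  · exact .inl ⟨by simp, by funext; simp [State.labels], by simp⟩
  · rintro k hk st ⟨hf, hr⟩ hI
    have e0 : st.nat 0 = s.nat 0 := (hf 0 (by decide)).trans (by funext; simp)
    have e4 : st.nat 4 = s.nat 4 := (hf 4 (by decide)).trans (by funext; simp)
    have e2 : st.real 2 = s.real 2 := (hr 2 (by decide)).trans (by simp)
    simp only [sem_seq]
    obtain ⟨f1, f2⟩ := findPar_spec (N := N) (st.setNat 5 0 0 k) k (by simp)
    have g0 : (findPar.sem N (st.setNat 5 0 0 k)).nat 0 0 0 = n := by
      rw [sem_nat findPar _ (by decide), State.setNat_nat_of_ne _ (by decide), e0, hn]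
    have g4 : (findPar.sem N (st.setNat 5 0 0 k)).nat 4 0 0 = N := by
      rw [sem_nat findPar _ (by decide), State.setNat_nat_of_ne _ (by decide), e4, hN]
    have g5 : (findPar.sem N (st.setNat 5 0 0 k)).nat 5 0 0 = k := by
      rw [sem_nat findPar _ (by decide)]; simp
    have g8 : (findPar.sem N (st.setNat 5 0 0 k)).labels = st.labels := by
      funext v; simp only [State.labels]
      rw [sem_nat findPar _ (by decide), State.setNat_nat_of_ne _ (by decide)]
    have g11 : (findPar.sem N (st.setNat 5 0 0 k)).nat 11 0 0 = st.nat 11 0 0 := by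
      rw [sem_nat findPar _ (by decide), State.setNat_nat_of_ne _ (by decide)]
    have gl : (st.setNat 5 0 0 k).labels = st.labels := by
      funext v; simp [State.labels]
    have gp : (st.setNat 5 0 0 k).pars = st.pars := by
      funext v; simp [State.pars]
    rw [gl, State.setNat_real, e2] at f1
    rw [gp] at f2
    generalize findPar.sem N (st.setNat 5 0 0 k) = st' at *
    have hcond : (Test.and (.natEq (nv 10) (.const 0)) (.and (.not (.natEq (nv 5)
        (.add (nv 0) (nv 0)))) (.natLE (na 8 (nv 5)) (nv 4)))).Holds st' ↔
        st'.nat 10 0 0 = 0 ∧ k ≠ n + n ∧ st.labels k ≤ N := by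
      rw [← g8]; simp [g0, g4, g5, State.labels]
    by_cases hc : st'.nat 10 0 0 = 0 ∧ k ≠ n + n ∧ st.labels k ≤ N
    · rw [sem_whenever_pos (hcond.2 hc)]
      right
      have hno := (f1.resolve_left fun h' => by simp [hc.1] at h').2
      have hInv : MinCut.Inv N (n + n) t cap (s.real 2) st.labels ∧
          potential N (s.real 2) st.labels ≤ potential N (s.real 2) s.labels ∧
          ¬ Exact N (n + n) (s.real 2) s.labels := by
        rcases hI with ⟨-, hI, -⟩ | ⟨-, hI, hI', hI''⟩
        · rw [hI] at hno hc ⊢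
          refine ⟨h, le_rfl, fun hE => ?_⟩
          obtain ⟨u, hu, hu', hu''⟩ := hE k hk hc.2.1 hc.2.2
          exact hno u hu hu' hu''
        · exact ⟨hI, hI'.le, hI''⟩
      obtain ⟨r1, r2⟩ := hInv.1.relabel hk hc.2.1 hc.2.2 hno
      have e8 : st'.nat 8 k 0 = st.labels k := by rw [← g8]; rfl
      have el : ∀ z, ((st'.setNat 8 k 0 z).setNat 11 0 0 1).labels =
          Function.update st.labels k z := by
        intro z
        rw [← g8, ← labels_setNat]
        funext y; simp [State.labels]
      simp only [sem_seq, sem_asgAt, sem_asg, eval_nv, eval_na, NatExpr.eval, g5, e8, el]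
      exact ⟨by simp, r1, r2.trans_le hInv.2.1, hInv.2.2⟩
    · rw [sem_whenever_neg (hcond.not.2 hc), g8, g11]
      refine hI.imp (fun ⟨i1, i2, i3⟩ => ⟨i1, i2, fun v hv hvN hvs hvL => ?_⟩) id
      rcases Nat.lt_succ_iff_lt_or_eq.1 hv with hv | rfl
      · rw [f2 v (by omega)]; exact i3 v hv hvN hvs hvL
      · rw [i2] at f1 hc
        have f1' := f1.resolve_right fun h' => hc ⟨h'.1, hvs, hvL⟩
        exact f1'.2
  · rintro st - hI
    have el : (st.setNat 5 0 0 N).labels = st.labels := by funext; simp [State.labels]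
    have ep : (st.setNat 5 0 0 N).pars = st.pars := by funext; simp [State.pars]
    rw [el, ep]
    simp only [State.setNat_nat, Nat.reduceEqDiff, false_and, if_false]
    exact hI.imp (fun ⟨i1, i2, i3⟩ => ⟨i1, i2, fun v hv => i3 v hv hv⟩) id

end RAM

/-! ### Augmentation and termination of the minimum cut program -/

namespace RAM

open Cmd MinCut

variable {N : ℕ}

theorem bottleneck_spec {n : ℕ} (s : State) (hn : s.nat 0 0 0 = n) (hN : N = n + n + 2) :
    (∀ r < N, back (n + n) (n + n + 1) s.pars r ≠ n + n → (bottleneck.sem N s).real 4 0 0 ≤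
      s.real 2 (s.pars (back (n + n) (n + n + 1) s.pars r)) (back (n + n) (n + n + 1) s.pars r)) ∧
    ∃ r < N, back (n + n) (n + n + 1) s.pars r ≠ n + n ∧ (bottleneck.sem N s).real 4 0 0 =
      s.real 2 (s.pars (back (n + n) (n + n + 1) s.pars r)) (back (n + n) (n + n + 1) s.pars r) := by
  simp only [bottleneck, sem_seq, sem_asg, sem_asgR]
  set b := back (n + n) (n + n + 1) s.pars with hb
  refine sem_loop_ind (fun k st => st.nat 12 0 0 = b k ∧
    (∀ r < k, b r ≠ n + n → st.real 4 0 0 ≤ s.real 2 (s.pars (b r)) (b r)) ∧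
    ∃ r < N, b r ≠ n + n ∧ st.real 4 0 0 = s.real 2 (s.pars (b r)) (b r)) (Q := fun st =>
    (∀ r < N, b r ≠ n + n → st.real 4 0 0 ≤ s.real 2 (s.pars (b r)) (b r)) ∧
    ∃ r < N, b r ≠ n + n ∧ st.real 4 0 0 = s.real 2 (s.pars (b r)) (b r)) ?_ ?_ ?_
  -- The minimum is initialised with the edge into the sink, at position 0 of the path.
  · refine ⟨by simp [sinkE, hn, hb, back], by simp, 0, by omega, by simp [hb, back], ?_⟩
    simp [sinkE, hn, hb, back, State.pars]
  · rintro k hk st ⟨hf, hr⟩ ⟨i1, i2, i3⟩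
    have e0 : st.nat 0 0 0 = n := by rw [hf 0 (by decide)]; simpa using hn
    have e9 : ∀ x, st.nat 9 x 0 = s.pars x := fun x => by
      rw [hf 9 (by decide)]; simp [State.pars]
    have e2 : st.real 2 = s.real 2 := (hr 2 (by decide)).trans (by funext; simp)
    have hb1 : b (k + 1) = if b k = n + n then n + n else s.pars (b k) := rfl
    have hcond : (Test.not (.natEq (nv 12) (.add (nv 0) (nv 0)))).Holds (st.setNat 7 0 0 k) ↔
        b k ≠ n + n := by
      simp [e0, i1]
    by_cases hc : b k = n + n
    · rw [sem_whenever_neg (fun h => hcond.1 h hc)]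
      simp only [State.setNat_nat, State.setNat_real, Nat.reduceEqDiff, false_and, if_false]
      rw [hb1, if_pos hc]
      refine ⟨by rw [i1, hc], fun r hr hrs => ?_, i3⟩
      rcases Nat.lt_succ_iff_lt_or_eq.1 hr with hr | rfl
      · exact i2 r hr hrs
      · exact absurd hc hrs
    · rw [sem_whenever_pos (hcond.2 hc), hb1, if_neg hc]
      have hcond2 : (Test.not (.realLE (rv 4) (.cell 2 (na 9 (nv 12)) (nv 12)))).Holds
          (st.setNat 7 0 0 k) ↔ s.real 2 (s.pars (b k)) (b k) < st.real 4 0 0 := by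
        simp [i1, e9, e2]
      by_cases hc2 : s.real 2 (s.pars (b k)) (b k) < st.real 4 0 0
      · rw [sem_seq, sem_whenever_pos (hcond2.2 hc2)]
        simp only [sem_asgR, sem_asg, eval_na, eval_nv, State.setReal_nat, State.setNat_nat,
          RealExpr.eval, Nat.reduceEqDiff, false_and, if_false, i1, e9, State.setNat_real, e2,
          State.setReal_real, and_self, if_true]
        refine ⟨trivial, fun r hr hrs => ?_, k, hk, hc, rfl⟩
        rcases Nat.lt_succ_iff_lt_or_eq.1 hr with hr | rfl
        · exact hc2.le.trans (i2 r hr hrs)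
        · exact le_rfl
      · rw [sem_seq, sem_whenever_neg (hcond2.not.2 hc2)]
        simp only [sem_asg, eval_na, eval_nv, State.setNat_nat,
          Nat.reduceEqDiff, false_and, if_false, i1, e9, State.setNat_real,
          and_self, if_true]
        refine ⟨trivial, fun r hr hrs => ?_, i3⟩
        rcases Nat.lt_succ_iff_lt_or_eq.1 hr with hr | rfl
        · exact i2 r hr hrs
        · exact not_lt.1 hc2
  · rintro st - ⟨-, i2, i3⟩
    exact ⟨i2, i3⟩

theorem pushPath_spec {n : ℕ} (s : State) (hn : s.nat 0 0 0 = n) (hN : N = n + n + 2)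
    (hp : IsPar N (n + n) (s.real 2) s.labels s.pars) (ht : s.labels (n + n + 1) ≤ N) : (pushPath.sem N s).real 2 =
    augment (n + n) (n + n + 1) s.pars (s.real 2) (s.real 4 0 0) N := by
  simp only [pushPath, sem_seq, sem_asg]
  set b := back (n + n) (n + n + 1) s.pars with hb
  refine sem_loop_ind (fun k st => st.nat 12 0 0 = b k ∧
    st.real 2 = augment (n + n) (n + n + 1) s.pars (s.real 2) (s.real 4 0 0) k) (Q := fun st =>
    st.real 2 = augment (n + n) (n + n + 1) s.pars (s.real 2) (s.real 4 0 0) N) ?_ ?_ ?_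
  · exact ⟨by simp [sinkE, hn, hb, back], by simp [augment]⟩
  · rintro k hk st ⟨hf, hr⟩ ⟨i1, i2⟩
    have e0 : st.nat 0 0 0 = n := by rw [hf 0 (by decide)]; simpa using hn
    have e9 : ∀ x, st.nat 9 x 0 = s.pars x := fun x => by
      rw [hf 9 (by decide)]; simp [State.pars]
    have e4 : st.real 4 = s.real 4 := (hr 4 (by decide)).trans (by funext; simp)
    have hb1 : b (k + 1) = if b k = n + n then n + n else s.pars (b k) := rfl
    have ha1 : augment (n + n) (n + n + 1) s.pars (s.real 2) (s.real 4 0 0) (k + 1) =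
      if b k = n + n then augment (n + n) (n + n + 1) s.pars (s.real 2) (s.real 4 0 0) k
      else push (augment (n + n) (n + n + 1) s.pars (s.real 2) (s.real 4 0 0) k)
        (s.pars (b k)) (b k) (s.real 4 0 0) := rfl
    have hcond : (Test.not (.natEq (nv 12) (.add (nv 0) (nv 0)))).Holds (st.setNat 7 0 0 k) ↔
        b k ≠ n + n := by
      simp [e0, i1]
    by_cases hc : b k = n + n
    · rw [sem_whenever_neg (fun h => hcond.1 h hc), ha1, if_pos hc, hb1, if_pos hc]
      exact ⟨by simp [i1, hc], by simpa using i2⟩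
    · rw [sem_whenever_pos (hcond.2 hc), ha1, if_neg hc, hb1, if_neg hc, ← i2]
      obtain ⟨h1, h2⟩ := back_spec hp (by omega) ht k hc
      obtain ⟨-, -, h4⟩ := hp _ h1 hc (by omega)
      -- The edge and its reverse occupy different cells, so the second assignment does not read the
      -- result of the first.
      have hne : s.pars (b k) ≠ b k := fun e => by rw [hb] at e; rw [e] at h4; omega
      simp only [sem_seq, sem_setReal, sem_asg, eval_na, eval_nv, State.setReal_nat,
        State.setNat_nat, RealExpr.eval, Nat.reduceEqDiff, false_and, if_false, i1, e9,
        State.setNat_real, State.setReal_real, and_self, if_true, eval_rv, e4]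
      refine ⟨trivial, ?_⟩
      funext x y
      simp only [State.setReal_real, push, State.setNat_real, true_and]
      by_cases h5 : x = b k ∧ y = s.pars (b k)
      · have h6 : ¬ (b k = s.pars (b k) ∧ s.pars (b k) = b k) := fun h => hne h.2
        rw [if_pos h5, if_pos h5, if_neg h6, h5.1, h5.2]
      · rw [if_neg h5, if_neg h5]
        by_cases h6 : x = s.pars (b k) ∧ y = b k
        · rw [if_pos h6, if_pos h6, h6.1, h6.2]
        · rw [if_neg h6, if_neg h6]
  · rintro st - ⟨-, i⟩
    simpa using i

/-- The algorithm has found a minimum cut. -/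
def FlowDone (N n : ℕ) (s : State) : Prop :=
  Exact N (n + n) (s.real 2) s.labels ∧ s.labels (n + n + 1) = N + 1

/-- The part of the memory on which the minimum cut algorithm depends is in order. -/
def FlowOK (N n : ℕ) (cap : ℕ → ℕ → ℝ) (s : State) : Prop :=
  s.nat 0 0 0 = n ∧ s.nat 4 0 0 = N ∧ N = n + n + 2 ∧
    MinCut.Inv N (n + n) (n + n + 1) cap (s.real 2) s.labels

/-- A sweep that raises labels lowers the potential, and so does an augmentation after an idle
sweep. An idle sweep with the sink unreached means that a minimum cut has been found. -/
theorem flowStep_spec {n : ℕ} {cap : ℕ → ℕ → ℝ} {s : State} (h : FlowOK N n cap s) :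
    FlowOK N n cap (flowStep.sem N s) ∧
      (FlowDone N n (flowStep.sem N s) ∧
        potential N ((flowStep.sem N s).real 2) (flowStep.sem N s).labels ≤
          potential N (s.real 2) s.labels ∨
      potential N ((flowStep.sem N s).real 2) (flowStep.sem N s).labels <
        potential N (s.real 2) s.labels) := by
  obtain ⟨hn, h4, hN, hI⟩ := h
  simp only [flowStep, sem_seq]
  have hs := sweep_spec s hn h4 hI
  have e0 : (sweep.sem N s).nat 0 0 0 = n := by rw [sem_nat sweep _ (by decide), hn]
  have e4 : (sweep.sem N s).nat 4 0 0 = N := by rw [sem_nat sweep _ (by decide), h4]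
  have e2 : (sweep.sem N s).real 2 = s.real 2 := sem_real sweep _ (by decide)
  generalize sweep.sem N s = st at *
  have hcond : (Test.and (.natEq (nv 11) (.const 0)) (.natLE (na 8 sinkE) (nv 4))).Holds st ↔
      st.nat 11 0 0 = 0 ∧ st.labels (n + n + 1) ≤ N := by
    simp [sinkE, e0, e4, State.labels]
  by_cases hc : st.nat 11 0 0 = 0 ∧ st.labels (n + n + 1) ≤ N
  · rw [sem_whenever_pos (hcond.2 hc), sem_seq]
    rcases hs with ⟨-, hl, hp⟩ | ⟨h1, -⟩
    swap
    · simp [hc.1] at h1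
    rw [← hl] at hp hI
    rw [← e2] at hp hI
    have hb := bottleneck_spec st e0 hN
    have b0 : (bottleneck.sem N st).nat 0 0 0 = n := by rw [sem_nat bottleneck _ (by decide), e0]
    have b4 : (bottleneck.sem N st).nat 4 0 0 = N := by rw [sem_nat bottleneck _ (by decide), e4]
    have b2 : (bottleneck.sem N st).real 2 = st.real 2 := sem_real bottleneck _ (by decide)
    have bl : (bottleneck.sem N st).labels = st.labels := by
      funext; simp only [State.labels]; rw [sem_nat bottleneck _ (by decide)]
    have bp : (bottleneck.sem N st).pars = st.pars := by
      funext; simp only [State.pars]; rw [sem_nat bottleneck _ (by decide)]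
    generalize bottleneck.sem N st = st' at *
    have hq := pushPath_spec (N := N) st' b0 hN (by rwa [b2, bl, bp]) (by rw [bl]; exact hc.2)
    rw [bp, b2] at hq
    have q0 : (pushPath.sem N st').nat 0 0 0 = n := by rw [sem_nat pushPath _ (by decide), b0]
    have q4 : (pushPath.sem N st').nat 4 0 0 = N := by rw [sem_nat pushPath _ (by decide), b4]
    have ql : (pushPath.sem N st').labels = st.labels := by
      rw [← bl]; funext; simp only [State.labels]; rw [sem_nat pushPath _ (by decide)]
    obtain ⟨a1, a2⟩ := Inv.augment hp (by omega) hc.2 hI hb.1 hb.2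
    refine ⟨⟨q0, q4, hN, by rw [hq, ql]; exact a1⟩, .inr ?_⟩
    rw [hq, ql]
    rw [hl, e2] at a2 ⊢
    exact a2
  · rw [sem_whenever_neg (hcond.not.2 hc), e2]
    rcases hs with ⟨h1, hl, hp⟩ | ⟨h1, h2, h3, -⟩
    · refine ⟨⟨e0, e4, hN, by rw [e2, hl]; exact hI⟩, .inl ⟨⟨by rw [e2, hl]; exact hp.exact, ?_⟩,
        by rw [hl]⟩⟩
      have := hI.label_le (n + n + 1) (by omega)
      have hc' : ¬ st.labels (n + n + 1) ≤ N := fun h => hc ⟨h1, h⟩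
      rw [hl] at hc' ⊢
      omega
    · exact ⟨⟨e0, e4, hN, by rw [e2]; exact h2⟩, .inr h3⟩

/-- When a minimum cut has been found, nothing relevant changes any more. -/
theorem flowStep_of_done {n : ℕ} {cap : ℕ → ℕ → ℝ} {s : State} (h : FlowOK N n cap s)
    (hd : FlowDone N n s) : FlowDone N n (flowStep.sem N s) := by
  obtain ⟨hn, h4, hN, hI⟩ := h
  obtain ⟨hE, ht⟩ := hd
  simp only [flowStep, sem_seq]
  have hs := sweep_spec s hn h4 hI
  have e0 : (sweep.sem N s).nat 0 0 0 = n := by rw [sem_nat sweep _ (by decide), hn]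
  have e4 : (sweep.sem N s).nat 4 0 0 = N := by rw [sem_nat sweep _ (by decide), h4]
  have e2 : (sweep.sem N s).real 2 = s.real 2 := sem_real sweep _ (by decide)
  generalize sweep.sem N s = st at *
  rcases hs with ⟨-, hl, -⟩ | ⟨-, -, -, h⟩
  · have e8 : st.nat 8 (n + n + 1) 0 = N + 1 := by rw [← ht, ← hl]; rfl
    rw [sem_whenever_neg (by simp [sinkE, e0, e4, e8]), FlowDone, e2, hl]
    exact ⟨hE, ht⟩
  · exact absurd hE h

theorem flowOK_setNat {n : ℕ} {cap : ℕ → ℕ → ℝ} {s : State} (h : FlowOK N n cap s) {a : ℕ}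
    (ha : 20 ≤ a) (v : ℕ) : FlowOK N n cap (s.setNat a 0 0 v) := by
  have e : (s.setNat a 0 0 v).labels = s.labels := by
    funext; simp only [State.labels]; rw [State.setNat_nat_of_ne _ (by omega)]
  rw [FlowOK, State.setNat_nat_of_ne _ (by omega), State.setNat_nat_of_ne _ (by omega), e]
  exact h

/-- By `J m`, after `m` steps the cut has been found or the potential lies at least `m` below its
initial bound. That bound has degree 4 in `N`, and the seven nested loops make `N ^ 7` steps, which
is more since `N ≥ 2`. -/
theorem flow_spec {n : ℕ} {cap : ℕ → ℕ → ℝ} {s : State} (h : FlowOK N n cap s) :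
    FlowOK N n cap (flow.sem N s) ∧ FlowDone N n (flow.sem N s) := by
  have hlab : ∀ (s : State) {a : ℕ} (_ : 20 ≤ a) (v : ℕ), (s.setNat a 0 0 v).labels = s.labels :=
    fun s a ha v => by funext; simp only [State.labels]; rw [State.setNat_nat_of_ne _ (by omega)]
  set J : ℕ → State → Prop := fun m s => FlowOK N n cap s ∧ (FlowDone N n s ∨
    potential N (s.real 2) s.labels + m ≤ N * (N + 1) * (N * N + 1) + N * N) with hJ
  have hset : ∀ m s a v, 20 ≤ a → J m s → J m (s.setNat a 0 0 v) := by
    rintro m s a v ha ⟨h1, h2⟩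
    refine ⟨flowOK_setNat h1 ha v, ?_⟩
    rwa [FlowDone, hlab s ha v]
  have key : ∀ k m s, J m s → J (m + N ^ k) ((loops 20 k flowStep).sem N s) := by
    intro k
    induction k with
    | zero =>
      rintro m s ⟨h1, h2⟩
      refine ⟨(flowStep_spec h1).1, ?_⟩
      rcases h2 with h2 | h2
      · exact .inl (flowStep_of_done h1 h2)
      · rcases (flowStep_spec h1).2 with h3 | h3
        · exact .inl h3.1
        · right
          simp only [loops, pow_zero]
          omega
    | succ k ih =>
      intro m s hs
      refine sem_loop_ind (fun i st => J (m + i * N ^ k) st) (Q := J (m + N ^ (k + 1)))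
        (by simpa using hs) ?_ ?_
      · intro i _ st _ hst
        have := ih _ _ (hset _ _ (20 + k) i (by omega) hst)
        rwa [add_assoc, ← Nat.succ_mul] at this
      · intro st _ hst
        rw [pow_succ']
        exact hset _ _ _ _ (by omega) hst
  have hfin := key 7 0 s ⟨h, .inr (by simpa using potential_le N (s.real 2) s.labels)⟩
  refine ⟨hfin.1, hfin.2.resolve_right fun hle => ?_⟩
  have h2 : 2 ≤ N := by have := h.2.2.1; omega
  have h3 : N * (N + 1) * (N * N + 1) + N * N < N ^ 7 := by
    have e1 : 2 * N ≤ N * N := Nat.mul_le_mul_right _ h2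
    have e2 : 2 * (N * N) ≤ N * (N * N) := Nat.mul_le_mul_right _ h2
    have e3 : 2 * (N * (N * N)) ≤ N * (N * (N * N)) := Nat.mul_le_mul_right _ h2
    have e4 : 2 * (N * (N * (N * N))) ≤ N * (N * (N * (N * N))) := Nat.mul_le_mul_right _ h2
    have e5 : 2 * (N * (N * (N * (N * N)))) ≤ N * (N * (N * (N * (N * N)))) :=
      Nat.mul_le_mul_right _ h2
    have e6 : 2 * (N * (N * (N * (N * (N * N))))) ≤ N * (N * (N * (N * (N * (N * N))))) :=
      Nat.mul_le_mul_right _ h2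
    have e7 : N ^ 7 = N * (N * (N * (N * (N * (N * N))))) := by ring
    have e8 : N * (N + 1) * (N * N + 1) + N * N =
      N * (N * (N * N)) + N * (N * N) + 2 * (N * N) + N := by ring
    rw [e7, e8]
    omega
  omega

end RAM

/-! ## Candidates -/

namespace WSFVS

variable (I : WSFVS)

/-- Vertices of the two sides of a candidate that must not both be chosen. -/
def Conflict (x y : ℕ) : Prop :=
  x < I.n ∧ y < I.n ∧ (x = y ∨ I.input.nat 1 x y = 1)

open Classical in
/-- The weights, set to zero outside `R`. -/
noncomputable def weightOn (R : Set (Fin I.n)) (x : ℕ) : ℝ :=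
  if ∃ h : x < I.n, ⟨x, h⟩ ∈ R then I.input.real 0 x 0 else 0

/-- A number that exceeds the total weight. -/
noncomputable def big : ℝ := I.input.real 1 0 0 + ∑ x ∈ Finset.range (I.n + I.n + 2), I.input.real 0 x 0

variable {I}

theorem input_adj {x y : ℕ} :
    I.input.nat 1 x y = 1 ↔ ∃ (hx : x < I.n) (hy : y < I.n), I.G.Adj ⟨x, hx⟩ ⟨y, hy⟩ := by
  simp only [input]
  split_ifs <;> simp_all

theorem input_mem {x : ℕ} : I.input.nat 2 x 0 = 1 ↔ ∃ hx : x < I.n, ⟨x, hx⟩ ∈ I.T := by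
  simp only [input]
  split_ifs <;> simp_all

theorem input_mem_zero {x : ℕ} : I.input.nat 2 x 0 = 0 ↔ ¬ ∃ hx : x < I.n, ⟨x, hx⟩ ∈ I.T := by
  simp only [input]
  split_ifs <;> simp_all

theorem input_n : I.input.nat 0 0 0 = I.n := by simp [input]

theorem input_weight (v : Fin I.n) : I.input.real 0 v 0 = I.w v := by simp [input]

theorem input_weight_of_le {x : ℕ} (h : I.n ≤ x) : I.input.real 0 x 0 = 0 := by
  simp [input, not_lt.2 h]

theorem input_weight_nonneg (x : ℕ) : 0 ≤ I.input.real 0 x 0 := by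
  by_cases h : x < I.n
  · exact (input_weight ⟨x, h⟩).symm ▸ I.w_nonneg _
  · rw [input_weight_of_le (not_lt.1 h)]

theorem input_bound : I.input.real 1 0 0 = I.k := by simp [input]

theorem weightOn_nonneg (R : Set (Fin I.n)) (x : ℕ) : 0 ≤ I.weightOn R x := by
  simp only [weightOn]; split_ifs
  exacts [input_weight_nonneg x, le_rfl]

theorem sum_range_weight : ∑ x ∈ Finset.range (I.n + I.n + 2), I.input.real 0 x 0 = ∑ v, I.w v := by
  rw [show I.n + I.n + 2 = I.n + (I.n + 2) by ring, Finset.sum_range_add,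
    Finset.sum_eq_zero (s := Finset.range (I.n + 2)) fun x _ => input_weight_of_le (by omega),
    add_zero, Finset.sum_range]
  exact Finset.sum_congr rfl fun v _ => input_weight v

/-- Strictness comes from `1 ≤ k`: the bound supplies a positive number to a machine whose only real
constant is zero. -/
theorem big_pos : ∑ v, I.w v < I.big := by
  have : (1 : ℝ) ≤ I.k := by exact_mod_cast I.one_le_k
  rw [big, sum_range_weight, input_bound]
  linarith

open Classical in
theorem sum_weightOn (R : Set (Fin I.n)) (S : Set ℕ) :
    (∑ x ∈ Finset.range I.n, if x ∈ S then I.weightOn R x else 0) =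
      ∑ v with v ∈ R ∧ ↑v ∈ S, I.w v := by
  rw [Finset.sum_range, Finset.sum_filter]
  refine Finset.sum_congr rfl fun v _ => ?_
  simp only [weightOn, Fin.is_lt, Fin.eta, exists_true_left, input_weight]
  split_ifs <;> simp_all

open Classical in
/-- The minimum cut of the network of conflicts yields a heaviest separated pair. -/
theorem separated_of_min_cut {RL RR : Set (Fin I.n)} (S : Set ℕ) (hs : I.n + I.n ∈ S)
    (ht : I.n + I.n + 1 ∉ S)
    (hmin : ∀ S' : Set ℕ, I.n + I.n ∈ S' → I.n + I.n + 1 ∉ S' →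
      MinCut.cut (I.n + I.n + 2) (MinCut.bipCap I.n I.Conflict (I.weightOn RL) (I.weightOn RR)
        I.big) S ≤
      MinCut.cut (I.n + I.n + 2) (MinCut.bipCap I.n I.Conflict (I.weightOn RL) (I.weightOn RR)
        I.big) S') :
    I.G.Separated {v | v ∈ RL ∧ ↑v ∈ S} {v | v ∈ RR ∧ I.n + ↑v ∉ S} ∧
    ∀ P Q : Set (Fin I.n), P ⊆ RL → Q ⊆ RR → I.G.Separated P Q →
      (∑ v with v ∈ P, I.w v) + (∑ v with v ∈ Q, I.w v) ≤
        (∑ v with v ∈ RL ∧ ↑v ∈ S, I.w v) + ∑ v with v ∈ RR ∧ I.n + ↑v ∉ S, I.w v := by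
  have hb : ∑ v ∈ Finset.range I.n, I.weightOn RL v < I.big := by
    refine lt_of_le_of_lt ?_ big_pos
    rw [Finset.sum_range]
    refine Finset.sum_le_sum fun v _ => ?_
    simp only [weightOn, input_weight]
    split_ifs
    exacts [le_rfl, I.w_nonneg v]
  obtain ⟨h1, h2⟩ := MinCut.max_independent_of_min_cut (weightOn_nonneg RL) (weightOn_nonneg RR) hb
    S hs ht hmin
  refine ⟨fun p hp q hq => ?_, fun P Q hP hQ hPQ => ?_⟩
  · have := h1 p p.2 q q.2 hp.2 hq.2
    simp only [Conflict, p.2, q.2, true_and, not_or, input_adj, exists_true_left, Fin.eta] at this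
    exact ⟨fun e => this.1 (by rw [e]), this.2⟩
  · have h3 := h2 {x | ∃ h : x < I.n, ⟨x, h⟩ ∈ P} {x | ∃ h : x < I.n, ⟨x, h⟩ ∈ Q} (by
      rintro v hv u hu ⟨_, hvP⟩ ⟨_, huQ⟩ ⟨-, -, h⟩
      obtain ⟨h4, h5⟩ := hPQ _ hvP _ huQ
      rcases h with rfl | h
      · exact h4 rfl
      · obtain ⟨_, _, h⟩ := input_adj.1 h
        exact h5 h)
    obtain ⟨S', hS'⟩ : ∃ S' : Set ℕ, ∀ x, x ∈ S' ↔ I.n + x ∉ S := ⟨{x | _}, fun _ => Iff.rfl⟩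
    have e1 : (∑ x ∈ Finset.range I.n, if I.n + x ∈ S then 0 else I.weightOn RR x) =
        ∑ x ∈ Finset.range I.n, if x ∈ S' then I.weightOn RR x else 0 :=
      Finset.sum_congr rfl fun x _ => by simp only [hS', ite_not]
    rw [e1, sum_weightOn, sum_weightOn, sum_weightOn, sum_weightOn] at h3
    refine le_trans (le_of_eq ?_) (h3.trans (le_of_eq ?_))
    · congr 1
      · refine Finset.sum_congr (Finset.ext fun v => ?_) fun _ _ => rfl
        simp only [Finset.mem_filter, Finset.mem_univ, true_and]
        exact ⟨fun h => ⟨hP h, v.2, h⟩, fun h => h.2.2⟩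
      · refine Finset.sum_congr (Finset.ext fun v => ?_) fun _ _ => rfl
        simp only [Finset.mem_filter, Finset.mem_univ, true_and]
        exact ⟨fun h => ⟨hQ h, v.2, h⟩, fun h => h.2.2⟩
    · simp only [hS']

end WSFVS

/-! ### Tuples in memory and the regions they describe -/

namespace RAM

open Cmd MinCut

/-- The value of `e` occurs among the variables `b, …, b + k - 1`. -/
def inSlots (b k : ℕ) (e : NatExpr) : Test := .any (fun i => .natEq e (nv (b + i))) k

/-- The vertex `e` has a neighbour among the variables `b, …, b + 16`. -/
def adjSlots (b : ℕ) (e : NatExpr) : Test :=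
  .any (fun i => .natEq (.cell 1 e (nv (b + i))) (.const 1)) 17

/-- The vertex `e` belongs to the region described by the slots, and has no neighbour among the
variables `b, …, b + 16`. -/
def inRegion (b : ℕ) (e : NatExpr) : Test :=
  .and (.not (.natLE (nv 0) e)) (.and (.or (.not (.natLE (nv 0) (nv 151))) (.natEq (na 2 e) (.const 0)))
    (.and (.not (inSlots 100 51 e)) (.and (.not (adjSlots 100 e)) (.not (adjSlots b e)))))

/-- The set of vertices stored in the variables `b, …, b + 16`. -/
def State.slots (s : State) (n b : ℕ) : Set (Fin n) := {v | ∃ i < 17, s.nat (b + i) 0 0 = v}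

/-- The region described by the slots. -/
def State.region (s : State) (I : WSFVS) (b : ℕ) : Set (Fin I.n) :=
  I.G.region I.T (s.nat 151 0 0 < I.n) (s.slots I.n 100) (s.slots I.n 117) (s.slots I.n 134)
    (s.slots I.n b)

/-- The input is intact and the auxiliary constants are in place. -/
structure InputOK (I : WSFVS) (N : ℕ) (s : State) : Prop where
  nat : ∀ a < 3, s.nat a = I.input.nat a
  real : ∀ a < 2, s.real a = I.input.real a
  bound : s.nat 4 0 0 = N
  bound_eq : N = I.n + I.n + 2
  big : s.real 3 0 0 = I.big

variable {I : WSFVS} {N : ℕ} {s : State}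

theorem InputOK.n (h : InputOK I N s) : s.nat 0 0 0 = I.n := by
  rw [h.nat 0 (by norm_num), WSFVS.input_n]

theorem InputOK.sem (h : InputOK I N s) (c : Cmd) (h0 : ∀ a < 3, a ∉ c.natWrites)
    (h4 : 4 ∉ c.natWrites) (hr : ∀ a < 2, a ∉ c.realWrites) (h3 : 3 ∉ c.realWrites) :
    InputOK I N (c.sem N s) :=
  ⟨fun a ha => by rw [sem_nat _ _ (h0 a ha), h.nat a ha],
    fun a ha => by rw [sem_real _ _ (hr a ha), h.real a ha],
    by rw [sem_nat _ _ h4, h.bound], h.bound_eq, by rw [sem_real _ _ h3, h.big]⟩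

theorem InputOK.setNat (h : InputOK I N s) {a : ℕ} (ha : 5 ≤ a) (i j v : ℕ) :
    InputOK I N (s.setNat a i j v) :=
  ⟨fun b hb => by rw [State.setNat_nat_of_ne _ (by omega), h.nat b hb], h.real,
    by rw [State.setNat_nat_of_ne _ (by omega), h.bound], h.bound_eq, h.big⟩

theorem InputOK.of_frame {c : Cmd} {s' : State} (h : InputOK I N s) (hf : c.Frame s s')
    (h0 : ∀ a < 3, a ∉ c.natWrites)
    (h4 : 4 ∉ c.natWrites) (hr : ∀ a < 2, a ∉ c.realWrites) (h3 : 3 ∉ c.realWrites) :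
    InputOK I N s' :=
  ⟨fun a ha => by rw [hf.1 _ (h0 a ha), h.nat a ha],
    fun a ha => by rw [hf.2 _ (hr a ha), h.real a ha],
    by rw [hf.1 _ h4, h.bound], h.bound_eq, by rw [hf.2 _ h3, h.big]⟩

theorem holds_inSlots {b k : ℕ} {e : NatExpr} :
    (inSlots b k e).Holds s ↔ ∃ i < k, e.eval s = s.nat (b + i) 0 0 := by
  simp [inSlots]

theorem holds_inSlots_all {e : NatExpr} (he : e.eval s < I.n) :
    (inSlots 100 51 e).Holds s ↔ (⟨e.eval s, he⟩ : Fin I.n) ∈ s.slots I.n 100 ∨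
      (⟨e.eval s, he⟩ : Fin I.n) ∈ s.slots I.n 117 ∨ (⟨e.eval s, he⟩ : Fin I.n) ∈ s.slots I.n 134 := by
  rw [holds_inSlots]
  simp only [State.slots, Set.mem_ofPred_eq]
  constructor
  · rintro ⟨i, hi, h⟩
    rcases lt_or_ge i 17 with h1 | h1
    · exact .inl ⟨i, h1, h.symm⟩
    rcases lt_or_ge i 34 with h2 | h2
    · exact .inr (.inl ⟨i - 17, by omega, by rw [h]; congr 1; omega⟩)
    · exact .inr (.inr ⟨i - 34, by omega, by rw [h]; congr 1; omega⟩)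
  · rintro (⟨i, hi, h⟩ | ⟨i, hi, h⟩ | ⟨i, hi, h⟩)
    · exact ⟨i, by omega, h.symm⟩
    · exact ⟨i + 17, by omega, by rw [← h]; congr 1; omega⟩
    · exact ⟨i + 34, by omega, by rw [← h]; congr 1; omega⟩

/-- A slot with a value of at least `n` stands for no vertex; the adjacency array is not 1 there, so
the slot has no effect. -/
theorem holds_adjSlots (h : InputOK I N s) {b : ℕ} {e : NatExpr} (he : e.eval s < I.n) :
    (adjSlots b e).Holds s ↔ ∃ z ∈ s.slots I.n b, I.G.Adj ⟨e.eval s, he⟩ z := by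
  simp only [adjSlots, Test.holds_any, Test.Holds, NatExpr.eval, eval_nv, h.nat 1 (by norm_num),
    WSFVS.input_adj, State.slots, Set.mem_ofPred_eq]
  constructor
  · rintro ⟨i, hi, _, hz, hadj⟩
    exact ⟨⟨_, hz⟩, ⟨i, hi, rfl⟩, hadj⟩
  · rintro ⟨z, ⟨i, hi, hz⟩, hadj⟩
    refine ⟨i, hi, he, by rw [hz]; exact z.2, ?_⟩
    convert hadj

theorem holds_inRegion (h : InputOK I N s) {b : ℕ} {e : NatExpr} :
    (inRegion b e).Holds s ↔ ∃ he : e.eval s < I.n, ⟨e.eval s, he⟩ ∈ s.region I b := by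
  by_cases he : e.eval s < I.n
  · have h2 : s.nat 2 (e.eval s) 0 = 0 ↔ (⟨e.eval s, he⟩ : Fin I.n) ∉ I.T := by
      rw [h.nat 2 (by norm_num), WSFVS.input_mem_zero]; simp [he]
    simp only [inRegion, Test.Holds, eval_nv, eval_na, NatExpr.eval, h.n, h2,
      holds_inSlots_all he, holds_adjSlots h he, State.region, SimpleGraph.region,
      Set.mem_ofPred_eq, not_le, he, true_and, exists_true_left]
    push Not
    rw [Finset.mem_coe]
    tauto
  · simp [inRegion, h.n, he, not_lt.1 he]

/-- `s` and `s'` store the same tuple. -/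
def SameSlots (s s' : State) : Prop := ∀ a, 100 ≤ a → s.nat a 0 0 = s'.nat a 0 0

theorem SameSlots.slots {s' : State} (h : SameSlots s s') (n : ℕ) {b : ℕ} (hb : 100 ≤ b) :
    s.slots n b = s'.slots n b := by
  ext v
  simp only [State.slots, Set.mem_ofPred_eq]
  exact ⟨fun ⟨i, hi, e⟩ => ⟨i, hi, by rw [← h _ (by omega), e]⟩,
    fun ⟨i, hi, e⟩ => ⟨i, hi, by rw [h _ (by omega), e]⟩⟩

theorem SameSlots.region {s' : State} (h : SameSlots s s') {b : ℕ} (hb : 100 ≤ b) :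
    s.region I b = s'.region I b := by
  simp only [State.region]
  rw [h.slots _ hb, h.slots _ le_rfl, h.slots _ (show 100 ≤ 117 by norm_num),
    h.slots _ (show 100 ≤ 134 by norm_num), h 151 (by norm_num)]

theorem sameSlots_sem (c : Cmd) (hc : ∀ a ∈ c.natWrites, a < 100) (s : State) :
    SameSlots (c.sem N s) s := fun a ha => by
  rw [sem_nat _ _ fun h => by have := hc a h; omega]

theorem SameSlots.of_frame {c : Cmd} {s' : State} (hf : c.Frame s s')
    (hc : ∀ a ∈ c.natWrites, a < 100) : SameSlots s' s := fun a ha => by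
  rw [hf.1 _ fun h => by have := hc a h; omega]

theorem sameSlots_setNat {a : ℕ} (ha : a < 100) (i j v : ℕ) : SameSlots (s.setNat a i j v) s :=
  fun b hb => by rw [State.setNat_nat_of_ne _ (by omega)]

theorem SameSlots.trans {s' s'' : State} (h : SameSlots s s') (h' : SameSlots s' s'') :
    SameSlots s s'' := fun a ha => (h a ha).trans (h' a ha)

end RAM

/-! ### Network, candidate and weight for a given tuple -/

namespace RAM

open Cmd MinCut

/-- Compute the capacity of the pair of nodes in the variables `5` and `6`. -/
def fillCell : Cmd :=
  .ite (.and (.not (.natLE (nv 0) (nv 5))) (.and (.natLE (nv 0) (nv 6))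
      (.and (.not (.natLE (.add (nv 0) (nv 0)) (nv 6))) (.or (.natEq (nv 5) (.sub (nv 6) (nv 0)))
        (.natEq (.cell 1 (nv 5) (.sub (nv 6) (nv 0))) (.const 1))))))
    (setReal 2 (nv 5) (nv 6) (rv 3))
  (.ite (.and (.natEq (nv 5) (.add (nv 0) (nv 0))) (inRegion 134 (nv 6)))
    (setReal 2 (nv 5) (nv 6) (.cell 0 (nv 6) (.const 0)))
  (.ite (.and (.and (.natLE (nv 0) (nv 5)) (.not (.natLE (.add (nv 0) (nv 0)) (nv 5))))
      (.and (.natEq (nv 6) sinkE) (inRegion 117 (.sub (nv 5) (nv 0)))))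
    (setReal 2 (nv 5) (nv 6) (.cell 0 (.sub (nv 5) (nv 0)) (.const 0)))
    (setReal 2 (nv 5) (nv 6) .zero)))

/-- Set up the network. -/
def initCaps : Cmd := loop 5 (loop 6 fillCell)

/-- Set up the labels. -/
def initLabels : Cmd := loop 5 (asgAt 8 (nv 5) (.const 0))

/-- Compute the characteristic vector of the candidate. -/
def makeCandidate : Cmd := loop 5 (.ite (.and (.not (.natLE (nv 0) (nv 5))) (.or (inSlots 100 51 (nv 5))
    (.or (.and (inRegion 134 (nv 5)) (.natLE (na 8 (nv 5)) (nv 4)))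
      (.and (inRegion 117 (nv 5)) (.not (.natLE (na 8 (.add (nv 0) (nv 5))) (nv 4)))))))
  (asgAt 13 (nv 5) (.const 1)) (asgAt 13 (nv 5) (.const 0)))

/-- Compute the weight of the complement of the candidate. -/
def weigh : Cmd := seq (asgR 5 .zero) (loop 5 (whenever (.not (.natEq (na 13 (nv 5)) (.const 1)))
  (asgR 5 (.add (rv 5) (.cell 0 (nv 5) (.const 0))))))

/-- Compute a bound for the capacities. -/
def computeBig : Cmd := seq (asgR 3 (rv 1)) (loop 5
  (asgR 3 (.add (rv 3) (.cell 0 (nv 5) (.const 0)))))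

variable {I : WSFVS} {N : ℕ} {s : State}

/-- The network in which candidates are found. -/
noncomputable def State.network (s : State) (I : WSFVS) : ℕ → ℕ → ℝ :=
  bipCap I.n I.Conflict (I.weightOn (s.region I 134)) (I.weightOn (s.region I 117)) I.big

/-- The guards combine the cases of `bipCap` with membership in the region; outside the region the
last branch writes the zero that `weightOn` prescribes. -/
theorem fillCell_spec (h : InputOK I N s) {x y : ℕ} (hx : s.nat 5 0 0 = x) (hy : s.nat 6 0 0 = y) :
    (fillCell.sem N s).real 2 =
      fun x' y' => if x' = x ∧ y' = y then s.network I x y else s.real 2 x' y' := by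
  have hc1 : (Test.and (.not (.natLE (nv 0) (nv 5))) (.and (.natLE (nv 0) (nv 6))
      (.and (.not (.natLE (.add (nv 0) (nv 0)) (nv 6))) (.or (.natEq (nv 5) (.sub (nv 6) (nv 0)))
        (.natEq (.cell 1 (nv 5) (.sub (nv 6) (nv 0))) (.const 1)))))).Holds s ↔
      x < I.n ∧ I.n ≤ y ∧ y < I.n + I.n ∧ I.Conflict x (y - I.n) := by
    simp only [Test.Holds, eval_nv, NatExpr.eval, h.n, hx, hy, h.nat 1 (by norm_num), not_le,
      WSFVS.Conflict]
    constructor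
    · rintro ⟨h1, h2, h3, h4⟩; exact ⟨h1, h2, h3, h1, by omega, h4⟩
    · rintro ⟨h1, h2, h3, -, -, h4⟩; exact ⟨h1, h2, h3, h4⟩
  have hc2 : (Test.and (.natEq (nv 5) (.add (nv 0) (nv 0))) (inRegion 134 (nv 6))).Holds s ↔
      x = I.n + I.n ∧ ∃ hy : y < I.n, ⟨y, hy⟩ ∈ s.region I 134 := by
    rw [Test.Holds, holds_inRegion h]; simp [h.n, hx, hy]
  have hc3 : (Test.and (.and (.natLE (nv 0) (nv 5)) (.not (.natLE (.add (nv 0) (nv 0)) (nv 5))))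
      (.and (.natEq (nv 6) sinkE) (inRegion 117 (.sub (nv 5) (nv 0))))).Holds s ↔
      (I.n ≤ x ∧ x < I.n + I.n) ∧ y = I.n + I.n + 1 ∧
        ∃ hx : x - I.n < I.n, ⟨x - I.n, hx⟩ ∈ s.region I 117 := by
    simp only [Test.Holds, holds_inRegion h]
    simp [h.n, hx, hy, sinkE]
  have hset : ∀ v : RealExpr, v.eval s = s.network I x y →
      ((setReal 2 (nv 5) (nv 6) v).sem N s).real 2 =
      fun x' y' => if x' = x ∧ y' = y then s.network I x y else s.real 2 x' y' := by
    intro v hv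
    funext x' y'
    simp [hx, hy, hv]
  by_cases h1 : x < I.n ∧ I.n ≤ y ∧ y < I.n + I.n ∧ I.Conflict x (y - I.n)
  · rw [fillCell, sem_ite_pos (hc1.2 h1)]
    refine hset _ ?_
    rw [State.network, bipCap, if_pos h1]
    exact h.big
  rw [fillCell, sem_ite_neg (hc1.not.2 h1)]
  by_cases h2 : x = I.n + I.n ∧ ∃ hy : y < I.n, ⟨y, hy⟩ ∈ s.region I 134
  · rw [sem_ite_pos (hc2.2 h2)]
    refine hset _ ?_
    rw [State.network, bipCap, if_neg h1, if_pos ⟨h2.1, h2.2.1⟩, WSFVS.weightOn, if_pos h2.2]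
    simp [h.real 0 (by norm_num), hy]
  rw [sem_ite_neg (hc2.not.2 h2)]
  by_cases h3 : (I.n ≤ x ∧ x < I.n + I.n) ∧ y = I.n + I.n + 1 ∧
        ∃ hx : x - I.n < I.n, ⟨x - I.n, hx⟩ ∈ s.region I 117
  · rw [sem_ite_pos (hc3.2 h3)]
    refine hset _ ?_
    rw [State.network, bipCap, if_neg h1, if_neg (by omega), if_pos ⟨h3.1.1, h3.1.2, h3.2.1⟩,
      WSFVS.weightOn, if_pos h3.2.2]
    simp [h.real 0 (by norm_num), hx, h.n]
  rw [sem_ite_neg (hc3.not.2 h3)]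
  refine hset _ ?_
  rw [State.network, bipCap, if_neg h1]
  split_ifs with h4 h5
  · rw [WSFVS.weightOn, if_neg fun h' => h2 ⟨h4.1, h'⟩]; rfl
  · rw [WSFVS.weightOn, if_neg fun h' => h3 ⟨⟨h5.1, h5.2.1⟩, h5.2.2, h'⟩]; rfl
  · rfl

theorem initCaps_spec (h : InputOK I N s) :
    ∀ x < N, ∀ y < N, (initCaps.sem N s).real 2 x y = s.network I x y := by
  refine sem_loop_ind (fun k st => ∀ x < k, ∀ y < N, st.real 2 x y = s.network I x y)
    (Q := fun st => ∀ x < N, ∀ y < N, st.real 2 x y = s.network I x y) (by simp) ?_ ?_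
  · intro k hk st hf hI
    have hin := h.of_frame hf (by decide) (by decide) (by decide) (by decide)
    have hsl := SameSlots.of_frame hf (by decide)
    have key : (∀ x < k, ∀ y < N, ((loop 6 fillCell).sem N (st.setNat 5 0 0 k)).real 2 x y =
          s.network I x y) ∧
        ∀ y < N, ((loop 6 fillCell).sem N (st.setNat 5 0 0 k)).real 2 k y = s.network I k y := by
      refine sem_loop_ind (fun j st' => (∀ x < k, ∀ y < N, st'.real 2 x y = s.network I x y) ∧
        ∀ y < j, st'.real 2 k y = s.network I k y) (Q := fun st' =>
        (∀ x < k, ∀ y < N, st'.real 2 x y = s.network I x y) ∧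
        ∀ y < N, st'.real 2 k y = s.network I k y) ⟨by simpa using hI, by simp⟩ ?_ ?_
      · rintro j hj st' hf' ⟨i1, i2⟩
        have hin' := (hin.setNat (le_refl 5) 0 0 k).of_frame hf' (by decide) (by decide)
          (by decide) (by decide)
        have hsl' := (SameSlots.of_frame hf' (by decide)).trans
          ((sameSlots_setNat (by norm_num) 0 0 k).trans hsl)
        have hsl2 : SameSlots (st'.setNat 6 0 0 j) s :=
          (sameSlots_setNat (by norm_num) 0 0 j).trans hsl'
        have e5 : (st'.setNat 6 0 0 j).nat 5 0 0 = k := by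
          rw [State.setNat_nat_of_ne _ (by norm_num), hf'.1 5 (by decide)]; simp
        have e := fillCell_spec (hin'.setNat (show 5 ≤ 6 by norm_num) 0 0 j) e5
          (y := j) (by simp)
        have en : (st'.setNat 6 0 0 j).network I = s.network I := by
          rw [State.network, State.network, hsl2.region (by norm_num), hsl2.region (by norm_num)]
        rw [e, en]
        simp only [State.setNat_real]
        refine ⟨fun x hx y hy => ?_, fun y hy => ?_⟩
        · rw [if_neg (by omega)]; exact i1 x hx y hy
        · by_cases hyj : y = j
          · rw [if_pos ⟨trivial, hyj⟩, hyj]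
          · rw [if_neg (by tauto)]; exact i2 y (by omega)
      · intro st' _ h'
        simpa using h'
    intro x hx y hy
    rcases Nat.lt_succ_iff_lt_or_eq.1 hx with hx | rfl
    · exact key.1 x hx y hy
    · exact key.2 y hy
  · intro st _ h'
    simpa using h'

theorem initLabels_spec : ∀ x < N, (initLabels.sem N s).labels x = 0 := by
  refine sem_loop_ind (fun k st => ∀ x < k, st.labels x = 0)
    (Q := fun st => ∀ x < N, st.labels x = 0) (by simp) ?_ ?_
  · intro k hk st hf hI x hx
    have := hI x
    simp only [State.labels, sem_asgAt, State.setNat_nat, eval_nv, NatExpr.eval] at this ⊢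
    by_cases hxk : x = k
    · simp [hxk]
    · simpa [hxk] using this (by omega)
  · intro st _ h'
    simpa [State.labels] using h'

/-- The candidate given by the slots and the labels. -/
def State.candidate (s : State) (I : WSFVS) (N : ℕ) : Set (Fin I.n) :=
  s.slots I.n 100 ∪ s.slots I.n 117 ∪ s.slots I.n 134 ∪
    {v | v ∈ s.region I 134 ∧ ↑v ∈ {x | s.labels x ≤ N}} ∪
    {v | v ∈ s.region I 117 ∧ I.n + ↑v ∉ {x | s.labels x ≤ N}}

theorem makeCandidate_spec (h : InputOK I N s) (x : ℕ) (hx : x < N) :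
    (makeCandidate.sem N s).nat 13 x 0 = 1 ↔ ∃ hx : x < I.n, ⟨x, hx⟩ ∈ s.candidate I N := by
  revert x
  refine sem_loop_ind (fun k st => ∀ x < k, st.nat 13 x 0 = 1 ↔
      ∃ hx : x < I.n, ⟨x, hx⟩ ∈ s.candidate I N)
    (Q := fun st => ∀ x < N, st.nat 13 x 0 = 1 ↔ ∃ hx : x < I.n, ⟨x, hx⟩ ∈ s.candidate I N)
    (by simp) ?_ ?_
  · intro k hk st hf hI
    have hin := (h.of_frame hf (by decide) (by decide) (by decide) (by decide)).setNat
      (le_refl 5) 0 0 k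
    have hsl : SameSlots (st.setNat 5 0 0 k) s := (sameSlots_setNat (by norm_num) 0 0 k).trans
      (SameSlots.of_frame hf (by decide))
    have e8 : (st.setNat 5 0 0 k).nat 8 = s.nat 8 := by
      rw [State.setNat_nat_of_ne _ (by norm_num), hf.1 8 (by decide)]
    have e5 : (st.setNat 5 0 0 k).nat 5 0 0 = k := by simp
    have e13 : (st.setNat 5 0 0 k).nat 13 = st.nat 13 := State.setNat_nat_of_ne _ (by norm_num)
    generalize st.setNat 5 0 0 k = st' at *
    have hcond : (Test.and (.not (.natLE (nv 0) (nv 5))) (.or (inSlots 100 51 (nv 5))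
      (.or (.and (inRegion 134 (nv 5)) (.natLE (na 8 (nv 5)) (nv 4)))
        (.and (inRegion 117 (nv 5)) (.not (.natLE (na 8 (.add (nv 0) (nv 5))) (nv 4))))))).Holds st' ↔
        ∃ hx : k < I.n, ⟨k, hx⟩ ∈ s.candidate I N := by
      by_cases hkn : k < I.n
      · have he : (nv 5).eval st' < I.n := by rw [eval_nv, e5]; exact hkn
        simp only [Test.Holds, holds_inRegion hin, holds_inSlots_all he]
        simp only [eval_nv, eval_na, NatExpr.eval, e5, hin.n, hin.bound, e8, not_le, hkn, true_and,
          exists_true_left, hsl.slots I.n (show 100 ≤ 100 by norm_num),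
          hsl.slots I.n (show 100 ≤ 117 by norm_num), hsl.slots I.n (show 100 ≤ 134 by norm_num),
          hsl.region (show 100 ≤ 117 by norm_num), hsl.region (show 100 ≤ 134 by norm_num),
          State.candidate, Set.mem_union, Set.mem_ofPred_eq, State.labels]
        tauto
      · simp [hin.n, e5, hkn, not_lt.1 hkn]
    intro x hx
    by_cases hxk : x = k
    · subst hxk
      by_cases hc : ∃ hx : x < I.n, ⟨x, hx⟩ ∈ s.candidate I N
      · rw [sem_ite_pos (hcond.2 hc)]; simp [e5, hc]
      · rw [sem_ite_neg (hcond.not.2 hc)]; simp [e5, hc]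
    · have := hI x (by omega)
      rw [← e13] at this
      by_cases hc : ∃ hx : k < I.n, ⟨k, hx⟩ ∈ s.candidate I N
      · rw [sem_ite_pos (hcond.2 hc)]; simpa [e5, hxk] using this
      · rw [sem_ite_neg (hcond.not.2 hc)]; simpa [e5, hxk] using this
  · intro st _ h'
    simpa using h'

theorem weigh_spec (h : InputOK I N s) : (weigh.sem N s).real 5 0 0 =
    ∑ x ∈ Finset.range N, if s.nat 13 x 0 = 1 then 0 else I.input.real 0 x 0 := by
  simp only [weigh, sem_seq, sem_asgR]
  refine sem_loop_ind (fun k st => st.real 5 0 0 =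
    ∑ x ∈ Finset.range k, if s.nat 13 x 0 = 1 then 0 else I.input.real 0 x 0) (Q := fun st =>
    st.real 5 0 0 = ∑ x ∈ Finset.range N, if s.nat 13 x 0 = 1 then 0 else I.input.real 0 x 0)
    (by simp) ?_ ?_
  · rintro k hk st ⟨hf, hr⟩ hI
    have e13 : st.nat 13 = s.nat 13 := hf 13 (by decide)
    have e0 : st.real 0 = I.input.real 0 := by
      rw [hr 0 (by decide), State.setReal_real_of_ne _ (by norm_num), h.real 0 (by norm_num)]
    rw [Finset.sum_range_succ, ← hI]
    by_cases hc : s.nat 13 k 0 = 1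
    · rw [sem_whenever_neg (by simp [e13, hc]), if_pos hc, add_zero, State.setNat_real]
    · rw [sem_whenever_pos (by simp [e13, hc]), if_neg hc]
      simp [e0]
  · intro st _ h'
    simpa using h'

theorem computeBig_spec (h0 : s.real 0 = I.input.real 0) (h1 : s.real 1 = I.input.real 1)
    (hN : N = I.n + I.n + 2) : (computeBig.sem N s).real 3 0 0 = I.big := by
  simp only [computeBig, sem_seq, sem_asgR]
  rw [WSFVS.big, ← hN]
  refine sem_loop_ind (fun k st => st.real 3 0 0 = I.input.real 1 0 0 +
    ∑ x ∈ Finset.range k, I.input.real 0 x 0) (Q := fun st =>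
    st.real 3 0 0 = I.input.real 1 0 0 + ∑ x ∈ Finset.range N, I.input.real 0 x 0)
    (by simp [h1]) ?_ ?_
  · rintro k hk st ⟨hf, hr⟩ hI
    have e0 : st.real 0 = I.input.real 0 := by
      rw [hr 0 (by decide), State.setReal_real_of_ne _ (by norm_num), h0]
    rw [Finset.sum_range_succ, ← add_assoc, ← hI]
    simp [e0]
  · intro st _ h'
    simpa using h'

end RAM

/-! ## Verification of candidates -/

namespace RAM

open Cmd MinCut

/-- Mark the neighbours of marked vertices inside the candidate, except for the vertex in
variable `16`. -/
def markRound : Cmd := loop 5 (loop 6 (whenever (.and (.natEq (na 14 (nv 5)) (.const 1))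
    (.and (.natEq (.cell 1 (nv 5) (nv 6)) (.const 1)) (.and (.natEq (na 13 (nv 6)) (.const 1))
      (.not (.natEq (nv 6) (nv 16))))))
  (asgAt 14 (nv 6) (.const 1))))

/-- Mark what can be reached from the vertex in variable `17`. -/
def mark : Cmd := seq (loop 5 (asgAt 14 (nv 5) (.const 0)))
  (seq (asgAt 14 (nv 17) (.const 1)) (loop 7 markRound))

/-- Search a further neighbour of the vertex in variable `16` among the marked vertices. -/
def findMarked : Cmd := loop 18 (whenever (.and (.not (.natEq (nv 18) (nv 17)))
    (.and (.natEq (na 13 (nv 18)) (.const 1)) (.and (.natEq (.cell 1 (nv 16) (nv 18)) (.const 1))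
      (.natEq (na 14 (nv 18)) (.const 1)))))
  (asg 15 (.const 1)))

/-- Set variable `15` to `0` or `1` according to whether the candidate is a subset forest. -/
def verify : Cmd := seq (asg 15 (.const 0)) (loop 16 (loop 17 (whenever
    (.and (.natEq (na 2 (nv 16)) (.const 1)) (.and (.natEq (na 13 (nv 16)) (.const 1))
      (.and (.natEq (na 13 (nv 17)) (.const 1)) (.natEq (.cell 1 (nv 16) (nv 17)) (.const 1)))))
  (seq mark findMarked))))

variable {I : WSFVS} {N : ℕ} {s : State}

/-- `y` is a vertex of the candidate adjacent to `x` and different from `t`. -/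
def State.Step (s : State) (t x y : ℕ) : Prop :=
  s.nat 1 x y = 1 ∧ s.nat 13 y 0 = 1 ∧ y ≠ t

/-- Soundness is stated for any predicate closed under steps, because marks made within a round may
spread in the same round. Completeness concerns only vertices marked before the round. -/
theorem markRound_spec (Good : ℕ → Prop) (hG : ∀ x y, Good x → s.Step (s.nat 16 0 0) x y → Good y)
    (hs : ∀ x, s.nat 14 x 0 = 1 → Good x) :
    (∀ x, (markRound.sem N s).nat 14 x 0 = 1 → Good x) ∧
    (∀ x, s.nat 14 x 0 = 1 → (markRound.sem N s).nat 14 x 0 = 1) ∧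
    ∀ x < N, s.nat 14 x 0 = 1 → ∀ y < N, s.Step (s.nat 16 0 0) x y →
      (markRound.sem N s).nat 14 y 0 = 1 := by
  refine sem_loop_ind (fun k st => (∀ x, st.nat 14 x 0 = 1 → Good x) ∧
    (∀ x, s.nat 14 x 0 = 1 → st.nat 14 x 0 = 1) ∧
    ∀ x < k, s.nat 14 x 0 = 1 → ∀ y < N, s.Step (s.nat 16 0 0) x y → st.nat 14 y 0 = 1)
    (Q := fun st => (∀ x, st.nat 14 x 0 = 1 → Good x) ∧
    (∀ x, s.nat 14 x 0 = 1 → st.nat 14 x 0 = 1) ∧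
    ∀ x < N, s.nat 14 x 0 = 1 → ∀ y < N, s.Step (s.nat 16 0 0) x y → st.nat 14 y 0 = 1)
    ⟨hs, fun _ h => h, by simp⟩ ?_ ?_
  · rintro k hk st ⟨hf, -⟩ ⟨i1, i2, i3⟩
    refine sem_loop_ind (fun j st' => (∀ x, st'.nat 14 x 0 = 1 → Good x) ∧
      (∀ x, st.nat 14 x 0 = 1 → st'.nat 14 x 0 = 1) ∧
      (st.nat 14 k 0 = 1 → ∀ y < j, s.Step (s.nat 16 0 0) k y → st'.nat 14 y 0 = 1))
      (Q := fun st' => (∀ x, st'.nat 14 x 0 = 1 → Good x) ∧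
      (∀ x, s.nat 14 x 0 = 1 → st'.nat 14 x 0 = 1) ∧
      ∀ x < k + 1, s.nat 14 x 0 = 1 → ∀ y < N, s.Step (s.nat 16 0 0) x y → st'.nat 14 y 0 = 1)
      ⟨by simpa using i1, by simp, by simp⟩ ?_ ?_
    · rintro j hj st' ⟨hf', -⟩ ⟨j1, j2, j3⟩
      have e1 : st'.nat 1 = s.nat 1 := by
        rw [hf' 1 (by decide), State.setNat_nat_of_ne _ (by norm_num), hf 1 (by decide)]
      have e13 : st'.nat 13 = s.nat 13 := by
        rw [hf' 13 (by decide), State.setNat_nat_of_ne _ (by norm_num), hf 13 (by decide)]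
      have e16 : st'.nat 16 = s.nat 16 := by
        rw [hf' 16 (by decide), State.setNat_nat_of_ne _ (by norm_num), hf 16 (by decide)]
      have e5 : st'.nat 5 0 0 = k := by
        rw [hf' 5 (by decide)]; simp
      have hcond : (Test.and (.natEq (na 14 (nv 5)) (.const 1))
        (.and (.natEq (.cell 1 (nv 5) (nv 6)) (.const 1)) (.and (.natEq (na 13 (nv 6)) (.const 1))
          (.not (.natEq (nv 6) (nv 16)))))).Holds (st'.setNat 6 0 0 j) ↔
          st'.nat 14 k 0 = 1 ∧ s.Step (s.nat 16 0 0) k j := by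
        simp [e1, e13, e16, e5, State.Step]
      by_cases hc : st'.nat 14 k 0 = 1 ∧ s.Step (s.nat 16 0 0) k j
      · rw [sem_whenever_pos (hcond.2 hc)]
        simp only [sem_asgAt, State.setNat_nat, eval_nv, NatExpr.eval, true_and, and_true, if_true,
          Nat.reduceEqDiff, false_and, if_false]
        refine ⟨fun x hx => ?_, fun x hx => ?_, fun hM y hy hst => ?_⟩
        · by_cases hxj : x = j
          · rw [hxj]; exact hG k j (j1 k hc.1) hc.2
          · rw [if_neg (by simpa using hxj)] at hx; exact j1 x hx
        · by_cases hxj : x = j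
          · simp [hxj]
          · rw [if_neg (by simpa using hxj)]; exact j2 x hx
        · by_cases hxj : y = j
          · simp [hxj]
          · rw [if_neg (by simpa using hxj)]; exact j3 hM y (by omega) hst
      · rw [sem_whenever_neg (hcond.not.2 hc)]
        simp only [State.setNat_nat, Nat.reduceEqDiff, false_and, if_false]
        refine ⟨j1, j2, fun hM y hy hst => ?_⟩
        rcases Nat.lt_succ_iff_lt_or_eq.1 hy with hy | rfl
        · exact j3 hM y hy hst
        · exact absurd ⟨j2 k hM, hst⟩ hc
    · rintro st' - ⟨j1, j2, j3⟩
      simp only [State.setNat_nat, Nat.reduceEqDiff, false_and, if_false]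
      refine ⟨j1, fun x hx => j2 x (i2 x hx), fun x hx hM y hy hst => ?_⟩
      rcases Nat.lt_succ_iff_lt_or_eq.1 hx with hx | rfl
      · exact j2 y (i3 x hx hM y hy hst)
      · exact j3 (i2 x hM) y hy hst
  · rintro st - h
    simpa using h

/-- The vertices marked in array `13`. -/
def State.chosen (s : State) (n : ℕ) : Set (Fin n) := {v | s.nat 13 v 0 = 1}

/-- After `k` rounds every vertex with a walk of length at most `k` to `u` is marked; paths are
shorter than `n`, so `N` rounds suffice. -/
theorem mark_spec (h1 : s.nat 1 = I.input.nat 1) (hN : I.n ≤ N) {t u : Fin I.n}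
    (ht : s.nat 16 0 0 = t) (hu : s.nat 17 0 0 = u) (huF : u ∈ s.chosen I.n) (hut : u ≠ t)
    (x : Fin I.n) : (mark.sem N s).nat 14 x 0 = 1 ↔ I.G.ReachIn (s.chosen I.n \ {t}) u x := by
  set F := s.chosen I.n with hF
  simp only [mark, sem_seq, sem_asgAt]
  have hz : (∀ x < N, ((loop 5 (asgAt 14 (nv 5) (.const 0))).sem N s).nat 14 x 0 = 0) ∧
      ∀ x, N ≤ x → ((loop 5 (asgAt 14 (nv 5) (.const 0))).sem N s).nat 14 x 0 = s.nat 14 x 0 := by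
    refine sem_loop_ind (fun k st => (∀ x < k, st.nat 14 x 0 = 0) ∧
      ∀ x, N ≤ x → st.nat 14 x 0 = s.nat 14 x 0)
      (Q := fun st => (∀ x < N, st.nat 14 x 0 = 0) ∧ ∀ x, N ≤ x → st.nat 14 x 0 = s.nat 14 x 0)
      (by simp) ?_ ?_
    · rintro k hk st - ⟨i1, i2⟩
      simp only [sem_asgAt, State.setNat_nat, eval_nv, NatExpr.eval, true_and, and_true, if_true,
          Nat.reduceEqDiff, false_and, if_false]
      refine ⟨fun x hx => ?_, fun x hx => ?_⟩
      · by_cases hxk : x = k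
        · simp [hxk]
        · rw [if_neg (by simpa using hxk)]; exact i1 x (by omega)
      · rw [if_neg (by omega)]; exact i2 x hx
    · intro st _ h
      simpa using h
  have g1 : ((loop 5 (asgAt 14 (nv 5) (.const 0))).sem N s).nat 1 = I.input.nat 1 := by
    rw [sem_nat _ _ (by decide), h1]
  have g13 : ((loop 5 (asgAt 14 (nv 5) (.const 0))).sem N s).nat 13 = s.nat 13 :=
    sem_nat _ _ (by decide)
  have g16 : ((loop 5 (asgAt 14 (nv 5) (.const 0))).sem N s).nat 16 0 0 = t := by
    rw [sem_nat _ _ (by decide), ht]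
  have g17 : ((loop 5 (asgAt 14 (nv 5) (.const 0))).sem N s).nat 17 0 0 = u := by
    rw [sem_nat _ _ (by decide), hu]
  generalize (loop 5 (asgAt 14 (nv 5) (.const 0))).sem N s = s₁ at *
  -- Cells from `N` on are not cleared and may contain old marks; they belong to no vertex and no
  -- step starts from them.
  set Good : ℕ → Prop := fun x => N ≤ x ∨ ∃ hx : x < I.n, I.G.ReachIn (F \ {t}) u ⟨x, hx⟩ with hGood
  have hGstep : ∀ st : State, st.nat 1 = I.input.nat 1 → st.nat 13 = s.nat 13 →
      ∀ x y, Good x → st.Step t x y → Good y := by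
    rintro st e1 e13 x y hx ⟨h2, h3, h4⟩
    rw [e1, WSFVS.input_adj] at h2
    obtain ⟨hxn, hyn, hadj⟩ := h2
    rcases hx with hx | ⟨_, hx⟩
    · omega
    · right
      refine ⟨hyn, hx.trans (hadj.reachIn (hx.mem ⟨huF, hut⟩) ⟨?_, ?_⟩)⟩
      · rw [e13] at h3; exact h3
      · intro h'; exact h4 (by rw [← (show _ = t from h')])
  refine sem_loop_ind (fun k st => (∀ x, st.nat 14 x 0 = 1 → Good x) ∧
    ∀ (y : Fin I.n) (p : I.G.Walk y u), p.length ≤ k → (∀ z ∈ p.support, z ∈ F \ {t}) →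
      st.nat 14 y 0 = 1)
    (Q := fun st => st.nat 14 x 0 = 1 ↔ I.G.ReachIn (F \ {t}) u x) ⟨fun y hy => ?_, ?_⟩ ?_ ?_
  · rw [eval_nv, g17] at hy
    by_cases hyu : y = u
    · exact .inr ⟨hyu ▸ u.2, by subst hyu; exact .refl⟩
    · rw [State.setNat_nat, if_neg (by simpa using hyu)] at hy
      by_cases hyN : y < N
      · rw [hz.1 y hyN] at hy; simp at hy
      · exact .inl (not_lt.1 hyN)
  · intro y p hp _
    have hyu := SimpleGraph.Walk.eq_of_length_eq_zero (Nat.le_zero.1 hp)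
    rw [hyu]; simp [g17]
  · rintro k hk st ⟨hf, -⟩ ⟨i1, i2⟩
    have e1 : (st.setNat 7 0 0 k).nat 1 = I.input.nat 1 := by
      rw [State.setNat_nat_of_ne _ (by norm_num), hf 1 (by decide),
        State.setNat_nat_of_ne _ (by norm_num), g1]
    have e13 : (st.setNat 7 0 0 k).nat 13 = s.nat 13 := by
      rw [State.setNat_nat_of_ne _ (by norm_num), hf 13 (by decide),
        State.setNat_nat_of_ne _ (by norm_num), g13]
    have e16 : (st.setNat 7 0 0 k).nat 16 0 0 = t := by
      rw [State.setNat_nat_of_ne _ (by norm_num), hf 16 (by decide),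
        State.setNat_nat_of_ne _ (by norm_num), g16]
    have e14 : (st.setNat 7 0 0 k).nat 14 = st.nat 14 := State.setNat_nat_of_ne _ (by norm_num)
    obtain ⟨m1, m2, m3⟩ := markRound_spec (N := N) (s := st.setNat 7 0 0 k) Good
      (by rw [e16]; exact hGstep _ e1 e13) (by rw [e14]; exact i1)
    rw [e16, e14] at m3
    rw [e14] at m2
    refine ⟨m1, fun y p hp hpS => ?_⟩
    cases p with
    | nil => exact m2 _ (i2 _ .nil (by simp) hpS)
    | @cons _ z _ hadj p =>
      have hzy := i2 z p (by simpa using hp) fun w hw => hpS w (by simp [hw])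
      refine m3 z (z.2.trans_le hN) hzy y (y.2.trans_le hN) ⟨?_, ?_, ?_⟩
      · rw [e1, WSFVS.input_adj]; exact ⟨z.2, y.2, hadj.symm⟩
      · rw [e13]; exact (hpS y (by simp)).1
      · intro h'; exact (hpS y (by simp)).2 (Fin.ext h')
  · rintro st - ⟨i1, i2⟩
    have e14 : (st.setNat 7 0 0 N).nat 14 = st.nat 14 := State.setNat_nat_of_ne _ (by norm_num)
    rw [e14]
    constructor
    · intro h
      rcases i1 x h with h' | ⟨_, h'⟩
      · exact absurd (x.2.trans_le hN) (not_lt.2 h')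
      · exact h'
    · intro h
      obtain ⟨p, hp, hpS⟩ := h.symm.exists_isPath (h.mem ⟨huF, hut⟩)
      refine i2 x p ?_ hpS
      have := hp.length_lt
      rw [Fintype.card_fin] at this
      omega

theorem findMarked_spec : (findMarked.sem N s).nat 15 0 0 = 1 ∧ (∃ v < N, v ≠ s.nat 17 0 0 ∧
      s.nat 13 v 0 = 1 ∧ s.nat 1 (s.nat 16 0 0) v = 1 ∧ s.nat 14 v 0 = 1) ∨
    (findMarked.sem N s).nat 15 0 0 = s.nat 15 0 0 ∧ ∀ v < N, ¬ (v ≠ s.nat 17 0 0 ∧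
      s.nat 13 v 0 = 1 ∧ s.nat 1 (s.nat 16 0 0) v = 1 ∧ s.nat 14 v 0 = 1) := by
  refine sem_loop_ind (fun k st => st.nat 15 0 0 = 1 ∧ (∃ v < N, v ≠ s.nat 17 0 0 ∧
      s.nat 13 v 0 = 1 ∧ s.nat 1 (s.nat 16 0 0) v = 1 ∧ s.nat 14 v 0 = 1) ∨
    st.nat 15 0 0 = s.nat 15 0 0 ∧ ∀ v < k, ¬ (v ≠ s.nat 17 0 0 ∧
      s.nat 13 v 0 = 1 ∧ s.nat 1 (s.nat 16 0 0) v = 1 ∧ s.nat 14 v 0 = 1)) (Q := fun st =>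
    st.nat 15 0 0 = 1 ∧ (∃ v < N, v ≠ s.nat 17 0 0 ∧
      s.nat 13 v 0 = 1 ∧ s.nat 1 (s.nat 16 0 0) v = 1 ∧ s.nat 14 v 0 = 1) ∨
    st.nat 15 0 0 = s.nat 15 0 0 ∧ ∀ v < N, ¬ (v ≠ s.nat 17 0 0 ∧
      s.nat 13 v 0 = 1 ∧ s.nat 1 (s.nat 16 0 0) v = 1 ∧ s.nat 14 v 0 = 1)) (by simp) ?_ ?_
  · rintro k hk st ⟨hf, -⟩ hI
    have hcond : (Test.and (.not (.natEq (nv 18) (nv 17)))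
      (.and (.natEq (na 13 (nv 18)) (.const 1)) (.and (.natEq (.cell 1 (nv 16) (nv 18)) (.const 1))
      (.natEq (na 14 (nv 18)) (.const 1))))).Holds (st.setNat 18 0 0 k) ↔ (k ≠ s.nat 17 0 0 ∧
      s.nat 13 k 0 = 1 ∧ s.nat 1 (s.nat 16 0 0) k = 1 ∧ s.nat 14 k 0 = 1) := by
      simp [hf 17 (by decide), hf 13 (by decide), hf 16 (by decide), hf 1 (by decide),
        hf 14 (by decide)]
    by_cases hc : (k ≠ s.nat 17 0 0 ∧
      s.nat 13 k 0 = 1 ∧ s.nat 1 (s.nat 16 0 0) k = 1 ∧ s.nat 14 k 0 = 1)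
    · rw [sem_whenever_pos (hcond.2 hc)]
      exact .inl ⟨by simp, k, hk, hc⟩
    · rw [sem_whenever_neg (hcond.not.2 hc)]
      simp only [State.setNat_nat, Nat.reduceEqDiff, false_and, if_false]
      refine hI.imp id fun ⟨i1, i2⟩ => ⟨i1, fun v hv => ?_⟩
      rcases Nat.lt_succ_iff_lt_or_eq.1 hv with hv | rfl
      exacts [i2 v hv, hc]
  · intro st _ h
    simpa using h

theorem verify_spec (h : InputOK I N s) : (verify.sem N s).nat 15 0 0 = 0 ↔
    I.G.IsSubsetForest I.T (s.chosen I.n) := by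
  have hnN : I.n ≤ N := by have := h.bound_eq; omega
  set F := s.chosen I.n with hF
  -- A violation is a vertex of `T` with two neighbours joined without it. The loops run over the
  -- first two of these vertices, and `findMarked` looks for the third.
  set Viol : ℕ → ℕ → Prop := fun t u => ∃ (ht : t < I.n) (hu : u < I.n) (v : Fin I.n),
    (⟨t, ht⟩ : Fin I.n) ∈ I.T ∧ (⟨t, ht⟩ : Fin I.n) ∈ F ∧ (⟨u, hu⟩ : Fin I.n) ∈ F ∧ v ∈ F ∧
    I.G.Adj ⟨t, ht⟩ ⟨u, hu⟩ ∧ I.G.Adj ⟨t, ht⟩ v ∧ I.G.ReachIn (F \ {⟨t, ht⟩}) ⟨u, hu⟩ v ∧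
    (⟨u, hu⟩ : Fin I.n) ≠ v with hViol
  have hforest : I.G.IsSubsetForest I.T F ↔ ∀ t < N, ∀ u < N, ¬ Viol t u := by
    constructor
    · rintro hfor t - u - ⟨ht, hu, v, h1, h2, h3, h4, h5, h6, h7, h8⟩
      exact h8 (hfor _ h1 h2 _ h3 _ h4 h5 h6 h7)
    · intro hno t htT htF u hu v hv htu htv hr
      by_contra hne
      exact hno t (t.2.trans_le hnN) u (u.2.trans_le hnN)
        ⟨t.2, u.2, v, htT, htF, hu, hv, htu, htv, hr, hne⟩
  rw [hforest]
  simp only [verify, sem_seq, sem_asg]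
  refine sem_loop_ind (fun k st => (st.nat 15 0 0 = 0 ∧ ∀ t < k, ∀ u < N, ¬ Viol t u) ∨
    (st.nat 15 0 0 = 1 ∧ ∃ t < N, ∃ u < N, Viol t u)) (Q := fun st =>
    st.nat 15 0 0 = 0 ↔ ∀ t < N, ∀ u < N, ¬ Viol t u) (by simp) ?_ ?_
  · rintro k hk st hf hI
    refine sem_loop_ind (fun j st' => (st'.nat 15 0 0 = 0 ∧ (∀ t < k, ∀ u < N, ¬ Viol t u) ∧
      ∀ u < j, ¬ Viol k u) ∨ (st'.nat 15 0 0 = 1 ∧ ∃ t < N, ∃ u < N, Viol t u)) (Q := fun st' =>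
      (st'.nat 15 0 0 = 0 ∧ ∀ t < k + 1, ∀ u < N, ¬ Viol t u) ∨
      (st'.nat 15 0 0 = 1 ∧ ∃ t < N, ∃ u < N, Viol t u)) (by simpa using hI) ?_ ?_
    · rintro j hj st' hf' hI'
      have fr : ∀ a, a ∉ [15, 16, 17, 5, 14, 7, 6, 18] → (st'.setNat 17 0 0 j).nat a = s.nat a := by
        intro a ha
        simp only [List.mem_cons, List.not_mem_nil, or_false, not_or] at ha
        rw [State.setNat_nat_of_ne _ (by omega), hf'.1 a, State.setNat_nat_of_ne _ (by omega),
          hf.1 a, State.setNat_nat_of_ne _ (by omega)]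
        · simp only [natWrites, whenever, mark, markRound, findMarked, asgAt, asg, List.mem_cons,
            List.mem_append, List.not_mem_nil, or_false]
          omega
        · simp only [natWrites, whenever, mark, markRound, findMarked, asgAt, asg, List.mem_cons,
            List.mem_append, List.not_mem_nil, or_false]
          omega
      have e16 : (st'.setNat 17 0 0 j).nat 16 0 0 = k := by
        rw [State.setNat_nat_of_ne _ (by norm_num), hf'.1 16 (by decide)]; simp
      have e17 : (st'.setNat 17 0 0 j).nat 17 0 0 = j := by simp
      have e15 : (st'.setNat 17 0 0 j).nat 15 = st'.nat 15 :=
        State.setNat_nat_of_ne _ (by norm_num)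
      have e1 : (st'.setNat 17 0 0 j).nat 1 = I.input.nat 1 := by
        rw [fr 1 (by decide), h.nat 1 (by norm_num)]
      have e2 : (st'.setNat 17 0 0 j).nat 2 = I.input.nat 2 := by
        rw [fr 2 (by decide), h.nat 2 (by norm_num)]
      have e13 : (st'.setNat 17 0 0 j).nat 13 = s.nat 13 := fr 13 (by decide)
      have hch : (st'.setNat 17 0 0 j).chosen I.n = F := by
        rw [hF, State.chosen, State.chosen, e13]
      generalize st'.setNat 17 0 0 j = st₁ at *
      have hcond : (Test.and (.natEq (na 2 (nv 16)) (.const 1)) (.and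
          (.natEq (na 13 (nv 16)) (.const 1)) (.and (.natEq (na 13 (nv 17)) (.const 1))
          (.natEq (.cell 1 (nv 16) (nv 17)) (.const 1))))).Holds st₁ ↔
          ∃ (ht : k < I.n) (hu : j < I.n), (⟨k, ht⟩ : Fin I.n) ∈ I.T ∧ (⟨k, ht⟩ : Fin I.n) ∈ F ∧
          (⟨j, hu⟩ : Fin I.n) ∈ F ∧ I.G.Adj ⟨k, ht⟩ ⟨j, hu⟩ := by
        simp only [Test.Holds, eval_na, eval_nv, NatExpr.eval, e16, e17, e1, e2, e13,
          WSFVS.input_adj, WSFVS.input_mem, hF, State.chosen, Set.mem_ofPred_eq]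
        constructor
        · rintro ⟨⟨ht, h1⟩, h2, h3, _, hu, h4⟩; exact ⟨ht, hu, h1, h2, h3, h4⟩
        · rintro ⟨ht, hu, h1, h2, h3, h4⟩; exact ⟨⟨ht, h1⟩, h2, h3, ht, hu, h4⟩
      by_cases hc : ∃ (ht : k < I.n) (hu : j < I.n), (⟨k, ht⟩ : Fin I.n) ∈ I.T ∧
          (⟨k, ht⟩ : Fin I.n) ∈ F ∧ (⟨j, hu⟩ : Fin I.n) ∈ F ∧ I.G.Adj ⟨k, ht⟩ ⟨j, hu⟩
      · rw [sem_whenever_pos (hcond.2 hc), sem_seq]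
        obtain ⟨ht, hu, h1, h2, h3, h4⟩ := hc
        have hm := mark_spec (t := ⟨k, ht⟩) (u := ⟨j, hu⟩) e1 hnN e16 e17 (by rw [hch]; exact h3)
          h4.ne'
        rw [hch] at hm
        have hfm := findMarked_spec (N := N) (s := mark.sem N st₁)
        rw [sem_nat mark _ (show 17 ∉ mark.natWrites by decide),
          sem_nat mark _ (show 13 ∉ mark.natWrites by decide),
          sem_nat mark _ (show 16 ∉ mark.natWrites by decide),
          sem_nat mark _ (show 1 ∉ mark.natWrites by decide),
          sem_nat mark _ (show 15 ∉ mark.natWrites by decide), e15, e16, e17, e1, e13] at hfm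
        rcases hfm with ⟨f1, v, -, f3, f4, f5, f6⟩ | ⟨f1, f2⟩
        · right
          obtain ⟨_, hv, f7⟩ := WSFVS.input_adj.1 f5
          refine ⟨f1, k, hk, j, hj, ht, hu, ⟨v, hv⟩, h1, h2, h3, f4, h4, f7, (hm _).1 f6, ?_⟩
          intro e; exact f3 (Fin.mk.inj e).symm
        · rw [f1]
          refine hI'.imp (fun ⟨i1, i2, i3⟩ => ⟨i1, i2, fun u hu => ?_⟩) id
          rcases Nat.lt_succ_iff_lt_or_eq.1 hu with hu | rfl
          · exact i3 u hu
          · rintro ⟨_, _, v, -, -, -, g4, -, g6, g7, g8⟩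
            exact f2 v (v.2.trans_le hnN) ⟨fun e => g8 (Fin.ext e.symm), g4,
              WSFVS.input_adj.2 ⟨_, _, g6⟩, (hm v).2 g7⟩
      · rw [sem_whenever_neg (hcond.not.2 hc), e15]
        refine hI'.imp (fun ⟨i1, i2, i3⟩ => ⟨i1, i2, fun u hu => ?_⟩) id
        rcases Nat.lt_succ_iff_lt_or_eq.1 hu with hu | rfl
        · exact i3 u hu
        · rintro ⟨ht, hu, v, g1, g2, g3, -, g5, -⟩
          exact hc ⟨ht, hu, g1, g2, g3, g5⟩
    · rintro st' - hI'
      simp only [State.setNat_nat, Nat.reduceEqDiff, false_and, if_false]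
      refine hI'.imp (fun ⟨i1, i2, i3⟩ => ⟨i1, fun t ht u hu => ?_⟩) id
      rcases Nat.lt_succ_iff_lt_or_eq.1 ht with ht | rfl
      exacts [i2 t ht u hu, i3 u hu]
  · rintro st - hI
    simp only [State.setNat_nat, Nat.reduceEqDiff, false_and, if_false]
    rcases hI with ⟨i1, i2⟩ | ⟨i1, t, ht, u, hu, hv⟩
    · simp only [i1, true_iff]; exact i2
    · simp only [i1, one_ne_zero, false_iff]; exact fun h' => h' t ht u hu hv

end RAM

/-! ## The algorithm -/

open Classical in
-- After adding the weights of `P` and `Q` to the left and those of `P'` and `Q'` to the right, the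
-- inequality holds vertex by vertex: the left side counts each vertex outside `K` exactly once, by
-- disjointness, and the right side at least once.
theorem sum_notMem_union_le {V : Type*} [Fintype V] {w : V → ℝ} (hw : ∀ v, 0 ≤ w v)
    {C K P Q P' Q' : Set V} {S : Finset V} (hC : C = K ∪ P ∪ Q)
    (hcov : ∀ v ∉ S, v ∈ K ∪ P' ∪ Q')
    (hP : ∀ v ∈ P, v ∉ K) (hQ : ∀ v ∈ Q, v ∉ K) (hPQ : ∀ v ∈ P, v ∉ Q)
    (hle : (∑ v with v ∈ P', w v) + (∑ v with v ∈ Q', w v) ≤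
      (∑ v with v ∈ P, w v) + ∑ v with v ∈ Q, w v) :
    ∑ v with v ∉ C, w v ≤ ∑ v ∈ S, w v := by
  have key : (∑ v with v ∉ C, w v) + ((∑ v with v ∈ P, w v) + ∑ v with v ∈ Q, w v) ≤
      (∑ v with v ∈ S, w v) + ((∑ v with v ∈ P', w v) + ∑ v with v ∈ Q', w v) := by
    simp only [Finset.sum_filter, ← Finset.sum_add_distrib]
    refine Finset.sum_le_sum fun v _ => ?_
    have h1 := hw v
    have h2 : v ∈ S ∨ v ∈ K ∨ v ∈ P' ∨ v ∈ Q' := by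
      by_cases h : v ∈ S
      · exact .inl h
      · have := hcov v h
        simp only [Set.mem_union] at this
        tauto
    have h3 := hP v
    have h4 := hQ v
    have h5 := hPQ v
    simp only [hC, Set.mem_union]
    by_cases a1 : v ∈ K <;> by_cases a2 : v ∈ P <;> by_cases a3 : v ∈ Q <;>
      by_cases a4 : v ∈ S <;> by_cases a5 : v ∈ P' <;> by_cases a6 : v ∈ Q' <;>
      (simp_all; try linarith [hw v])
  have : (∑ v with v ∈ S, w v) = ∑ v ∈ S, w v := by
    rw [Finset.filter_mem_eq_inter, Finset.univ_inter]
  linarith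

/-! ### Exhaustive search and the final program -/

namespace RAM

open Cmd

namespace Cmd

variable {N : ℕ}

theorem mem_natWrites_loops {a b : ℕ} {c : Cmd} : ∀ {k : ℕ}, b ∈ (loops a k c).natWrites →
    b ∈ c.natWrites ∨ a ≤ b ∧ b < a + k
  | 0, h => .inl h
  | k + 1, h => by
    simp only [loops, natWrites, List.mem_cons] at h
    rcases h with rfl | h
    · exact .inr ⟨by omega, by omega⟩
    · exact (mem_natWrites_loops h).imp id fun h => ⟨h.1, by omega⟩

theorem wf_loops {a : ℕ} {c : Cmd} (hc : c.WF) (ha : 4 < a) (hw : ∀ b ∈ c.natWrites, b < a) :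
    ∀ k : ℕ, (loops a k c).WF
  | 0 => hc
  | k + 1 => ⟨wf_loops hc ha hw k, by omega, fun h => by
      rcases mem_natWrites_loops h with h | h
      · have := hw _ h
        omega
      · omega⟩

/-- An exhaustive search over all values of the counters keeps invariants. -/
theorem sem_loops_inv {a : ℕ} {c : Cmd} {J : State → Prop}
    (hset : ∀ s b v, a ≤ b → J s → J (s.setNat b 0 0 v)) (hc : ∀ s, J s → J (c.sem N s)) :
    ∀ k s, J s → J ((loops a k c).sem N s)
  | 0, s, h => hc s h
  | k + 1, s, h => by
    refine sem_loop_ind (fun _ st => J st) (Q := J) h ?_ ?_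
    · intro _ _ st _ hst
      exact sem_loops_inv hset hc k _ (hset _ _ _ (by omega) hst)
    · intro st _ hst
      exact hset _ _ _ (by omega) hst

/-- An exhaustive search succeeds if it succeeds for some values `g` of the counters. -/
theorem sem_loops_search {a K : ℕ} {c : Cmd} {J D : State → Prop} {g : ℕ → ℕ}
    (hw : ∀ b ∈ c.natWrites, b < a) (hg : ∀ i < K, g i < N)
    (hset : ∀ s b v, a ≤ b → J s → J (s.setNat b 0 0 v)) (hc : ∀ s, J s → J (c.sem N s))
    (hsetD : ∀ s b v, a ≤ b → D s → D (s.setNat b 0 0 v))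
    (hcD : ∀ s, J s ∧ D s → J (c.sem N s) ∧ D (c.sem N s))
    (hgood : ∀ s, J s → (∀ i < K, s.nat (a + i) 0 0 = g i) → D (c.sem N s)) :
    ∀ k ≤ K, ∀ s, J s → (∀ i, k ≤ i → i < K → s.nat (a + i) 0 0 = g i) →
      D ((loops a k c).sem N s)
  | 0, _, s, h, hs => hgood s h fun i hi => hs i (Nat.zero_le i) hi
  | k + 1, hk, s, h, hs => by
    have hsetJD : ∀ s b v, a ≤ b → J s ∧ D s → J (s.setNat b 0 0 v) ∧ D (s.setNat b 0 0 v) :=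
      fun s b v hb h => ⟨hset s b v hb h.1, hsetD s b v hb h.2⟩
    -- The counters from `a + k + 1` on already have their values. Round `g k` succeeds by the inner
    -- search, and later rounds keep the success.
    refine sem_loop_ind (fun j st => J st ∧ (g k < j → D st)) (Q := D) ⟨h, by simp⟩ ?_ ?_
    · rintro j - st hf ⟨i1, i2⟩
      have i3 := hset st (a + k) j (by omega) i1
      refine ⟨sem_loops_inv hset hc k _ i3, fun hj => ?_⟩
      rcases Nat.lt_succ_iff_lt_or_eq.1 hj with hj | rfl
      · exact (sem_loops_inv (J := fun s => J s ∧ D s) hsetJD hcD k _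
          ⟨i3, hsetD _ _ _ (by omega) (i2 hj)⟩).2
      · refine sem_loops_search hw hg hset hc hsetD hcD hgood k (by omega) _ i3 fun i hki hi => ?_
        rcases hki.eq_or_lt with rfl | hki
        · simp
        · rw [State.setNat_nat_of_ne _ (by omega), hf.1, hs i hki hi]
          intro hmem
          rcases mem_natWrites_loops (k := k + 1) hmem with h' | h'
          · have := hw _ h'
            omega
          · omega
    · rintro st - ⟨-, i2⟩
      exact hsetD _ _ _ (by omega) (i2 (hg k hk))

end Cmd

/-- Find the heaviest separated pair that completes the tuple in the slots. -/
def optimize : Cmd := seq initCaps (seq initLabels flow)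

/-- Compute the best candidate for the tuple in the slots, and answer yes if it is good enough. -/
def tryGuess : Cmd :=
  seq optimize (seq makeCandidate (seq weigh (seq verify (whenever
    (.and (.natEq (nv 15) (.const 0)) (.realLE (rv 5) (rv 1))) (asg 3 (.const 1))))))

variable {I : WSFVS} {N : ℕ} {s : State}

theorem network_nonneg (x y : ℕ) : 0 ≤ s.network I x y :=
  MinCut.bipCap_nonneg (WSFVS.weightOn_nonneg _) (WSFVS.weightOn_nonneg _)
    ((Finset.sum_nonneg fun v _ => I.w_nonneg v).trans WSFVS.big_pos.le) x y

/-- The zero flow and the zero labels satisfy the invariant. -/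
theorem optimize_spec (h : InputOK I N s) : FlowOK N I.n (s.network I) (optimize.sem N s) ∧
    FlowDone N I.n (optimize.sem N s) := by
  refine flow_spec ?_
  have hc := initCaps_spec h
  have hl := initLabels_spec (N := N) (s := initCaps.sem N s)
  have hr : (initLabels.sem N (initCaps.sem N s)).real 2 = (initCaps.sem N s).real 2 :=
    sem_real _ _ (by decide)
  have h0 : (initLabels.sem N (initCaps.sem N s)).nat 0 = s.nat 0 := by
    rw [sem_nat initLabels _ (by decide), sem_nat initCaps _ (by decide)]
  have h4 : (initLabels.sem N (initCaps.sem N s)).nat 4 = s.nat 4 := by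
    rw [sem_nat initLabels _ (by decide), sem_nat initCaps _ (by decide)]
  have hN := h.bound_eq
  refine ⟨by rw [h0, h.n], by rw [h4, h.bound], hN, ?_⟩
  rw [hr]
  refine ⟨fun x hx y hy => ?_, ⟨0, fun S _ _ => ?_⟩, hl _ (by omega), fun v hv => ?_,
    fun u hu v hv _ => ?_⟩
  · rw [hc x hx y hy]; exact network_nonneg x y
  · rw [sub_zero]
    refine Finset.sum_congr rfl fun x hx => Finset.sum_congr rfl fun y hy => ?_
    rw [hc x (Finset.mem_range.1 hx) y (Finset.mem_range.1 hy)]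
  · rw [hl v hv]; omega
  · rw [hl v hv]; omega

open Classical in
-- The nodes with finite labels form a minimum cut. The left side carries the region of the slots
-- from 134 on, the right side that of the slots from 117 on; the slots do not change meanwhile.
theorem candidate_spec (h : InputOK I N s) : ∃ P Q : Set (Fin I.n), P ⊆ s.region I 134 ∧
    Q ⊆ s.region I 117 ∧ I.G.Separated P Q ∧ (optimize.sem N s).candidate I N =
      s.slots I.n 100 ∪ s.slots I.n 117 ∪ s.slots I.n 134 ∪ P ∪ Q ∧
    ∀ P' Q' : Set (Fin I.n), P' ⊆ s.region I 134 → Q' ⊆ s.region I 117 → I.G.Separated P' Q' →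
      (∑ v with v ∈ P', I.w v) + (∑ v with v ∈ Q', I.w v) ≤
        (∑ v with v ∈ P, I.w v) + ∑ v with v ∈ Q, I.w v := by
  obtain ⟨⟨-, -, hN, hI⟩, hE, ht⟩ := optimize_spec h
  have hmin := fun S => hI.min_cut hE ht S
  have hsl := sameSlots_sem (N := N) optimize (by decide) s
  subst hN
  obtain ⟨h1, h2⟩ := WSFVS.separated_of_min_cut
    {x | (optimize.sem (I.n + I.n + 2) s).labels x ≤ I.n + I.n + 2}
    (by rw [Set.mem_ofPred_eq, hI.label_s]; omega) (by rw [Set.mem_ofPred_eq, ht]; omega) hmin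
  refine ⟨_, _, fun v hv => hv.1, fun v hv => hv.1, h1, ?_, by
    convert h2 <;> exact Iff.rfl⟩
  rw [State.candidate, hsl.slots _ le_rfl, hsl.slots _ (show 100 ≤ 117 by norm_num),
    hsl.slots _ (show 100 ≤ 134 by norm_num), hsl.region (show 100 ≤ 134 by norm_num),
    hsl.region (show 100 ≤ 117 by norm_num)]

open Classical in
theorem tryGuess_spec (h : InputOK I N s) {C : Set (Fin I.n)}
    (hC : (optimize.sem N s).candidate I N = C) :
    (tryGuess.sem N s).nat 3 0 0 = if I.G.IsSubsetForest I.T C ∧ ∑ v with v ∉ C, I.w v ≤ (I.k : ℝ)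
      then 1 else s.nat 3 0 0 := by
  have hN := h.bound_eq
  have h1 : InputOK I N (optimize.sem N s) :=
    h.sem _ (by decide) (by decide) (by decide) (by decide)
  have hm := makeCandidate_spec h1
  rw [hC] at hm
  have h2 : InputOK I N (makeCandidate.sem N (optimize.sem N s)) :=
    h1.sem _ (by decide) (by decide) (by decide) (by decide)
  have e3 : (makeCandidate.sem N (optimize.sem N s)).nat 3 = s.nat 3 := by
    rw [sem_nat makeCandidate _ (by decide), sem_nat optimize _ (by decide)]
  simp only [tryGuess, sem_seq]
  generalize makeCandidate.sem N (optimize.sem N s) = s₁ at *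
  have hw := weigh_spec h2
  have h3 : InputOK I N (weigh.sem N s₁) :=
    h2.sem _ (by decide) (by decide) (by decide) (by decide)
  have hv := verify_spec h3
  have hch : (weigh.sem N s₁).chosen I.n = C := by
    ext v
    rw [State.chosen, Set.mem_ofPred_eq, sem_nat weigh _ (by decide), hm v (by omega)]
    simp
  have hsum : (weigh.sem N s₁).real 5 0 0 = ∑ v with v ∉ C, I.w v := by
    rw [hw, hN, show I.n + I.n + 2 = I.n + (I.n + 2) by ring, Finset.sum_range_add,
      Finset.sum_eq_zero (s := Finset.range (I.n + 2)) fun x _ => by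
        rw [WSFVS.input_weight_of_le (by omega), ite_self],
      add_zero, Finset.sum_range, Finset.sum_filter]
    refine Finset.sum_congr rfl fun v _ => ?_
    rw [WSFVS.input_weight, ite_not]
    refine if_congr ?_ rfl rfl
    rw [hm v (by omega)]
    simp
  have hcond : (Test.and (.natEq (nv 15) (.const 0)) (.realLE (rv 5) (rv 1))).Holds
      (verify.sem N (weigh.sem N s₁)) ↔
      I.G.IsSubsetForest I.T C ∧ ∑ v with v ∉ C, I.w v ≤ (I.k : ℝ) := by
    simp only [Test.Holds, eval_nv, NatExpr.eval, eval_rv, hv, hch]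
    rw [sem_real verify _ (by decide), sem_real verify _ (by decide), hsum,
      h3.real 1 (by norm_num), WSFVS.input_bound]
  split_ifs with hc
  · rw [sem_whenever_pos (hcond.2 hc)]; simp
  · rw [sem_whenever_neg (hcond.not.2 hc), sem_nat verify _ (by decide),
      sem_nat weigh _ (by decide), e3]

theorem isYes_of_isSubsetForest {C : Set (Fin I.n)} [DecidablePred (· ∉ C)]
    (hC : I.G.IsSubsetForest I.T C)
    (hw : ∑ v with v ∉ C, I.w v ≤ (I.k : ℝ)) : I.IsYes := by
  refine ⟨_, SimpleGraph.isSubsetFeedbackVertexSet_iff.2 ?_, hw⟩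
  convert hC
  ext v; simp

/-- The invariant of the search. -/
def SearchOK (I : WSFVS) (N : ℕ) (s : State) : Prop :=
  InputOK I N s ∧ (s.nat 3 0 0 = 0 ∨ s.nat 3 0 0 = 1 ∧ I.IsYes)

theorem SearchOK.setNat (h : SearchOK I N s) {a : ℕ} (ha : 100 ≤ a) (v : ℕ) :
    SearchOK I N (s.setNat a 0 0 v) :=
  ⟨h.1.setNat (by omega) _ _ _, by rw [State.setNat_nat_of_ne _ (by omega)]; exact h.2⟩

/-- Soundness needs nothing about the guess: "yes" is recorded only for a candidate that has been
verified and weighed. -/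
theorem SearchOK.tryGuess (h : SearchOK I N s) : SearchOK I N (tryGuess.sem N s) := by
  classical
  refine ⟨h.1.sem _ (by decide) (by decide) (by decide) (by decide), ?_⟩
  rw [tryGuess_spec h.1 rfl]
  split_ifs with hc
  · exact .inr ⟨rfl, isYes_of_isSubsetForest hc.1 hc.2⟩
  · exact h.2

/-- The pair that covers the complement of `S` competes in the maximisation, so the vertices outside
the candidate weigh at most as much as `S`. The second half of `IsGuess` makes the candidate a
subset forest, whichever optimal pair was found. -/
theorem tryGuess_of_isGuess (h : InputOK I N s) {S A X Y : Finset (Fin I.n)} {m : Prop}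
    (hS : ∑ v ∈ S, I.w v ≤ (I.k : ℝ)) (hG : I.G.IsGuess I.T Sᶜ m A X Y)
    (hm : s.nat 151 0 0 < I.n ↔ m) (hA : s.slots I.n 100 = A) (hX : s.slots I.n 117 = X)
    (hY : s.slots I.n 134 = Y) : (tryGuess.sem N s).nat 3 0 0 = 1 := by
  classical
  obtain ⟨P, Q, hP, hQ, hPQ, hC, hmax⟩ := candidate_spec h
  obtain ⟨⟨P', Q', hP', hQ', hPQ', hcov⟩, hall⟩ := hG
  rw [hA, hX, hY] at hC
  rw [State.region, hA, hX, hY, propext hm] at hP hQ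
  simp only [State.region, hA, hX, hY, propext hm] at hmax
  rw [tryGuess_spec h rfl]
  refine if_pos ⟨hC ▸ hall P Q hP hQ hPQ, le_trans ?_ hS⟩
  refine sum_notMem_union_le I.w_nonneg hC (fun v hv => hcov (by simpa using hv)) (fun v hv => ?_) (fun v hv => ?_)
    (fun v hv hv' => (hPQ v hv v hv').1 rfl) (hmax P' Q' hP' hQ' hPQ')
  · have := hP hv
    simp only [SimpleGraph.region, Set.mem_ofPred_eq, Set.mem_union] at this ⊢
    tauto
  · have := hQ hv
    simp only [SimpleGraph.region, Set.mem_ofPred_eq, Set.mem_union] at this ⊢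
    tauto

theorem tryGuess_keeps (h : InputOK I N s) (h3 : s.nat 3 0 0 = 1) :
    (tryGuess.sem N s).nat 3 0 0 = 1 := by
  rw [tryGuess_spec h rfl, h3, ite_self]

theorem tryGuess_wf : tryGuess.WF := by
  simp [tryGuess, optimize, initCaps, initLabels, flow, makeCandidate, weigh, verify, WF, natWrites,
    loops, fillCell, flowStep, sweep, findPar, bottleneck, pushPath, mark, markRound, findMarked,
    whenever, asg, asgAt, asgR]

theorem tryGuess_natWrites : ∀ b ∈ tryGuess.natWrites, b < 100 := by decide

/-- The entries of a list of vertices, padded with `n`. -/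
def entry {n : ℕ} (l : List (Fin n)) (i : ℕ) : ℕ := (l[i]?).elim n Fin.val

theorem entry_le {n : ℕ} (l : List (Fin n)) (i : ℕ) : entry l i ≤ n := by
  rw [entry]
  cases l[i]? with
  | none => exact le_rfl
  | some v => exact v.2.le

theorem slots_eq_of_entry {n : ℕ} {A : Finset (Fin n)} (hA : A.card ≤ 17) {b : ℕ}
    (h : ∀ i < 17, s.nat (b + i) 0 0 = entry A.toList i) : s.slots n b = A := by
  ext v
  rw [State.slots, Set.mem_ofPred_eq, Finset.mem_coe, ← Finset.mem_toList, List.mem_iff_getElem?]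
  constructor
  · rintro ⟨i, hi, e⟩
    refine ⟨i, ?_⟩
    rw [h i hi, entry] at e
    cases hl : A.toList[i]? with
    | none => rw [hl] at e; exact absurd v.2 (by rw [← e]; simp)
    | some u => rw [hl] at e; rw [Fin.ext e]
  · rintro ⟨i, e⟩
    have hi : i < 17 := by
      obtain ⟨hi, -⟩ := List.getElem?_eq_some_iff.1 e
      rw [Finset.length_toList] at hi
      omega
    exact ⟨i, hi, by rw [h i hi, entry, e]; rfl⟩

/-- Try all tuples. -/
def search : Cmd := loops 100 52 tryGuess

theorem search_spec (hG : I.G.AvoidsThreeP1AddP2) (h : InputOK I N s) (h3 : s.nat 3 0 0 = 0) :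
    (I.IsYes → (search.sem N s).nat 3 0 0 = 1) ∧ (¬ I.IsYes → (search.sem N s).nat 3 0 0 = 0) := by
  have hJ : SearchOK I N s := ⟨h, .inl h3⟩
  constructor
  · rintro ⟨S, hS, hw⟩
    obtain ⟨m, A, X, Y, hA, hX, hY, hm, hguess⟩ :=
      SimpleGraph.IsSubsetForest.exists_isGuess hG (SimpleGraph.isSubsetFeedbackVertexSet_iff.1 hS)
    classical
    -- There are 17 slots for each of the three sets, padded with `n`, which is no vertex; the flag
    -- is 0 for true and `n` for false. All values are at most `n`, within the range of the
    -- counters.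
    set g : ℕ → ℕ := fun i => if i < 17 then entry A.toList i else
      if i < 34 then entry X.toList (i - 17) else if i < 51 then entry Y.toList (i - 34) else
      if m then 0 else I.n with hg
    have hN := h.bound_eq
    refine sem_loops_search (J := SearchOK I N) (D := fun s => s.nat 3 0 0 = 1) (K := 52) (g := g)
      tryGuess_natWrites (fun i _ => ?_) (fun s b v hb hs => hs.setNat hb v)
      (fun s hs => hs.tryGuess) (fun s b v hb hs => ?_)
      (fun s hs => ⟨hs.1.tryGuess, tryGuess_keeps hs.1.1 hs.2⟩) (fun s hs hsg => ?_) 52 le_rfl s hJ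
      (fun i h1 h2 => by omega)
    · have h1 := entry_le A.toList i
      have h2 := entry_le X.toList (i - 17)
      have h3 := entry_le Y.toList (i - 34)
      simp only [hg]
      split_ifs <;> omega
    · rw [State.setNat_nat_of_ne _ (by omega)]; exact hs
    · refine tryGuess_of_isGuess hs.1 hw hguess ?_ (slots_eq_of_entry hA fun i hi => ?_)
        (slots_eq_of_entry hX fun i hi => ?_) (slots_eq_of_entry hY fun i hi => ?_)
      · rw [hsg 51 (by norm_num)]
        by_cases hm' : m
        · obtain ⟨v⟩ := hm hm'
          simpa [hg, hm'] using v.pos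
        · simp [hg, hm']
      · rw [hsg i (by omega)]
        simp [hg, hi]
      · rw [show 117 + i = 100 + (17 + i) by omega, hsg _ (by omega)]
        simp only [hg]
        rw [if_neg (by omega), if_pos (by omega), Nat.add_sub_cancel_left]
      · rw [show 134 + i = 100 + (34 + i) by omega, hsg _ (by omega)]
        simp only [hg]
        rw [if_neg (by omega), if_neg (by omega), if_pos (by omega), Nat.add_sub_cancel_left]
  · intro hno
    have := sem_loops_inv (a := 100) (J := SearchOK I N) (fun s b v hb hs => hs.setNat hb v)
      (fun s hs => hs.tryGuess) 52 s hJ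
    exact this.2.resolve_right fun h => hno h.2

/-- The algorithm without the computation of the loop bound. -/
def solve : Cmd := seq computeBig search

theorem solve_wf : solve.WF :=
  ⟨by simp [computeBig, WF, natWrites, asgR],
    wf_loops tryGuess_wf (by norm_num) tryGuess_natWrites 52⟩

theorem solve_spec (hG : I.G.AvoidsThreeP1AddP2) {N : ℕ} (hN : N = I.n + I.n + 2) :
    (I.IsYes → (solve.sem N (I.input.setNat 4 0 0 N)).nat 3 0 0 = 1) ∧
      (¬ I.IsYes → (solve.sem N (I.input.setNat 4 0 0 N)).nat 3 0 0 = 0) := by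
  refine search_spec hG ⟨fun a ha => ?_, fun a ha => ?_, ?_, hN, computeBig_spec rfl rfl hN⟩ ?_
  · rw [sem_nat computeBig _ (by simp [computeBig, natWrites, asgR]; omega),
      State.setNat_nat_of_ne _ (by omega)]
  · rw [sem_real computeBig _ (by simp [computeBig, realWrites, asgR]; omega), State.setNat_real]
  · rw [sem_nat computeBig _ (by decide)]; simp
  · rw [sem_nat computeBig _ (by decide)]; simp [WSFVS.input]

/-- The algorithm. -/
def solver : Program :=
  .seq (.setNat 4 (.const 0) (.const 0) (.add (.add (nv 0) (nv 0)) (.const 2))) solve.toProgram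

/-- The time is a polynomial in `N = 2n + 2`, hence the composition; the summand 20 covers the
assignment of the loop bound. -/
theorem decidedWithin_solver (hG : I.G.AvoidsThreeP1AddP2) :
    I.DecidedWithin solver ((solve.time.comp (2 * Polynomial.X + 2) + 20).eval I.n) := by
  obtain ⟨t, ht, hex⟩ := exec_toProgram solve_wf (N := I.n + I.n + 2)
    (s := I.input.setNat 4 0 0 (I.n + I.n + 2)) (by simp)
  have hset := Exec.setNat I.input 4 (.const 0) (.const 0)
    (.add (.add (nv 0) (nv 0)) (.const 2))
  simp only [NatExpr.eval, eval_nv, WSFVS.input_n] at hset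
  refine ⟨_, _, hset.seq hex, ?_, solve_spec hG rfl⟩
  rw [Polynomial.eval_add, Polynomial.eval_comp]
  simp only [NatExpr.cost, nv, Polynomial.eval_add, Polynomial.eval_X,
    Polynomial.eval_ofNat, two_mul]
  omega

end RAM

theorem mainTheorem4 : WSFVS.PolyTimeSolvableOnFree threeP1AddP2 :=
  ⟨RAM.solver, _, fun _ hG =>
    RAM.decidedWithin_solver (SimpleGraph.avoidsThreeP1AddP2_of_not_isIndContained hG)⟩
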